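/- Consider the equation $$u_{yy}=u_yu_{xx}-(u_x+u)u_{xy}+u_xu_y \qquad(\ast)$$ and let $\mathcal E$ be its infinite prolongation, with coordinates $x,\ y,\ u_k=\partial_x^k u,\ v_k=\partial_x^k u_y$ ($k\ge 0$), restricted to one of the two connected sets $\{u_y>0\}$, $\{u_y<0\}$. For an integer $p\neq 1$ let $\tau^p\colon\tilde{\mathcal E}\to\mathcal E$ be the infinite-dimensional covering with nonlocal variables $q_1,q_2,\dots$ defined by $$q_{i,y}=(-p-i+1)\,q_{i-1}-\frac{u_x+u}{u_y}\,q_{i-1,y}+\frac1{u_y}\,q_{i-2,y},\qquad q_{i,x}=\frac{q_{i-1,y}}{u_y}\qquad(i\ge 1),$$ where $q_{-1}=1$ and $q_0=-(p-1)y$; put $\tau^1=\tau^2$. Let $\tilde D_x,\tilde D_y$ be the total derivatives on $\tilde{\mathcal E}$. Functions on $\tilde{\mathcal E}$ are smooth functions of finitely many of the coordinates $x,y,u_k,v_k,q_i$. A nonlocal symmetry of $(\ast)$ in $\tau^p$ is a vector field (derivation of the algebra of functions) $S$ on $\tilde{\mathcal E}$ with $S(x)=S(y)=0$ that commutes with $\tilde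 D_x$ and $\tilde D_y$. Assign the weights $|x|=0$, $|y|=1$, $|u_k|=-1$, $|v_k|=-2$, $|q_i|=i+1$, let $E=\sum_z|z|\,z\,\partial/\partial z$ be the corresponding Euler field (the sum being over all coordinates $z$), and call $S$ homogeneous of weight $k\in\mathbb R$ if $[E,S]=kS$. By the Lie algebra of nonlocal symmetries in $\tau^p$ we mean the real Lie algebra, under the commutator, of all finite sums of homogeneous nonlocal symmetries. Then, for every integer $p$ and either sign of $u_y$, the Lie algebra of nonlocal symmetries of $(\ast)$ in $\tau^p$ is isomorphic to the direct sum $\mathfrak w\oplus\mathfrak s_2$, where $\mathfrak w=\operatorname{span}_{\mathbb R}\{z^{i+1}\,\partial/\partial z : i\in\mathbb Z\}$ is the Witt algebra and $\mathfrak s_2$ is the two-dimensional non-Abelian (solvable) real Lie algebra. -/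

import Mathlib

open scoped ContDiff

noncomputable section

namespace UHEReduction

/-! ### The space of the covering -/

/-- Coordinates on the covering space: the independent variables `x`, `y`, the internal jet
coordinates `u k = ∂ₓᵏ u` and `v k = ∂ₓᵏ u_y` of the equation
`u_yy = u_y u_xx - (u_x + u) u_xy + u_x u_y`, and the nonlocal variables;
the constructor `q n` is the nonlocal variable with subscript `n + 1`, so that the nonlocal
variables are `q₁, q₂, …`. -/
inductive Coord : Type
  | x : Coord
  | y : Coord
  | u (k : ℕ) : Coord
  | v (k : ℕ) : Coord
  | q (n : ℕ) : Coord
  deriving DecidableEq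

/-- The covering space: the connected open set of all points at which `u_y` is positive
(for `ε = 1`) or negative (for `ε = -1`). -/
def Domain (ε : ℤˣ) : Set (Coord → ℝ) :=
  {θ | 0 < ((ε : ℤ) : ℝ) * θ (Coord.v 0)}

variable {ε : ℤˣ}

/-- A function is smooth if it is a smooth function of finitely many coordinates. -/
def IsSmooth (f : Domain ε → ℝ) : Prop :=
  ∃ (s : Finset Coord) (g : (s → ℝ) → ℝ),
    (∀ θ : Domain ε, ContDiffAt ℝ ∞ g (s.restrict θ.1)) ∧ ∀ θ : Domain ε, f θ = g (s.restrict θ.1)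

theorem IsSmooth.enlarge {f : Domain ε → ℝ} {s t : Finset Coord} (hst : s ⊆ t)
    {g : (s → ℝ) → ℝ} (hg : ∀ θ : Domain ε, ContDiffAt ℝ ∞ g (s.restrict θ.1))
    (hf : ∀ θ : Domain ε, f θ = g (s.restrict θ.1)) :
    ∃ g' : (t → ℝ) → ℝ, (∀ θ : Domain ε, ContDiffAt ℝ ∞ g' (t.restrict θ.1)) ∧
      ∀ θ : Domain ε, f θ = g' (t.restrict θ.1) := by
  refine ⟨fun z => g (fun c => z ⟨c.1, hst c.2⟩), fun θ => ?_, fun θ => hf θ⟩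
  have h : ContDiff ℝ ∞ (fun (z : t → ℝ) (c : s) => z ⟨c.1, hst c.2⟩) := by fun_prop
  exact ContDiffAt.comp (t.restrict θ.1) (hg θ) h.contDiffAt

theorem isSmooth_const (r : ℝ) : IsSmooth (fun _ : Domain ε => r) :=
  ⟨∅, fun _ => r, fun _ => contDiffAt_const, fun _ => rfl⟩

theorem isSmooth_coord (c : Coord) : IsSmooth (fun θ : Domain ε => θ.1 c) :=
  ⟨{c}, fun z => z ⟨c, Finset.mem_singleton_self c⟩, fun _ => by fun_prop, fun _ => rfl⟩

theorem IsSmooth.add {f₁ f₂ : Domain ε → ℝ} (h₁ : IsSmooth f₁) (h₂ : IsSmooth f₂) :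
    IsSmooth (f₁ + f₂) := by
  obtain ⟨s₁, g₁, hg₁, e₁⟩ := h₁
  obtain ⟨s₂, g₂, hg₂, e₂⟩ := h₂
  obtain ⟨k₁, hk₁, d₁⟩ := IsSmooth.enlarge (Finset.subset_union_left (s₂ := s₂)) hg₁ e₁
  obtain ⟨k₂, hk₂, d₂⟩ := IsSmooth.enlarge (Finset.subset_union_right (s₁ := s₁)) hg₂ e₂
  exact ⟨s₁ ∪ s₂, fun z => k₁ z + k₂ z, fun θ => (hk₁ θ).add (hk₂ θ), fun θ => by
    simp [d₁ θ, d₂ θ]⟩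

theorem IsSmooth.mul {f₁ f₂ : Domain ε → ℝ} (h₁ : IsSmooth f₁) (h₂ : IsSmooth f₂) :
    IsSmooth (f₁ * f₂) := by
  obtain ⟨s₁, g₁, hg₁, e₁⟩ := h₁
  obtain ⟨s₂, g₂, hg₂, e₂⟩ := h₂
  obtain ⟨k₁, hk₁, d₁⟩ := IsSmooth.enlarge (Finset.subset_union_left (s₂ := s₂)) hg₁ e₁
  obtain ⟨k₂, hk₂, d₂⟩ := IsSmooth.enlarge (Finset.subset_union_right (s₁ := s₁)) hg₂ e₂
  exact ⟨s₁ ∪ s₂, fun z => k₁ z * k₂ z, fun θ => (hk₁ θ).mul (hk₂ θ), fun θ => by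
    simp [d₁ θ, d₂ θ]⟩

theorem Domain.ne_zero (θ : Domain ε) : θ.1 (Coord.v 0) ≠ 0 := by
  intro h
  have h2 : 0 < ((ε : ℤ) : ℝ) * θ.1 (Coord.v 0) := θ.2
  rw [h, mul_zero] at h2
  exact lt_irrefl _ h2

theorem isSmooth_inv_v : IsSmooth (fun θ : Domain ε => (θ.1 (Coord.v 0))⁻¹) :=
  ⟨{Coord.v 0}, fun z => (z ⟨Coord.v 0, Finset.mem_singleton_self _⟩)⁻¹,
    fun θ => ContDiffAt.inv (by fun_prop) (Domain.ne_zero θ), fun _ => rfl⟩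

/-- The smooth functions on the covering space, as a subalgebra of all real functions. -/
def smoothFun (ε : ℤˣ) : Subalgebra ℝ (Domain ε → ℝ) where
  carrier := {f | IsSmooth f}
  mul_mem' := IsSmooth.mul
  add_mem' := IsSmooth.add
  algebraMap_mem' := isSmooth_const

/-- The `ℝ`-algebra of smooth functions on the covering space. -/
def Fun (ε : ℤˣ) : Type := smoothFun ε

instance (ε : ℤˣ) : CommRing (Fun ε) := inferInstanceAs (CommRing (smoothFun ε))

instance (ε : ℤˣ) : Algebra ℝ (Fun ε) := inferInstanceAs (Algebra ℝ (smoothFun ε))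

/-- The coordinate functions. -/
def coord (ε : ℤˣ) (c : Coord) : Fun ε := ⟨fun θ => θ.1 c, isSmooth_coord c⟩

/-- The function `1 / u_y`. -/
def invUy (ε : ℤˣ) : Fun ε := ⟨fun θ => (θ.1 (Coord.v 0))⁻¹, isSmooth_inv_v⟩

/-! ### Vector fields -/

/-- The partial derivative of `f` with respect to the coordinate `c` at the point `θ`. (Only the
values of `f` near `θ` matter, so the extension of `f` by zero is immaterial.) -/
def partialAt (c : Coord) (f : Domain ε → ℝ) (θ : Domain ε) : ℝ :=
  deriv (fun t : ℝ => Function.extend Subtype.val f 0 (Function.update θ.1 c t)) (θ.1 c)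

theorem hasDerivAt_extend (c : Coord) {f : Domain ε → ℝ} {s : Finset Coord}
    {g : (s → ℝ) → ℝ} (hg : ∀ θ : Domain ε, ContDiffAt ℝ ∞ g (s.restrict θ.1))
    (hf : ∀ θ : Domain ε, f θ = g (s.restrict θ.1)) (θ : Domain ε) :
    HasDerivAt (fun t : ℝ => Function.extend Subtype.val f 0 (Function.update θ.1 c t))
      (fderiv ℝ g (s.restrict θ.1) (fun d => if d.1 = c then 1 else 0)) (θ.1 c) := by
  have hpath : HasDerivAt (fun t : ℝ => s.restrict (Function.update θ.1 c t))
      (fun d : s => if d.1 = c then (1 : ℝ) else 0) (θ.1 c) := by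
    rw [hasDerivAt_pi]
    intro d
    by_cases h : d.1 = c
    · simp only [Finset.restrict, h, Function.update_self, if_true]
      exact hasDerivAt_id _
    · simp only [Finset.restrict, h, if_false, ne_eq, not_false_eq_true, Function.update_of_ne]
      exact hasDerivAt_const _ _
  have hself : s.restrict (Function.update θ.1 c (θ.1 c)) = s.restrict θ.1 := by
    rw [Function.update_eq_self]
  have hd : HasFDerivAt g (fderiv ℝ g (s.restrict θ.1))
      (s.restrict (Function.update θ.1 c (θ.1 c))) := by
    rw [hself]
    exact ((hg θ).differentiableAt (by simp)).hasFDerivAt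
  refine (hd.comp_hasDerivAt (θ.1 c) hpath).congr_of_eventuallyEq ?_
  have hcont : Continuous fun t : ℝ =>
      ((ε : ℤ) : ℝ) * Function.update θ.1 c t (Coord.v 0) := by
    refine continuous_const.mul ?_
    exact (continuous_apply (A := fun _ : Coord => ℝ) (Coord.v 0)).comp
      (continuous_const.update c continuous_id)
  have hmem : ∀ᶠ t in nhds (θ.1 c), Function.update θ.1 c t ∈ Domain ε := by
    refine (isOpen_Ioi.preimage hcont).mem_nhds (x := θ.1 c) ?_
    have h0 : (0 : ℝ) < ((ε : ℤ) : ℝ) * θ.1 (Coord.v 0) := θ.2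
    simpa only [Set.mem_preimage, Set.mem_Ioi, Function.update_eq_self] using h0
  filter_upwards [hmem] with t ht
  have := Subtype.val_injective.extend_apply f 0 (⟨_, ht⟩ : Domain ε)
  simpa using this.trans (hf ⟨_, ht⟩)

theorem partialAt_eq (c : Coord) {f : Domain ε → ℝ} {s : Finset Coord}
    {g : (s → ℝ) → ℝ} (hg : ∀ θ : Domain ε, ContDiffAt ℝ ∞ g (s.restrict θ.1))
    (hf : ∀ θ : Domain ε, f θ = g (s.restrict θ.1)) (θ : Domain ε) :
    partialAt c f θ = fderiv ℝ g (s.restrict θ.1) (fun d => if d.1 = c then 1 else 0) :=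
  (hasDerivAt_extend c hg hf θ).deriv

theorem partialAt_eq_zero {c : Coord} {f : Domain ε → ℝ} {s : Finset Coord}
    {g : (s → ℝ) → ℝ} (hg : ∀ θ : Domain ε, ContDiffAt ℝ ∞ g (s.restrict θ.1))
    (hf : ∀ θ : Domain ε, f θ = g (s.restrict θ.1)) (hc : c ∉ s) :
    partialAt c f = 0 := by
  funext θ
  rw [partialAt_eq c hg hf]
  have : (fun d : s => if d.1 = c then (1 : ℝ) else 0) = 0 := by
    funext d
    have : d.1 ≠ c := fun h => hc (h ▸ d.2)
    simp [this]
  simp [this]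

theorem IsSmooth.partialAt {f : Domain ε → ℝ} (h : IsSmooth f) (c : Coord) :
    IsSmooth (partialAt c f) := by
  obtain ⟨s, g, hg, hf⟩ := h
  refine ⟨s, fun z => fderiv ℝ g z (fun d => if d.1 = c then 1 else 0), fun θ => ?_,
    partialAt_eq c hg hf⟩
  exact ((hg θ).fderiv_right (m := ∞) (by simp)).clm_apply contDiffAt_const

theorem IsSmooth.hasDerivAt {f : Domain ε → ℝ} (h : IsSmooth f) (c : Coord) (θ : Domain ε) :
    HasDerivAt (fun t : ℝ => Function.extend Subtype.val f 0 (Function.update θ.1 c t))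
      (UHEReduction.partialAt c f θ) (θ.1 c) := by
  obtain ⟨s, g, hg, hf⟩ := h
  rw [partialAt_eq c hg hf θ]
  exact hasDerivAt_extend c hg hf θ

theorem extend_update_self (f : Domain ε → ℝ) (c : Coord) (θ : Domain ε) :
    Function.extend Subtype.val f 0 (Function.update θ.1 c (θ.1 c)) = f θ := by
  rw [Function.update_eq_self]
  exact Subtype.val_injective.extend_apply f 0 θ

theorem extend_add (f₁ f₂ : Domain ε → ℝ) (z : Coord → ℝ) :
    Function.extend Subtype.val (f₁ + f₂) 0 z =
      Function.extend Subtype.val f₁ 0 z + Function.extend Subtype.val f₂ 0 z := by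
  by_cases hz : z ∈ Domain ε
  · have e := fun f : Domain ε → ℝ => Subtype.val_injective.extend_apply f 0 (⟨z, hz⟩ : Domain ε)
    simp only at e
    rw [e, e, e, Pi.add_apply]
  · have e := fun f : Domain ε → ℝ => Function.extend_apply' (f := Subtype.val) f 0 z
      (by rintro ⟨a, rfl⟩; exact hz a.2)
    rw [e, e, e]
    simp

theorem extend_mul (f₁ f₂ : Domain ε → ℝ) (z : Coord → ℝ) :
    Function.extend Subtype.val (f₁ * f₂) 0 z =
      Function.extend Subtype.val f₁ 0 z * Function.extend Subtype.val f₂ 0 z := by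
  by_cases hz : z ∈ Domain ε
  · have e := fun f : Domain ε → ℝ => Subtype.val_injective.extend_apply f 0 (⟨z, hz⟩ : Domain ε)
    simp only at e
    rw [e, e, e, Pi.mul_apply]
  · have e := fun f : Domain ε → ℝ => Function.extend_apply' (f := Subtype.val) f 0 z
      (by rintro ⟨a, rfl⟩; exact hz a.2)
    rw [e, e, e]
    simp

theorem partialAt_add {f₁ f₂ : Domain ε → ℝ} (h₁ : IsSmooth f₁) (h₂ : IsSmooth f₂) (c : Coord) :
    partialAt c (f₁ + f₂) = partialAt c f₁ + partialAt c f₂ := by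
  funext θ
  have h := (h₁.hasDerivAt c θ).add (h₂.hasDerivAt c θ)
  rw [Pi.add_apply, ← h.deriv]
  unfold partialAt
  congr 1
  funext t
  exact extend_add f₁ f₂ _

theorem partialAt_mul {f₁ f₂ : Domain ε → ℝ} (h₁ : IsSmooth f₁) (h₂ : IsSmooth f₂) (c : Coord) :
    partialAt c (f₁ * f₂) = f₁ * partialAt c f₂ + f₂ * partialAt c f₁ := by
  funext θ
  have h := (h₁.hasDerivAt c θ).mul (h₂.hasDerivAt c θ)
  rw [extend_update_self, extend_update_self] at h
  have e : partialAt c (f₁ * f₂) θ =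
      partialAt c f₁ θ * f₂ θ + f₁ θ * partialAt c f₂ θ := by
    rw [← h.deriv]
    unfold partialAt
    congr 1
    funext t
    exact extend_mul f₁ f₂ _
  simp only [Pi.add_apply, Pi.mul_apply, e]
  ring

theorem partialAt_const (r : ℝ) (c : Coord) :
    partialAt c (fun _ : Domain ε => r) = 0 :=
  partialAt_eq_zero (s := ∅) (g := fun _ => r) (fun _ => contDiffAt_const) (fun _ => rfl)
    (Finset.notMem_empty c)

/-- The coordinate vector field `∂/∂c`. -/
def pd (ε : ℤˣ) (c : Coord) : Derivation ℝ (Fun ε) (Fun ε) :=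
  Derivation.mk'
    { toFun := fun f => ⟨partialAt c f.1, IsSmooth.partialAt f.2 c⟩
      map_add' := fun f g => Subtype.ext (partialAt_add f.2 g.2 c)
      map_smul' := fun r f => Subtype.ext (by
        have h := partialAt_mul (isSmooth_const (ε := ε) r) f.2 c
        rw [partialAt_const, mul_zero, add_zero] at h
        exact h) }
    (fun f g => Subtype.ext (partialAt_mul f.2 g.2 c))

theorem pd_support_finite (f : Fun ε) : (Function.support fun c => pd ε c f).Finite := by
  obtain ⟨s, g, hg, hf⟩ := f.2
  refine s.finite_toSet.subset fun c hc => ?_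
  by_contra h
  exact hc (Subtype.ext (partialAt_eq_zero hg hf h))

theorem mul_pd_support_finite (a : Coord → Fun ε) (f : Fun ε) :
    (Function.support fun c => a c * pd ε c f).Finite :=
  (pd_support_finite f).subset fun c hc h => hc (by simp only [h, mul_zero])

/-- The vector field `∑ a_c ∂/∂c`, the sum being over all coordinates `c`. On each smooth function
it is a finite sum. -/
def vectorField (a : Coord → Fun ε) : Derivation ℝ (Fun ε) (Fun ε) :=
  Derivation.mk'
    { toFun := fun f => ∑ᶠ c, a c * pd ε c f
      map_add' := fun f g => by
        rw [← finsum_add_distrib (mul_pd_support_finite a f) (mul_pd_support_finite a g)]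
        simp only [map_add, mul_add]
      map_smul' := fun r f => by
        rw [RingHom.id_apply, smul_finsum' r (mul_pd_support_finite a f)]
        simp only [Derivation.map_smul, mul_smul_comm] }
    (fun f g => by
      have hf := mul_pd_support_finite a f
      have hg := mul_pd_support_finite a g
      have hf' : (Function.support fun c => g * (a c * pd ε c f)).Finite :=
        hf.subset fun c hc h => hc (by simp only [h, mul_zero])
      have hg' : (Function.support fun c => f * (a c * pd ε c g)).Finite :=
        hg.subset fun c hc h => hc (by simp only [h, mul_zero])
      simp only [LinearMap.coe_mk, AddHom.coe_mk, smul_eq_mul]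
      rw [mul_finsum' _ f hg, mul_finsum' _ g hf, ← finsum_add_distrib hg' hf']
      refine finsum_congr fun c => ?_
      rw [Derivation.leibniz]
      simp only [smul_eq_mul]
      ring)

/-! ### The equation and the covering `τᵖ` -/

/-- `Q p m` is the function `q_{m-1}`: thus `q_{-1} = 1`, `q_0 = -(p - 1) y`, and `q_1, q_2, …`
are the nonlocal variables. -/
def Q (ε : ℤˣ) (p : ℤ) : ℕ → Fun ε
  | 0 => 1
  | 1 => (-((p : ℝ) - 1)) • coord ε Coord.y
  | n + 2 => coord ε (Coord.q n)

/-- `Qy p m` is the function `q_{m-1,y}`, that is, `q_{-1,y} = 0`, `q_{0,y} = -(p - 1)` and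
`q_{i,y} = (-p - i + 1) q_{i-1} - (u_x + u) / u_y * q_{i-1,y} + 1 / u_y * q_{i-2,y}`
for `i = n + 1 ≥ 1`. -/
def Qy (ε : ℤˣ) (p : ℤ) : ℕ → Fun ε
  | 0 => 0
  | 1 => algebraMap ℝ (Fun ε) (-((p : ℝ) - 1))
  | n + 2 =>
      (-(p : ℝ) - ((n : ℝ) + 1) + 1) • Q ε p (n + 1)
        - (coord ε (Coord.u 1) + coord ε (Coord.u 0)) * invUy ε * Qy ε p (n + 1)
        + invUy ε * Qy ε p n

/-- The total derivative with respect to `x` on the covering; on the nonlocal variables it is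
given by `q_{i,x} = q_{i-1,y} / u_y`, `i ≥ 1`. -/
def Dx (ε : ℤˣ) (p : ℤ) : Derivation ℝ (Fun ε) (Fun ε) :=
  vectorField fun c => match c with
    | Coord.x => 1
    | Coord.y => 0
    | Coord.u k => coord ε (Coord.u (k + 1))
    | Coord.v k => coord ε (Coord.v (k + 1))
    | Coord.q n => invUy ε * Qy ε p (n + 1)

/-- The right-hand side `u_y u_xx - (u_x + u) u_xy + u_x u_y` of the equation. -/
def rhs (ε : ℤˣ) : Fun ε :=
  coord ε (Coord.v 0) * coord ε (Coord.u 2)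
    - (coord ε (Coord.u 1) + coord ε (Coord.u 0)) * coord ε (Coord.v 1)
    + coord ε (Coord.u 1) * coord ε (Coord.v 0)

/-- The total derivative with respect to `y` on the covering. -/
def Dy (ε : ℤˣ) (p : ℤ) : Derivation ℝ (Fun ε) (Fun ε) :=
  vectorField fun c => match c with
    | Coord.x => 0
    | Coord.y => 1
    | Coord.u k => coord ε (Coord.v k)
    | Coord.v k => (Dx ε p)^[k] (rhs ε)
    | Coord.q n => Qy ε p (n + 2)

/-- The Lie algebra of all symmetries of the covering equation: the vector fields `S` that are
vertical with respect to the projection to the `(x, y)`-plane and commute with both total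
derivatives. With `φ = S u` and `ψⁱ = S qᵢ`, these are exactly the fields
`∑ D_σ(φ) ∂/∂u_σ + ∑ ψⁱ ∂/∂qᵢ` for which `(φ, ψ¹, ψ², …)` solves the linearization of the
equation and of the defining relations of the covering. -/
def symmetries (ε : ℤˣ) (p : ℤ) : LieSubalgebra ℝ (Derivation ℝ (Fun ε) (Fun ε)) where
  carrier := {S | S (coord ε Coord.x) = 0 ∧ S (coord ε Coord.y) = 0 ∧
    (∀ f, S (Dx ε p f) = Dx ε p (S f)) ∧ ∀ f, S (Dy ε p f) = Dy ε p (S f)}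
  add_mem' := by
    rintro S T ⟨h₁, h₂, h₃, h₄⟩ ⟨k₁, k₂, k₃, k₄⟩
    refine ⟨?_, ?_, fun f => ?_, fun f => ?_⟩
    · rw [Derivation.add_apply, h₁, k₁, add_zero]
    · rw [Derivation.add_apply, h₂, k₂, add_zero]
    · rw [Derivation.add_apply, Derivation.add_apply, h₃, k₃, map_add]
    · rw [Derivation.add_apply, Derivation.add_apply, h₄, k₄, map_add]
  zero_mem' := by
    refine ⟨rfl, rfl, fun f => ?_, fun f => ?_⟩
    · rw [Derivation.zero_apply, Derivation.zero_apply, map_zero]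
    · rw [Derivation.zero_apply, Derivation.zero_apply, map_zero]
  smul_mem' := by
    rintro r S ⟨h₁, h₂, h₃, h₄⟩
    refine ⟨?_, ?_, fun f => ?_, fun f => ?_⟩
    · rw [Derivation.smul_apply, h₁, smul_zero]
    · rw [Derivation.smul_apply, h₂, smul_zero]
    · rw [Derivation.smul_apply, Derivation.smul_apply, h₃, Derivation.map_smul]
    · rw [Derivation.smul_apply, Derivation.smul_apply, h₄, Derivation.map_smul]
  lie_mem' := by
    rintro S T ⟨h₁, h₂, h₃, h₄⟩ ⟨k₁, k₂, k₃, k₄⟩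
    refine ⟨?_, ?_, fun f => ?_, fun f => ?_⟩
    · rw [Derivation.commutator_apply, h₁, k₁, map_zero, map_zero, sub_zero]
    · rw [Derivation.commutator_apply, h₂, k₂, map_zero, map_zero, sub_zero]
    · rw [Derivation.commutator_apply, Derivation.commutator_apply, h₃, k₃, h₃, k₃, map_sub]
    · rw [Derivation.commutator_apply, Derivation.commutator_apply, h₄, k₄, h₄, k₄, map_sub]

/-- The Euler field of the weights `|x| = 0`, `|y| = 1`, `|u| = -1`, `|u_y| = -2` (the same for
the derivatives with respect to `x`) and `|qᵢ| = i + 1`. -/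
def euler (ε : ℤˣ) : Derivation ℝ (Fun ε) (Fun ε) :=
  vectorField fun c => match c with
    | Coord.x => 0
    | Coord.y => coord ε Coord.y
    | Coord.u k => (-1 : ℝ) • coord ε (Coord.u k)
    | Coord.v k => (-2 : ℝ) • coord ε (Coord.v k)
    | Coord.q n => ((n : ℝ) + 2) • coord ε (Coord.q n)

/-- The Lie algebra of those symmetries that are finite sums of weight-homogeneous symmetries;
a field `S` is homogeneous of weight `k` if `[E, S] = k S` for the Euler field `E`, so that
`f ∂/∂z` has weight `|f| - |z|`. -/
def gradedSymmetries (ε : ℤˣ) (p : ℤ) : LieSubalgebra ℝ (Derivation ℝ (Fun ε) (Fun ε)) where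
  toSubmodule := Submodule.span ℝ {S | S ∈ symmetries ε p ∧ ∃ k : ℝ, ∀ f, euler ε (S f) - S (euler ε f) = k • S f}
  lie_mem' := by
    intro S T hS hT
    refine Submodule.span_induction₂
      (p := fun S T _ _ => ⁅S, T⁆ ∈ Submodule.span ℝ
        {S | S ∈ symmetries ε p ∧ ∃ k : ℝ, ∀ f, euler ε (S f) - S (euler ε f) = k • S f})
      ?_ ?_ ?_ ?_ ?_ ?_ ?_ hS hT
    · rintro S T ⟨hS, k, hk⟩ ⟨hT, l, hl⟩
      refine Submodule.subset_span ⟨LieSubalgebra.lie_mem _ hS hT, k + l, fun f => ?_⟩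
      have e₁ : ∀ g, euler ε (S g) = S (euler ε g) + k • S g := fun g => by
        rw [← hk g]; abel
      have e₂ : ∀ g, euler ε (T g) = T (euler ε g) + l • T g := fun g => by
        rw [← hl g]; abel
      simp only [Derivation.commutator_apply, map_sub, e₁, e₂, map_add, Derivation.map_smul,
        add_smul, smul_sub]
      abel
    · intro T _
      simp
    · intro S _
      simp
    · intro S₁ S₂ T _ _ _ h₁ h₂
      rw [add_lie]
      exact add_mem h₁ h₂
    · intro S T₁ T₂ _ _ _ h₁ h₂
      rw [lie_add]
      exact add_mem h₁ h₂
    · intro r S T _ _ h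
      rw [smul_lie]
      exact Submodule.smul_mem _ r h
    · intro r S T _ _ h
      rw [lie_smul]
      exact Submodule.smul_mem _ r h

/-- The Lie algebra of nonlocal symmetries in the covering `τᵖ`. The recursion above defines `τᵖ`
for `p ≠ 1`; for `p = 1` it would make `q₁` a constant, and `τ¹` is by convention the same covering
as `τ²`. -/
def nonlocalSymmetries (ε : ℤˣ) (p : ℤ) : LieSubalgebra ℝ (Derivation ℝ (Fun ε) (Fun ε)) :=
  gradedSymmetries ε (if p = 1 then 2 else p)

/-! ### The model Lie algebras -/

/-- The Witt algebra: the Lie algebra of polynomial vector fields `f(z) ∂/∂z` on the punctured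
line, where `f` is a real Laurent polynomial. -/
abbrev WittAlgebra : Type := Derivation ℝ (LaurentPolynomial ℝ) (LaurentPolynomial ℝ)

section

attribute [local instance 100] LieRing.ofAssociativeRing

/-- The two-dimensional (non-Abelian) solvable Lie algebra, realised by the real matrices
`!![a, b; 0, 0]`. -/
def s2 : LieSubalgebra ℝ (Matrix (Fin 2) (Fin 2) ℝ) where
  carrier := {A | A 1 0 = 0 ∧ A 1 1 = 0}
  add_mem' := by
    rintro A B ⟨h₁, h₂⟩ ⟨k₁, k₂⟩
    simp [h₁, h₂, k₁, k₂]
  zero_mem' := by simp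
  smul_mem' := by
    rintro r A ⟨h₁, h₂⟩
    simp [h₁, h₂]
  lie_mem' := by
    rintro A B ⟨h₁, h₂⟩ ⟨k₁, k₂⟩
    simp [Ring.lie_def, Matrix.mul_apply, h₁, h₂, k₁, k₂]

end

end UHEReduction

end

noncomputable section

namespace UHEReduction

/-! Put s = u_x + u. The equation reads u_yy = u_y s_x - s u_xy. Let a, b be the roots of X² - sX -
u_y, let α = 1/a, β = 1/b, and let d = β D_y + D_x, d' = α D_y + D_x be the characteristic fields.
The nonlocal variables are collected in ρ = Σ q_{i-1} λ^i, with H = (p-1)ρ + λρ' and Δ = u_y + sλ -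
λ². For a symmetry S put P₀ = S(u) and define P₁, P₂, … by Δ·S(ρ) = λ²(Σ P_{i+1} λ^i) H. Symmetries
then correspond exactly to solutions of two first-order recurrences, the chains (`IsChain`,
`HasChain.isChain`, `IsChain.exists_symmetry`).

Existence. Let W be the power series with W^{p-1} = ρ. The series (p-1) Δ W^{k+p-1} / H, multiplied
by λ^{k-2}, solves the homogeneous form of the recurrences, and its coefficients from λ^{-1} on form
a chain for every integer k (`isChain_fundChain`). The resulting symmetry `fundSym k` has weight -k.
For k ≥ 2 it acts on z = λW as -z^{k+1} ∂/∂z, which explains the Witt algebra. Two more symmetries,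
D_x - ∂/∂x and the one with u-component e^{-x}, span the two-dimensional summand.

Completeness. Since dα and d'β are functions of α and β alone, x, y, u, the functions dᵏβ and d'ᵏα,
and the nonlocal variables form coordinates after the roots are adjoined. Along d and d' the
recurrences become `d_chain` and `d_swap_chain`. A leading derivative of a chain satisfies an
equation d'g = μg, where μ has a double pole at α = β. But d'(dˡβ) has a pole of order 2l + 1 there,
and the orders never match, so g = 0 (`eq_zero_of_d_swap_eq`). Hence a chain involves no dᵏβ or d'ᵏα
with k ≥ 1, and by the same argument it is affine in a and in b. It follows that P_i = c_{i+2} u_y +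
c_{i+1} s - c_i with c_i functions of x, y, u and the q's (`IsChain.exists_coefficients`). Expanding
in the transcendental element β gives relations for the c_i under fields τ_n that satisfy half of
the Witt relations (`IsChain.isCoefficients`).

In these relations τ_n c_j is affine along the diagonals j - n = const, vanishes on all sufficiently
low ones, and is constant on the first nonzero one. Constants have weight zero, so the weight of S
singles out that diagonal, and the commutators of the τ_n leave one free parameter
(`IsCoefficients.proportional`). If all c_{i+3} vanish, only the two extra symmetries remain.

Brackets. For k ≥ 2 and any l, the bracket of `fundSym k` and `fundSym l` is computed directly. For
arbitrary indices the defect of the Witt relation is homogeneous, so the classification leaves three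
unknown coefficients; brackets with the two extra symmetries and with a high `fundSym n` show that
they vanish (`fundSym_lie_fundSym`). -/

/-! ### Averages over segments and Hadamard's lemma -/

open Set Metric in
/-- Smoothness of integrals over segments from a fixed point. -/
theorem contDiffOn_nat_integral_segment {E : Type} [NormedAddCommGroup E] [NormedSpace ℝ E]
    [FiniteDimensional ℝ E] {V : Set E} (hV : IsOpen V) (hc : Convex ℝ V) {z₀ : E} (hz₀ : z₀ ∈ V)
    (n : ℕ) : ∀ {F : Type} [NormedAddCommGroup F] [NormedSpace ℝ F] [CompleteSpace F]
    (G : E → F) (w : ℝ → ℝ), Continuous w → ContDiffOn ℝ ∞ G V →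
    ContDiffOn ℝ n (fun z => ∫ t in (0 : ℝ)..1, w t • G (z₀ + t • (z - z₀))) V := by
  have hseg : ∀ z ∈ V, ∀ t ∈ Icc (0 : ℝ) 1, z₀ + t • (z - z₀) ∈ V := fun z hz t ht =>
    hc.add_smul_sub_mem hz₀ hz ht
  have key : ∀ {F : Type} [NormedAddCommGroup F] [NormedSpace ℝ F] [CompleteSpace F]
      (G : E → F) (w : ℝ → ℝ), Continuous w → ContDiffOn ℝ ∞ G V → ∀ z ∈ V,
      HasFDerivAt (fun z => ∫ t in (0 : ℝ)..1, w t • G (z₀ + t • (z - z₀)))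
        (∫ t in (0 : ℝ)..1, (w t * t) • fderiv ℝ G (z₀ + t • (z - z₀))) z := by
    intro F _ _ _ G w hw hG z hz
    have hG1 : ContinuousOn (fderiv ℝ G) V :=
      (hG.fderiv_of_isOpen hV (m := 0) (by simp)).continuousOn
    obtain ⟨r, hr, hball⟩ := nhds_basis_closedBall.mem_iff.1 (hV.mem_nhds hz)
    have hpath : ∀ z ∈ V, ContinuousOn (fun t : ℝ => z₀ + t • (z - z₀)) (Icc 0 1) :=
      fun z _ => by fun_prop
    have hcont : ∀ z ∈ V, ContinuousOn (fun t : ℝ => w t • G (z₀ + t • (z - z₀))) (Icc 0 1) :=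
      fun z hz => hw.continuousOn.smul (hG.continuousOn.comp (hpath z hz) (hseg z hz))
    have hcont' : ∀ z ∈ V, ContinuousOn
        (fun t : ℝ => (w t * t) • fderiv ℝ G (z₀ + t • (z - z₀))) (Icc 0 1) :=
      fun z hz => (hw.mul continuous_id).continuousOn.smul (hG1.comp (hpath z hz) (hseg z hz))
    have hK : IsCompact ((Icc (0 : ℝ) 1) ×ˢ closedBall z r) :=
      isCompact_Icc.prod (isCompact_closedBall z r)
    have hcK : ContinuousOn (fun a : ℝ × E => (w a.1 * a.1) • fderiv ℝ G (z₀ + a.1 • (a.2 - z₀)))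
        ((Icc (0 : ℝ) 1) ×ˢ closedBall z r) := by
      have hw1 : ContinuousOn (fun a : ℝ × E => w a.1 * a.1) ((Icc (0 : ℝ) 1) ×ˢ closedBall z r) :=
        ((hw.comp continuous_fst).mul continuous_fst).continuousOn
      have hp1 : ContinuousOn (fun a : ℝ × E => z₀ + a.1 • (a.2 - z₀))
          ((Icc (0 : ℝ) 1) ×ˢ closedBall z r) := by fun_prop
      refine hw1.smul (hG1.comp hp1 ?_)
      rintro ⟨t, z'⟩ ⟨ht, hz'⟩
      exact hseg z' (hball hz') t ht
    obtain ⟨B, hB⟩ := hK.exists_bound_of_continuousOn hcK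
    have hIoc : uIoc (0 : ℝ) 1 = Ioc 0 1 := uIoc_of_le zero_le_one
    have hmeas : ∀ {F' : Type} [NormedAddCommGroup F'] {h : ℝ → F'}, ContinuousOn h (Icc 0 1) →
        MeasureTheory.AEStronglyMeasurable h (MeasureTheory.volume.restrict (uIoc (0 : ℝ) 1)) := by
      intro F' _ h hh
      rw [hIoc]
      exact ((hh.mono Ioc_subset_Icc_self).aestronglyMeasurable measurableSet_Ioc)
    refine intervalIntegral.hasFDerivAt_integral_of_dominated_of_fderiv_le
      (F' := fun z t => (w t * t) • fderiv ℝ G (z₀ + t • (z - z₀))) (bound := fun _ => B)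
      (closedBall_mem_nhds z hr) ?_ ?_ ?_ ?_ ?_ ?_
    · filter_upwards [hV.mem_nhds hz] with z' hz' using hmeas (hcont z' hz')
    · exact (hcont z hz).intervalIntegrable_of_Icc zero_le_one
    · exact hmeas (hcont' z hz)
    · refine Filter.Eventually.of_forall fun t ht z' hz' => ?_
      rw [hIoc] at ht
      exact hB (t, z') ⟨Ioc_subset_Icc_self ht, hz'⟩
    · exact intervalIntegrable_const
    · refine Filter.Eventually.of_forall fun t ht z' hz' => ?_
      rw [hIoc] at ht
      have h1 : HasFDerivAt (fun z : E => z₀ + t • (z - z₀)) (t • ContinuousLinearMap.id ℝ E) z' :=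
        (((hasFDerivAt_id z').sub_const z₀).const_smul t).const_add z₀
      have hm := hseg z' (hball hz') t (Ioc_subset_Icc_self ht)
      have h2 := ((hG.contDiffAt (hV.mem_nhds hm)).differentiableAt (by simp)).hasFDerivAt
      have h3 := (h2.comp z' h1).const_smul (w t)
      refine h3.congr_fderiv ?_
      ext y
      simp [mul_smul]
  -- Differentiation under the integral replaces `G` by `fderiv ℝ G` and the weight `w t` by `w t *
  -- t`, so the induction has to range over all targets and weights.
  induction n with
  | zero =>
    intro F _ _ _ G w hw hG
    exact contDiffOn_zero.2 fun z hz => (key G w hw hG z hz).continuousAt.continuousWithinAt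
  | succ n ih =>
    intro F _ _ _ G w hw hG
    rw [Nat.cast_succ, contDiffOn_succ_iff_fderiv_of_isOpen hV]
    refine ⟨fun z hz => (key G w hw hG z hz).differentiableAt.differentiableWithinAt,
      by simp, ?_⟩
    refine (ih (fderiv ℝ G) (fun t => w t * t) (hw.mul continuous_id)
      (hG.fderiv_of_isOpen hV (m := ∞) (by simp))).congr fun z hz => ?_
    exact (key G w hw hG z hz).fderiv

theorem contDiffOn_integral_segment {E F : Type} [NormedAddCommGroup E] [NormedSpace ℝ E]
    [FiniteDimensional ℝ E] [NormedAddCommGroup F] [NormedSpace ℝ F] [CompleteSpace F]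
    {V : Set E} (hV : IsOpen V) (hc : Convex ℝ V) {z₀ : E} (hz₀ : z₀ ∈ V)
    {G : E → F} (hG : ContDiffOn ℝ ∞ G V) :
    ContDiffOn ℝ ∞ (fun z => ∫ t in (0 : ℝ)..1, G (z₀ + t • (z - z₀))) V := by
  rw [contDiffOn_infty]
  intro n
  simpa using contDiffOn_nat_integral_segment hV hc hz₀ n G (fun _ => 1) continuous_const hG

-- The fundamental theorem of calculus along the segment. Since the averaged derivative is smooth in
-- `z`, this is Hadamard's lemma: `g z - g z₀` is a combination of the coordinates of `z - z₀` with
-- smooth coefficients.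
open Set in
theorem eq_add_integral_segment {E : Type} [NormedAddCommGroup E] [NormedSpace ℝ E]
    [FiniteDimensional ℝ E] {V : Set E} (hV : IsOpen V) (hc : Convex ℝ V) {z₀ z : E} (hz₀ : z₀ ∈ V)
    (hz : z ∈ V) {g : E → ℝ} (hg : ContDiffOn ℝ ∞ g V) :
    g z = g z₀ + (∫ t in (0 : ℝ)..1, fderiv ℝ g (z₀ + t • (z - z₀))) (z - z₀) := by
  have hseg : ∀ t ∈ Icc (0 : ℝ) 1, z₀ + t • (z - z₀) ∈ V := fun t ht =>
    hc.add_smul_sub_mem hz₀ hz ht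
  have hcont : ContinuousOn (fun t : ℝ => fderiv ℝ g (z₀ + t • (z - z₀))) (Icc 0 1) :=
    (hg.fderiv_of_isOpen hV (m := 0) (by simp)).continuousOn.comp (by fun_prop) hseg
  have hint := hcont.intervalIntegrable_of_Icc (μ := MeasureTheory.volume) zero_le_one
  rw [ContinuousLinearMap.intervalIntegral_apply hint]
  have hd : ∀ t ∈ uIcc (0 : ℝ) 1, HasDerivAt (fun t : ℝ => g (z₀ + t • (z - z₀)))
      (fderiv ℝ g (z₀ + t • (z - z₀)) (z - z₀)) t := by
    intro t ht
    rw [uIcc_of_le zero_le_one] at ht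
    have h1 : HasDerivAt (fun t : ℝ => z₀ + t • (z - z₀)) (z - z₀) t := by
      simpa using ((hasDerivAt_id t).smul_const (z - z₀)).const_add z₀
    exact (((hg.contDiffAt (hV.mem_nhds (hseg t ht))).differentiableAt
      (by simp)).hasFDerivAt).comp_hasDerivAt t h1
  rw [intervalIntegral.integral_eq_sub_of_hasDerivAt hd]
  · simp
  · exact ((hcont.clm_apply continuousOn_const).intervalIntegrable_of_Icc zero_le_one)


/-! ### Derivations of the algebra of smooth functions -/

variable {ε : ℤˣ}

/-- Evaluation at a point. -/
def ev (θ : Domain ε) : Fun ε →ₐ[ℝ] ℝ :=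
  (Pi.evalAlgHom ℝ (fun _ : Domain ε => ℝ) θ).comp (smoothFun ε).val

theorem fun_ext {f g : Fun ε} (h : ∀ θ, ev θ f = ev θ g) : f = g :=
  Subtype.ext (funext h)

theorem ev_apply (θ : Domain ε) (f : Fun ε) : ev θ f = f.1 θ := rfl

/-- The values of finitely many coordinates at the points of the covering. -/
def box (ε : ℤˣ) (s : Finset Coord) : Set (s → ℝ) :=
  {z | ∀ h : Coord.v 0 ∈ s, 0 < ((ε : ℤ) : ℝ) * z ⟨Coord.v 0, h⟩}

theorem isOpen_box (s : Finset Coord) : IsOpen (box ε s) := by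
  by_cases h : Coord.v 0 ∈ s
  · have : box ε s = {z | 0 < ((ε : ℤ) : ℝ) * z ⟨Coord.v 0, h⟩} := by
      ext z; exact ⟨fun hz => hz h, fun hz _ => hz⟩
    rw [this]
    exact isOpen_lt continuous_const (by fun_prop)
  · have : box ε s = Set.univ := by
      ext z; exact ⟨fun _ => trivial, fun _ h' => absurd h' h⟩
    rw [this]; exact isOpen_univ

/-- Fixing the sign of u_y cuts out at most a half-space, so segments stay in the domain. Hence
Hadamard's lemma has coefficients smooth on the whole domain, and a function with zero gradient is a
single constant. -/
theorem convex_box (s : Finset Coord) : Convex ℝ (box ε s) := by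
  intro z hz z' hz' a b ha hb hab h
  have h1 := hz h
  have h2 := hz' h
  simp only [Pi.add_apply, Pi.smul_apply, smul_eq_mul]
  rcases ha.eq_or_lt with rfl | ha
  · have : b = 1 := by linarith
    subst this; simpa using h2
  · have := mul_pos ha h1
    have := mul_nonneg hb h2.le
    nlinarith

theorem restrict_mem_box (s : Finset Coord) (θ : Domain ε) : s.restrict θ.1 ∈ box ε s :=
  fun _ => θ.2

theorem exists_restrict_eq {s : Finset Coord} {z : s → ℝ} (hz : z ∈ box ε s) :
    ∃ θ : Domain ε, s.restrict θ.1 = z := by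
  classical
  -- Missing coordinates receive the value `ε`, admissible for u_y because `ε` has square one.
  refine ⟨⟨fun c => if h : c ∈ s then z ⟨c, h⟩ else ((ε : ℤ) : ℝ), ?_⟩, ?_⟩
  · by_cases h : Coord.v 0 ∈ s
    · simpa [Domain, h] using hz h
    · rcases Int.units_eq_one_or ε with rfl | rfl <;> simp [Domain, h]
  · ext c; simp

theorem contDiffOn_box {s : Finset Coord} {g : (s → ℝ) → ℝ}
    (hg : ∀ θ : Domain ε, ContDiffAt ℝ ∞ g (s.restrict θ.1)) : ContDiffOn ℝ ∞ g (box ε s) := by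
  intro z hz
  obtain ⟨θ, rfl⟩ := exists_restrict_eq hz
  exact (hg θ).contDiffWithinAt

theorem ev_pd (c : Coord) (f : Fun ε) {s : Finset Coord} {g : (s → ℝ) → ℝ}
    (hg : ∀ θ : Domain ε, ContDiffAt ℝ ∞ g (s.restrict θ.1))
    (hf : ∀ θ : Domain ε, f.1 θ = g (s.restrict θ.1)) (θ : Domain ε) (hc : c ∈ s) :
    ev θ (pd ε c f) = fderiv ℝ g (s.restrict θ.1) (Pi.single ⟨c, hc⟩ 1) := by
  refine (partialAt_eq c hg hf θ).trans ?_
  congr 1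
  ext d
  by_cases h : d = ⟨c, hc⟩
  · subst h; simp
  · have : d.1 ≠ c := fun h' => h (Subtype.ext h')
    simp [this, h]

theorem vectorField_apply (a : Coord → Fun ε) (f : Fun ε) :
    vectorField a f = ∑ᶠ c, a c * pd ε c f := rfl

theorem vectorField_eq_sum (a : Coord → Fun ε) {f : Fun ε} {s : Finset Coord}
    (hs : ∀ c ∉ s, pd ε c f = 0) : vectorField a f = ∑ c ∈ s, a c * pd ε c f := by
  rw [vectorField_apply]
  refine finsum_eq_sum_of_support_subset _ fun c hc => ?_
  by_contra h
  exact hc (by simp [hs c h])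

/-- By Hadamard's lemma f = f(θ) + Σ (c - c(θ)) H_c with smooth H_c and H_c(θ) = ∂f/∂c(θ). A
derivation kills the constants, and at θ only D(c) H_c(θ) survives from each product. Identities
between derivations can therefore be checked on coordinates. -/
theorem derivation_eq_vectorField (D : Derivation ℝ (Fun ε) (Fun ε)) :
    D = vectorField fun c => D (coord ε c) := by
  ext1 f
  refine fun_ext fun θ => ?_
  obtain ⟨s, g, hg, hf⟩ := f.2
  rw [vectorField_eq_sum (s := s) _ fun c hc => Subtype.ext (partialAt_eq_zero hg hf hc)]
  have hg' := contDiffOn_box hg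
  have h0 := restrict_mem_box s θ
  set z₀ := s.restrict θ.1 with hz₀
  have hI := contDiffOn_integral_segment (isOpen_box s) (convex_box s) h0
    (hg'.fderiv_of_isOpen (isOpen_box s) (m := ∞) (by simp))
  let h : s → (s → ℝ) → ℝ := fun c z =>
    (∫ t in (0 : ℝ)..1, fderiv ℝ g (z₀ + t • (z - z₀))) (Pi.single c 1)
  have hh : ∀ c, ∀ θ : Domain ε, ContDiffAt ℝ ∞ (h c) (s.restrict θ.1) := fun c θ =>
    ((hI.contDiffAt ((isOpen_box s).mem_nhds (restrict_mem_box s θ))).clm_apply contDiffAt_const)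
  let H : s → Fun ε := fun c => ⟨fun θ => h c (s.restrict θ.1), s, h c, hh c, fun _ => rfl⟩
  have key : f = algebraMap ℝ (Fun ε) (g z₀) +
      ∑ c : s, (coord ε c.1 - algebraMap ℝ (Fun ε) (z₀ c)) * H c := by
    refine fun_ext fun θ' => ?_
    have hsum : ∀ (I : (s → ℝ) →L[ℝ] ℝ) (y : s → ℝ), I y = ∑ c, y c * I (Pi.single c 1) := by
      intro I y
      conv_lhs => rw [← Finset.univ_sum_single y]
      rw [map_sum]
      refine Finset.sum_congr rfl fun c _ => ?_
      have : (Pi.single c (y c) : s → ℝ) = (y c) • Pi.single c 1 := by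
        rw [← Pi.single_smul]; simp
      rw [this, map_smul, smul_eq_mul]
    rw [map_add, map_sum, ev_apply, hf,
      eq_add_integral_segment (isOpen_box s) (convex_box s) h0 (restrict_mem_box s θ') hg', hsum]
    simp only [map_mul, map_sub, AlgHom.commutes, Algebra.algebraMap_self, RingHom.id_apply]
    congr 1
  conv_lhs => rw [key]
  rw [map_add, map_sum, Derivation.map_algebraMap, zero_add, map_sum, map_sum,
    ← Finset.sum_coe_sort s]
  refine Finset.sum_congr rfl fun c _ => ?_
  rw [Derivation.leibniz, map_sub, Derivation.map_algebraMap, sub_zero]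
  simp only [smul_eq_mul, map_add, map_mul, map_sub, AlgHom.commutes, Algebra.algebraMap_self,
    RingHom.id_apply]
  have e1 : ev θ (coord ε c.1) - z₀ c = 0 := sub_self _
  have e2 : ev θ (H c) = ev θ (pd ε c.1 f) := by
    rw [ev_pd c.1 f hg hf θ c.2]
    change h c z₀ = _
    simp [h, hz₀]
  rw [e1, e2]
  ring

theorem derivation_ext {D₁ D₂ : Derivation ℝ (Fun ε) (Fun ε)}
    (h : ∀ c, D₁ (coord ε c) = D₂ (coord ε c)) : D₁ = D₂ := by
  rw [derivation_eq_vectorField D₁, derivation_eq_vectorField D₂, funext h]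

theorem pd_coord (c d : Coord) : pd ε c (coord ε d) = if c = d then 1 else 0 := by
  refine fun_ext fun θ => ?_
  have hg : ∀ θ : Domain ε, ContDiffAt ℝ ∞ (fun z : ({d} : Finset Coord) → ℝ =>
      z ⟨d, Finset.mem_singleton_self d⟩) (Finset.restrict {d} θ.1) := fun _ => by fun_prop
  have hf : ∀ θ : Domain ε, (coord ε d).1 θ = (fun z : ({d} : Finset Coord) → ℝ =>
      z ⟨d, Finset.mem_singleton_self d⟩) (Finset.restrict {d} θ.1) := fun _ => rfl
  by_cases h : c = d
  · subst h
    rw [ev_pd c (coord ε c) hg hf θ (Finset.mem_singleton_self c), if_pos rfl, map_one]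
    have : (fun z : ({c} : Finset Coord) → ℝ => z ⟨c, Finset.mem_singleton_self c⟩) =
        ContinuousLinearMap.proj (R := ℝ) (φ := fun _ => ℝ) ⟨c, Finset.mem_singleton_self c⟩ := rfl
    rw [this, ContinuousLinearMap.fderiv]
    simp
  · rw [if_neg h, map_zero]
    exact congrFun (partialAt_eq_zero hg hf (by simpa using h)) θ

@[simp]
theorem vectorField_coord (a : Coord → Fun ε) (c : Coord) : vectorField a (coord ε c) = a c := by
  rw [vectorField_eq_sum (s := {c}) a fun d hd => by
    rw [pd_coord, if_neg (by simpa using hd)]]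
  simp [pd_coord]

theorem pd_comm (c d : Coord) (f : Fun ε) : pd ε c (pd ε d f) = pd ε d (pd ε c f) := by
  have : ⁅pd ε c, pd ε d⁆ = 0 := derivation_ext fun e => by
    rw [Derivation.commutator_apply, pd_coord, pd_coord]
    split_ifs <;> simp
  have h := DFunLike.congr_fun this f
  rwa [Derivation.commutator_apply, Derivation.zero_apply, sub_eq_zero] at h

theorem eq_algebraMap_of_pd_eq_zero {f : Fun ε} (h : ∀ c, pd ε c f = 0) :
    ∃ r : ℝ, f = algebraMap ℝ (Fun ε) r := by
  obtain ⟨s, g, hg, hf⟩ := f.2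
  have hg' := contDiffOn_box hg
  obtain ⟨θ₀⟩ : Nonempty (Domain ε) := by
    have : (fun c => if c = Coord.v 0 then ((ε : ℤ) : ℝ) else 0) ∈ Domain ε := by
      rcases Int.units_eq_one_or ε with rfl | rfl <;> simp [Domain]
    exact ⟨⟨_, this⟩⟩
  have hz : ∀ z ∈ box ε s, fderiv ℝ g z = 0 := by
    intro z hz
    obtain ⟨θ, rfl⟩ := exists_restrict_eq hz
    ext y
    rw [← Finset.univ_sum_single y, map_sum]
    refine Finset.sum_eq_zero fun c _ => ?_
    have : (Pi.single c (y c) : s → ℝ) = (y c) • Pi.single c 1 := by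
      rw [← Pi.single_smul]; simp
    rw [this, map_smul, ← ev_pd c.1 f hg hf θ c.2, h, map_zero, smul_zero]
  refine ⟨g (s.restrict θ₀.1), fun_ext fun θ => ?_⟩
  rw [ev_apply, hf, eq_add_integral_segment (isOpen_box s) (convex_box s) (restrict_mem_box s θ₀)
    (restrict_mem_box s θ) hg', AlgHom.commutes]
  have : ∀ t ∈ Set.uIcc (0 : ℝ) 1, fderiv ℝ g
      (s.restrict θ₀.1 + t • (s.restrict θ.1 - s.restrict θ₀.1)) = 0 := fun t ht =>
    hz _ ((convex_box s).add_smul_sub_mem (restrict_mem_box s θ₀) (restrict_mem_box s θ)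
      (by rwa [Set.uIcc_of_le zero_le_one] at ht))
  rw [intervalIntegral.integral_congr (g := fun _ => 0) this]
  simp

end UHEReduction

namespace UHEReduction

/-! ### Algebras with coordinates -/

/-- A system of coordinates on a commutative algebra: elements `ξ c` with commuting, locally finite
dual derivations `der c`. -/
structure Chart (A : Type) [CommRing A] [Algebra ℝ A] where
  ξ : Coord → A
  der : Coord → Derivation ℝ A A
  der_coord : ∀ c c', der c (ξ c') = if c = c' then 1 else 0
  der_comm : ∀ c c' F, der c (der c' F) = der c' (der c F)
  finite_der : ∀ F, (Function.support fun c => der c F).Finite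

namespace Chart

variable {A : Type} [CommRing A] [Algebra ℝ A] (χ : Chart A)

/-- The coordinates on which `F` depends. -/
def supp (F : A) : Finset Coord := (χ.finite_der F).toFinset

theorem der_eq_zero {F : A} {c : Coord} (h : c ∉ χ.supp F) : χ.der c F = 0 := by
  by_contra h'
  exact h ((χ.finite_der F).mem_toFinset.2 h')

theorem finsum_eq (a : Coord → A) {F : A} {s : Finset Coord} (hs : χ.supp F ⊆ s) :
    ∑ᶠ c, a c * χ.der c F = ∑ c ∈ s, a c * χ.der c F := by
  refine finsum_eq_sum_of_support_subset _ fun c hc => ?_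
  by_contra h
  exact hc (by simp [χ.der_eq_zero fun h' => h (hs h')])

theorem mul_der_support_finite (a : Coord → A) (F : A) :
    (Function.support fun c => a c * χ.der c F).Finite :=
  (χ.finite_der F).subset fun c hc h => hc (by simp only [h, mul_zero])

/-- The derivation with prescribed values on the coordinates. -/
def vf (a : Coord → A) : Derivation ℝ A A :=
  Derivation.mk'
    { toFun := fun F => ∑ᶠ c, a c * χ.der c F
      map_add' := fun F G => by
        rw [← finsum_add_distrib (χ.mul_der_support_finite a F) (χ.mul_der_support_finite a G)]
        simp only [map_add, mul_add]
      map_smul' := fun r F => by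
        rw [RingHom.id_apply, smul_finsum' r (χ.mul_der_support_finite a F)]
        simp only [Derivation.map_smul, mul_smul_comm] }
    (fun F G => by
      have hf := χ.mul_der_support_finite a F
      have hg := χ.mul_der_support_finite a G
      have hf' : (Function.support fun c => G * (a c * χ.der c F)).Finite :=
        hf.subset fun c hc h => hc (by simp only [h, mul_zero])
      have hg' : (Function.support fun c => F * (a c * χ.der c G)).Finite :=
        hg.subset fun c hc h => hc (by simp only [h, mul_zero])
      simp only [LinearMap.coe_mk, AddHom.coe_mk, smul_eq_mul]
      rw [mul_finsum' _ F hg, mul_finsum' _ G hf, ← finsum_add_distrib hg' hf']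
      refine finsum_congr fun c => ?_
      rw [Derivation.leibniz]
      simp only [smul_eq_mul]
      ring)

theorem vf_apply (a : Coord → A) (F : A) : χ.vf a F = ∑ c ∈ χ.supp F, a c * χ.der c F :=
  χ.finsum_eq a subset_rfl

theorem vf_coord (a : Coord → A) (c : Coord) : χ.vf a (χ.ξ c) = a c := by
  have hs : χ.supp (χ.ξ c) ⊆ {c} := fun d hd => by
    by_contra h
    refine (χ.finite_der _).mem_toFinset.1 hd ?_
    simp only [χ.der_coord, if_neg (by simpa using h)]
  refine (χ.finsum_eq a hs).trans ?_
  simp [χ.der_coord]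

/-- The derivations that are determined by the partial derivatives. -/
def IsRegular (D : Derivation ℝ A A) : Prop :=
  ∀ F, D F = ∑ c ∈ χ.supp F, D (χ.ξ c) * χ.der c F

theorem isRegular_vf (a : Coord → A) : χ.IsRegular (χ.vf a) := fun F => by
  simp only [χ.vf_coord, vf_apply]

variable {χ}

namespace IsRegular

variable {D D' : Derivation ℝ A A}

theorem apply_of_subset (h : χ.IsRegular D) {F : A} {s : Finset Coord} (hs : χ.supp F ⊆ s) :
    D F = ∑ c ∈ s, D (χ.ξ c) * χ.der c F := by
  rw [h F, ← χ.finsum_eq _ hs, χ.finsum_eq _ subset_rfl]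

theorem apply_eq_zero (h : χ.IsRegular D) {F : A} (hF : ∀ c, D (χ.ξ c) = 0 ∨ χ.der c F = 0) :
    D F = 0 := by
  rw [h F]
  refine Finset.sum_eq_zero fun c _ => ?_
  rcases hF c with h | h <;> simp [h]

theorem add (h : χ.IsRegular D) (h' : χ.IsRegular D') : χ.IsRegular (D + D') := fun F => by
  simp only [Derivation.add_apply, add_mul, Finset.sum_add_distrib, ← h F, ← h' F]

theorem smul (a : A) (h : χ.IsRegular D) : χ.IsRegular (a • D) := fun F => by
  simp only [Derivation.smul_apply, smul_eq_mul, mul_assoc, ← Finset.mul_sum, ← h F]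

theorem sub (h : χ.IsRegular D) (h' : χ.IsRegular D') : χ.IsRegular (D - D') := fun F => by
  simp only [Derivation.sub_apply, sub_mul, Finset.sum_sub_distrib, ← h F, ← h' F]

theorem eq_of_coord (h : χ.IsRegular D) (h' : χ.IsRegular D')
    (hc : ∀ c, D (χ.ξ c) = D' (χ.ξ c)) : D = D' := by
  ext F
  rw [h F, h' F]
  simp only [hc]

/-- The second-order terms of `D (D' F)` and `D' (D F)` coincide because the partial derivatives
commute, so they cancel in the commutator. -/
theorem lie (h : χ.IsRegular D) (h' : χ.IsRegular D') : χ.IsRegular ⁅D, D'⁆ := fun F => by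
  have key : ∀ {D D' : Derivation ℝ A A}, χ.IsRegular D → χ.IsRegular D' →
      D (D' F) = ∑ c ∈ χ.supp F, D (D' (χ.ξ c)) * χ.der c F +
        ∑ c ∈ χ.supp F, ∑ e ∈ χ.supp F, D' (χ.ξ c) * D (χ.ξ e) * χ.der e (χ.der c F) := by
    intro D D' h h'
    rw [h' F, map_sum, ← Finset.sum_add_distrib]
    refine Finset.sum_congr rfl fun c _ => ?_
    have hs : χ.supp (χ.der c F) ⊆ χ.supp F := fun e he => by
      by_contra hn
      refine (χ.finite_der _).mem_toFinset.1 he ?_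
      simp only [χ.der_comm e c, χ.der_eq_zero hn, map_zero]
    rw [Derivation.leibniz, h.apply_of_subset hs]
    simp only [smul_eq_mul, Finset.mul_sum, mul_assoc]
    rw [add_comm, mul_comm]
  rw [Derivation.commutator_apply, key h h', key h' h]
  rw [Finset.sum_comm (s := χ.supp F) (t := χ.supp F)
    (f := fun c e => D (χ.ξ c) * D' (χ.ξ e) * χ.der e (χ.der c F))]
  rw [add_sub_add_comm, ← Finset.sum_sub_distrib, ← Finset.sum_sub_distrib]
  have : ∀ c e, D' (χ.ξ c) * D (χ.ξ e) * χ.der e (χ.der c F) =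
      D (χ.ξ e) * D' (χ.ξ c) * χ.der c (χ.der e F) := fun c e => by
    rw [χ.der_comm c e]; ring
  simp only [this, sub_self, Finset.sum_const_zero, add_zero, Derivation.commutator_apply, sub_mul]

end IsRegular

theorem isRegular_der (χ : Chart A) (c : Coord) : χ.IsRegular (χ.der c) := fun F => by
  simp only [χ.der_coord, ite_mul, one_mul, zero_mul]
  rw [Finset.sum_ite_eq]
  split_ifs with h
  · rfl
  · exact χ.der_eq_zero h

/-- The commutator of a coordinate derivation with a regular derivation. -/
theorem der_apply_comm (χ : Chart A) {D : Derivation ℝ A A} (h : χ.IsRegular D) (c : Coord)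
    {F : A} {s : Finset Coord} (hs : χ.supp F ⊆ s) :
    χ.der c (D F) = D (χ.der c F) + ∑ e ∈ s, χ.der c (D (χ.ξ e)) * χ.der e F := by
  have := ((χ.isRegular_der c).lie h).apply_of_subset hs
  simp only [Derivation.commutator_apply, χ.der_coord] at this
  rw [← sub_eq_iff_eq_add', this]
  refine Finset.sum_congr rfl fun e _ => ?_
  split_ifs <;> simp

end Chart

/-- The coordinates on the covering space. -/
def funChart (ε : ℤˣ) : Chart (Fun ε) where
  ξ := coord ε
  der := pd ε
  der_coord := pd_coord
  der_comm := pd_comm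
  finite_der := pd_support_finite

theorem funChart_isRegular {ε : ℤˣ} (D : Derivation ℝ (Fun ε) (Fun ε)) :
    (funChart ε).IsRegular D := fun F => by
  conv_lhs => rw [derivation_eq_vectorField D]
  exact vectorField_eq_sum _ fun c hc => (funChart ε).der_eq_zero hc

end UHEReduction

namespace UHEReduction

variable {ε : ℤˣ}

/-! ### Adjoining the roots of the characteristic polynomial -/

/-- The function `u_x + u`. -/
def sFun (ε : ℤˣ) : Fun ε := coord ε (Coord.u 1) + coord ε (Coord.u 0)

open Polynomial in
/-- The quadratic polynomial `X² - (u_x + u) X - u_y`, with its discriminant inverted. -/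
def rootPair (ε : ℤˣ) : StandardEtalePair (Fun ε) where
  f := X ^ 2 - C (sFun ε) * X - C (coord ε (Coord.v 0))
  monic_f := by
    nontriviality Fun ε
    monicity!
  g := 2 * X - C (sFun ε)
  -- The inverted element is itself the derivative of the quadratic.
  cond := ⟨1, 0, 1, by simp; ring⟩

theorem aeval_rootPair_f {T : Type} [CommRing T] [Algebra (Fun ε) T] (x : T) :
    Polynomial.aeval x (rootPair ε).f = x ^ 2 - algebraMap (Fun ε) T (sFun ε) * x -
      algebraMap (Fun ε) T (coord ε (Coord.v 0)) := by
  simp [rootPair]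

theorem aeval_rootPair_g {T : Type} [CommRing T] [Algebra (Fun ε) T] (x : T) :
    Polynomial.aeval x (rootPair ε).g = 2 * x - algebraMap (Fun ε) T (sFun ε) := by
  simp [rootPair, map_ofNat]

/-- The algebra of functions with the roots of the characteristic polynomial adjoined. -/
def Ext (ε : ℤˣ) : Type := (rootPair ε).Ring

instance (ε : ℤˣ) : CommRing (Ext ε) := inferInstanceAs (CommRing (rootPair ε).Ring)

instance (ε : ℤˣ) : Algebra (Fun ε) (Ext ε) := inferInstanceAs (Algebra (Fun ε) (rootPair ε).Ring)

instance (ε : ℤˣ) : Algebra ℝ (Ext ε) :=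
  ((algebraMap (Fun ε) (Ext ε)).comp (algebraMap ℝ (Fun ε))).toAlgebra

instance (ε : ℤˣ) : IsScalarTower ℝ (Fun ε) (Ext ε) := IsScalarTower.of_algebraMap_eq fun _ => rfl

instance (ε : ℤˣ) : Algebra.FormallyEtale (Fun ε) (Ext ε) :=
  inferInstanceAs (Algebra.FormallyEtale (Fun ε) (rootPair ε).Ring)

/-- The embedding of the functions. -/
abbrev inc (ε : ℤˣ) : Fun ε →+* Ext ε := algebraMap (Fun ε) (Ext ε)

/-- The root of the characteristic polynomial. -/
def root (ε : ℤˣ) : Ext ε := (rootPair ε).X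

theorem root_sq : root ε ^ 2 = inc ε (sFun ε) * root ε + inc ε (coord ε (Coord.v 0)) := by
  have h' : root ε ^ 2 - inc ε (sFun ε) * root ε - inc ε (coord ε (Coord.v 0)) = 0 :=
    (aeval_rootPair_f _).symm.trans ((rootPair ε).hasMap_X).1
  linear_combination h'

theorem exists_inv_disc : ∃ w : Ext ε, w * (2 * root ε - inc ε (sFun ε)) = 1 := by
  have h := ((rootPair ε).hasMap_X).2.exists_left_inv
  obtain ⟨w, hw⟩ := h
  rw [aeval_rootPair_g] at hw
  exact ⟨w, hw⟩

-- The algebra is generated by the functions, the root and the inverse of 2·root - s; closure under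
-- existing inverses takes care of the last generator.
open Polynomial in
theorem Ext.induction {S : Subalgebra ℝ (Ext ε)} (h₁ : ∀ r, inc ε r ∈ S) (h₂ : root ε ∈ S)
    (h₃ : ∀ a ∈ S, ∀ b, a * b = 1 → b ∈ S) (F : Ext ε) : F ∈ S := by
  have hY : (Ideal.Quotient.mk _ X : (rootPair ε).Ring) ∈ (S : Set (Ext ε)) := by
    refine h₃ _ ?_ _ (rootPair ε).aeval_X_g_mul_mk_X
    rw [aeval_rootPair_g]
    exact sub_mem (mul_mem (ofNat_mem S 2) h₂) (h₁ _)
  obtain ⟨f, rfl⟩ := Ideal.Quotient.mk_surjective (I := Ideal.span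
    {C (rootPair ε).f, X * C (rootPair ε).g - 1}) F
  induction f using Polynomial.induction_on' with
  | add a b ha hb => exact (congrArg (· ∈ S) (map_add _ a b)).mpr (add_mem ha hb)
  | monomial n a =>
    rw [← C_mul_X_pow_eq_monomial]
    refine (congrArg (· ∈ S) (map_mul _ (C a) (X ^ n))).mpr (mul_mem ?_
      ((congrArg (· ∈ S) (map_pow _ _ n)).mpr (pow_mem hY n)))
    induction a using Polynomial.induction_on' with
    | add a b ha hb =>
      rw [C_add]
      exact (congrArg (· ∈ S) (map_add _ (C a) (C b))).mpr (add_mem ha hb)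
    | monomial n a =>
      rw [← C_mul_X_pow_eq_monomial, C_mul, C_pow]
      refine (congrArg (· ∈ S) (map_mul _ (C (C a)) (C X ^ n))).mpr (mul_mem (h₁ a)
        ((congrArg (· ∈ S) (map_pow _ _ n)).mpr (pow_mem h₂ n)))

/-- Differentiating the quadratic equation of the root gives (2·root - s)·D(root) = 0, and the
factor is invertible. -/
theorem ext_derivation_eq_zero {D : Derivation ℝ (Ext ε) (Ext ε)} (h : ∀ r, D (inc ε r) = 0) :
    D = 0 := by
  let S : Subalgebra ℝ (Ext ε) :=
    { carrier := {F | D F = 0}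
      mul_mem' := fun {a b} ha hb => by
        simp only [Set.mem_ofPred_eq] at *
        rw [Derivation.leibniz, ha, hb, smul_zero, smul_zero, add_zero]
      add_mem' := fun {a b} ha hb => by
        simp only [Set.mem_ofPred_eq] at *
        rw [map_add, ha, hb, add_zero]
      algebraMap_mem' := fun r => D.map_algebraMap r }
  obtain ⟨w, hw⟩ := exists_inv_disc (ε := ε)
  ext F
  refine Ext.induction (S := S) h ?_ ?_ F
  · have h1 := congrArg D (root_sq (ε := ε))
    rw [map_add, Derivation.leibniz, h, h, pow_two, Derivation.leibniz] at h1
    simp only [smul_eq_mul] at h1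
    change D (root ε) = 0
    linear_combination w * h1 - D (root ε) * hw
  · intro a ha b hab
    have h1 := congrArg D hab
    have ha' : D a = 0 := ha
    rw [Derivation.leibniz, ha', Derivation.map_one_eq_zero] at h1
    simp only [smul_eq_mul] at h1
    change D b = 0
    linear_combination b * h1 - D b * hab

theorem ext_derivation_ext {D D' : Derivation ℝ (Ext ε) (Ext ε)}
    (h : ∀ r, D (inc ε r) = D' (inc ε r)) : D = D' := by
  rw [← sub_eq_zero]
  exact ext_derivation_eq_zero fun r => by rw [Derivation.sub_apply, h, sub_self]

-- For a formally étale extension the Kähler differentials arise by base change, so a derivation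
-- extends; uniqueness is `ext_derivation_eq_zero`.
open KaehlerDifferential TensorProduct in
theorem exists_extension (D : Derivation ℝ (Fun ε) (Fun ε)) :
    ∃ D' : Derivation ℝ (Ext ε) (Ext ε), ∀ r, D' (inc ε r) = inc ε (D r) := by
  let L : Derivation ℝ (Fun ε) (Ext ε) := (Algebra.linearMap (Fun ε) (Ext ε)).compDer D
  let l : Ω[Ext ε⁄ℝ] →ₗ[Ext ε] Ext ε := (L.liftKaehlerDifferential.liftBaseChange (Ext ε)).comp
    (tensorKaehlerEquivOfFormallyEtale ℝ (Fun ε) (Ext ε)).symm.toLinearMap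
  refine ⟨l.compDer (KaehlerDifferential.D ℝ (Ext ε)), fun r => ?_⟩
  change (L.liftKaehlerDifferential.liftBaseChange (Ext ε))
    ((tensorKaehlerEquivOfFormallyEtale ℝ (Fun ε) (Ext ε)).symm
      (KaehlerDifferential.D ℝ (Ext ε) (algebraMap (Fun ε) (Ext ε) r))) = _
  rw [tensorKaehlerEquivOfFormallyEtale_symm_D_algebraMap, LinearMap.liftBaseChange_tmul, one_smul,
    Derivation.liftKaehlerDifferential_comp_D]
  rfl

/-- The extension of a vector field to the roots. -/
def extend (D : Derivation ℝ (Fun ε) (Fun ε)) : Derivation ℝ (Ext ε) (Ext ε) :=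
  (exists_extension D).choose

theorem extend_inc (D : Derivation ℝ (Fun ε) (Fun ε)) (r : Fun ε) :
    extend D (inc ε r) = inc ε (D r) := (exists_extension D).choose_spec r

theorem extend_root (D : Derivation ℝ (Fun ε) (Fun ε)) :
    (2 * root ε - inc ε (sFun ε)) * extend D (root ε) =
      root ε * inc ε (D (sFun ε)) + inc ε (D (coord ε (Coord.v 0))) := by
  have h1 := congrArg (extend D) (root_sq (ε := ε))
  rw [map_add, Derivation.leibniz, extend_inc, extend_inc, pow_two, Derivation.leibniz] at h1
  simp only [smul_eq_mul] at h1
  linear_combination h1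

/-- The chart of the extended algebra given by the original coordinates. -/
def extChart (ε : ℤˣ) : Chart (Ext ε) where
  ξ c := inc ε (coord ε c)
  der c := extend (pd ε c)
  der_coord c c' := by
    rw [extend_inc, pd_coord]
    split_ifs <;> simp
  der_comm c c' F := by
    have : ⁅extend (pd ε c), extend (pd ε c')⁆ = 0 := ext_derivation_eq_zero fun r => by
      rw [Derivation.commutator_apply, extend_inc, extend_inc, extend_inc, extend_inc, pd_comm,
        sub_self]
    have h := DFunLike.congr_fun this F
    rwa [Derivation.commutator_apply, Derivation.zero_apply, sub_eq_zero] at h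
  finite_der := by
    let S : Subalgebra ℝ (Ext ε) :=
      { carrier := {F | (Function.support fun c => extend (pd ε c) F).Finite}
        mul_mem' := fun {a b} ha hb => (ha.union hb).subset fun c hc => by
          by_contra h
          simp only [Set.mem_union, Function.mem_support, not_or, not_not] at h hc
          exact hc (by rw [Derivation.leibniz, h.1, h.2, smul_zero, smul_zero, add_zero])
        add_mem' := fun {a b} ha hb => (ha.union hb).subset fun c hc => by
          by_contra h
          simp only [Set.mem_union, Function.mem_support, not_or, not_not] at h hc
          exact hc (by rw [map_add, h.1, h.2, add_zero])
        algebraMap_mem' := fun r => by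
          simp }
    have hinc : ∀ r, inc ε r ∈ S := fun r => (pd_support_finite r).subset fun c hc h =>
      hc (by simp only [extend_inc, h, map_zero])
    obtain ⟨w, hw⟩ := exists_inv_disc (ε := ε)
    refine Ext.induction (S := S) hinc ?_ ?_
    · refine ((hinc (sFun ε)).union (hinc (coord ε (Coord.v 0)))).subset fun c hc => ?_
      by_contra h
      simp only [Set.mem_union, Function.mem_support, not_or, not_not, extend_inc] at h hc
      have := extend_root (pd ε c)
      rw [h.1, h.2] at this
      exact hc (by linear_combination w * this - extend (pd ε c) (root ε) * hw)
    · intro a ha b hab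
      refine (show Set.Finite _ from ha).subset fun c hc h => ?_
      have h : extend (pd ε c) a = 0 := h
      have h1 := congrArg (extend (pd ε c)) hab
      rw [Derivation.leibniz, h, Derivation.map_one_eq_zero] at h1
      simp only [smul_eq_mul, Function.mem_support] at h1 hc
      exact hc (by linear_combination b * h1 - extend (pd ε c) b * hab)

theorem extend_isRegular (D : Derivation ℝ (Fun ε) (Fun ε)) :
    (extChart ε).IsRegular (extend D) := by
  have : extend D = (extChart ε).vf fun c => extend D ((extChart ε).ξ c) := by
    refine ext_derivation_ext fun r => ?_
    have hs : (extChart ε).supp (inc ε r) ⊆ (funChart ε).supp r := fun c hc => by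
      by_contra h
      refine ((extChart ε).finite_der _).mem_toFinset.1 hc ?_
      change extend (pd ε c) _ = 0
      rw [extend_inc]
      exact (congrArg _ ((funChart ε).der_eq_zero h)).trans (map_zero _)
    refine Eq.trans ?_ ((extChart ε).finsum_eq _ hs).symm
    rw [extend_inc, funChart_isRegular D r, map_sum]
    refine Finset.sum_congr rfl fun c _ => ?_
    rw [map_mul]
    change _ = extend D (inc ε _) * extend (pd ε c) (inc ε r)
    rw [extend_inc, extend_inc]
    rfl
  rw [this]
  exact Chart.isRegular_vf _ _

/-! ### Injectivity of the extension -/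

/-- The roots may be non-real where u_y < 0, so evaluation takes values in ℂ. Zeros of the
discriminant are excluded because 2·root - s is invertible in `Ext ε`. -/
theorem exists_ringHom_ext (θ : Domain ε) (hd : ev θ (sFun ε ^ 2 + 4 * coord ε (Coord.v 0)) ≠ 0) :
    ∃ φ : Ext ε →+* ℂ, ∀ r, φ (inc ε r) = (ev θ r : ℂ) := by
  let φ₀ : Fun ε →+* ℂ := Complex.ofRealHom.comp (ev θ).toRingHom
  let _ := φ₀.toAlgebra
  obtain ⟨w, hw⟩ := IsAlgClosed.exists_pow_nat_eq
    (φ₀ (sFun ε ^ 2 + 4 * coord ε (Coord.v 0))) (n := 2) (by norm_num)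
  have hw0 : w ≠ 0 := by
    rintro rfl
    have : ((ev θ (sFun ε ^ 2 + 4 * coord ε (Coord.v 0)) : ℝ) : ℂ) = 0 :=
      hw.symm.trans (zero_pow two_ne_zero)
    exact hd (by exact_mod_cast this)
  simp only [map_add, map_mul, map_pow, map_ofNat] at hw
  have hm : (rootPair ε).HasMap ((φ₀ (sFun ε) + w) / 2) := by
    refine ⟨?_, ?_⟩
    · rw [aeval_rootPair_f]
      change ((φ₀ (sFun ε) + w) / 2) ^ 2 - φ₀ (sFun ε) * ((φ₀ (sFun ε) + w) / 2) -
        φ₀ (coord ε (Coord.v 0)) = 0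
      linear_combination hw / 4
    · rw [aeval_rootPair_g]
      change IsUnit (2 * ((φ₀ (sFun ε) + w) / 2) - φ₀ (sFun ε))
      have : 2 * ((φ₀ (sFun ε) + w) / 2) - φ₀ (sFun ε) = w := by ring
      rw [this]
      exact hw0.isUnit
  exact ⟨((rootPair ε).lift _ hm).toRingHom, fun r => ((rootPair ε).lift _ hm).commutes r⟩

theorem fun_eq_zero_of_sq {f : Fun ε} (h : f ^ 2 = 0) : f = 0 :=
  fun_ext fun θ => by
    have := congrArg (ev θ) h
    rw [map_pow, map_zero] at this
    rw [map_zero]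
    exact pow_eq_zero_iff (two_ne_zero) |>.1 this

/-- The discriminant is not a zero divisor. -/
theorem eq_zero_of_disc_mul {r : Fun ε} (h : (sFun ε ^ 2 + 4 * coord ε (Coord.v 0)) * r = 0) :
    r = 0 := by
  have h1 := congrArg (pd ε (Coord.v 0)) h
  have hs : pd ε (Coord.v 0) (sFun ε ^ 2 + 4 * coord ε (Coord.v 0)) = 4 := by
    have h4 : (4 : Fun ε) = algebraMap ℝ (Fun ε) 4 := by rw [map_ofNat]
    rw [map_add, pow_two, Derivation.leibniz, Derivation.leibniz, sFun, map_add, pd_coord, pd_coord,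
      pd_coord, h4, Derivation.map_algebraMap]
    simp
  rw [Derivation.leibniz, hs, map_zero, smul_eq_mul, smul_eq_mul] at h1
  -- The u_y-derivative of disc·r = 0 is disc·r_v + 4r = 0; multiplication by r removes the first
  -- term.
  have h4 : (4 : Fun ε) * r ^ 2 = 0 := by
    linear_combination r * h1 - pd ε (Coord.v 0) r * h
  refine fun_eq_zero_of_sq (fun_ext fun θ => ?_)
  have := congrArg (ev θ) h4
  rw [map_mul, map_zero, map_ofNat] at this
  rw [map_zero]
  linarith

/-- An element of the kernel vanishes wherever the discriminant does not, by evaluation in ℂ. Its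
product with the discriminant is therefore zero, and the discriminant is not a zero divisor. -/
theorem inc_injective : Function.Injective (inc ε) := by
  rw [injective_iff_map_eq_zero]
  intro r hr
  refine eq_zero_of_disc_mul (fun_ext fun θ => ?_)
  rw [map_mul, map_zero]
  by_contra hne
  obtain ⟨h1, h2⟩ := mul_ne_zero_iff.1 hne
  obtain ⟨φ, hφ⟩ := exists_ringHom_ext θ h1
  have := hφ r
  rw [hr, map_zero] at this
  exact h2 (by exact_mod_cast this.symm)

end UHEReduction

namespace UHEReduction

variable {ε : ℤˣ} {p : ℤ}

/-! ### Total derivatives -/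

open Coord (x y u v q)

theorem invUy_mul : invUy ε * coord ε (v 0) = 1 :=
  fun_ext fun θ => inv_mul_cancel₀ (Domain.ne_zero θ)

theorem derivation_invUy (D : Derivation ℝ (Fun ε) (Fun ε)) :
    D (invUy ε) = -invUy ε ^ 2 * D (coord ε (v 0)) := by
  have h := congrArg D (invUy_mul (ε := ε))
  rw [Derivation.leibniz, Derivation.map_one_eq_zero] at h
  simp only [smul_eq_mul] at h
  linear_combination invUy ε * h - D (invUy ε) * invUy_mul (ε := ε)

@[simp] theorem Dx_x : Dx ε p (coord ε x) = 1 := vectorField_coord _ _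
@[simp] theorem Dx_y : Dx ε p (coord ε y) = 0 := vectorField_coord _ _
@[simp] theorem Dx_u (k : ℕ) : Dx ε p (coord ε (u k)) = coord ε (u (k + 1)) :=
  vectorField_coord _ _
@[simp] theorem Dx_v (k : ℕ) : Dx ε p (coord ε (v k)) = coord ε (v (k + 1)) :=
  vectorField_coord _ _
@[simp] theorem Dx_q (n : ℕ) : Dx ε p (coord ε (q n)) = invUy ε * Qy ε p (n + 1) :=
  vectorField_coord _ _
@[simp] theorem Dy_x : Dy ε p (coord ε x) = 0 := vectorField_coord _ _
@[simp] theorem Dy_y : Dy ε p (coord ε y) = 1 := vectorField_coord _ _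
@[simp] theorem Dy_u (k : ℕ) : Dy ε p (coord ε (u k)) = coord ε (v k) := vectorField_coord _ _
@[simp] theorem Dy_v (k : ℕ) : Dy ε p (coord ε (v k)) = (Dx ε p)^[k] (rhs ε) :=
  vectorField_coord _ _
@[simp] theorem Dy_q (n : ℕ) : Dy ε p (coord ε (q n)) = Qy ε p (n + 2) := vectorField_coord _ _

/-- The function `u_xx + u_x`. -/
def sxFun (ε : ℤˣ) : Fun ε := coord ε (u 2) + coord ε (u 1)

theorem Dx_sFun : Dx ε p (sFun ε) = sxFun ε := by simp [sFun, sxFun]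

theorem Dy_sFun : Dy ε p (sFun ε) = coord ε (v 1) + coord ε (v 0) := by simp [sFun]

/-- The term u_x u_y completes u_y u_xx to u_y s_x with s = u_x + u, so u_yy is linear in s_x and
u_xy with no further term. The only undifferentiated term of the first-order system for s and u_y
sits in D_y s = u_xy + u_y. -/
theorem rhs_eq : rhs ε = coord ε (v 0) * sxFun ε - sFun ε * coord ε (v 1) := by
  rw [rhs, sFun, sxFun]; ring

theorem Dy_v_zero : Dy ε p (coord ε (v 0)) = coord ε (v 0) * sxFun ε - sFun ε * coord ε (v 1) := by
  rw [Dy_v, Function.iterate_zero_apply, rhs_eq]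

theorem Q_succ_succ (n : ℕ) : Q ε p (n + 2) = coord ε (q n) := rfl

theorem Qy_succ_succ (n : ℕ) : Qy ε p (n + 2) = algebraMap ℝ (Fun ε) (-(p : ℝ) - n) * Q ε p (n + 1)
    - sFun ε * invUy ε * Qy ε p (n + 1) + invUy ε * Qy ε p n := by
  rw [Qy, Algebra.smul_def, sFun]
  congr 4
  ring

theorem Dy_Q (n : ℕ) : Dy ε p (Q ε p n) = Qy ε p n := by
  rcases n with _ | _ | n
  · simp [Q, Qy]
  · simp [Q, Qy, Algebra.smul_def]
  · simp [Q]

theorem Dx_Q_zero : Dx ε p (Q ε p 0) = 0 := by simp [Q]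

theorem Dx_Q (n : ℕ) : Dx ε p (Q ε p (n + 1)) = invUy ε * Qy ε p n := by
  rcases n with _ | n
  · simp [Q, Qy]
  · simp [Q]

/-- This is the compatibility condition of the covering: the two expressions for q_{i,xy} agree. The
equation enters through D_y u_y; the term -i in the factor of q_{i-1} compensates the summand u_y of
D_y(u_x + u). -/
theorem Dx_Qy (n : ℕ) : Dx ε p (Qy ε p (n + 1)) = Dy ε p (invUy ε * Qy ε p n) := by
  induction n using Nat.strong_induction_on with
  | _ n ih =>
  have hv := invUy_mul (ε := ε)
  rcases n with _ | _ | n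
  · simp [Qy]
  · rw [Qy_succ_succ]
    simp only [Qy, map_add, map_sub, Derivation.leibniz, Derivation.map_algebraMap, smul_eq_mul,
      mul_zero, map_zero, Dx_Q, Dx_sFun, derivation_invUy, Dx_v, Dy_v_zero]
    linear_combination (algebraMap ℝ (Fun ε) (-((p : ℝ) - 1)) * sxFun ε * invUy ε) * hv
  · have h1 := ih (n + 1) (by omega)
    have h2 := ih n (by omega)
    have h3 := congrArg (Dy ε p) (Qy_succ_succ (ε := ε) (p := p) n)
    have hK : algebraMap ℝ (Fun ε) (-(p : ℝ) - (n + 1 : ℕ)) =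
        algebraMap ℝ (Fun ε) (-(p : ℝ) - n) - 1 := by
      rw [← map_one (algebraMap ℝ (Fun ε)), ← map_sub]
      congr 1
      push_cast; ring
    rw [Qy_succ_succ (n + 1), hK]
    simp only [map_add, map_sub, Derivation.leibniz, Derivation.map_algebraMap, smul_eq_mul,
      Derivation.map_one_eq_zero,
      Dx_Q, Dx_sFun, derivation_invUy, Dx_v, Dy_v_zero, Dy_Q, Dy_sFun] at h1 h2 h3 ⊢
    rw [h1, h2, h3]
    linear_combination (invUy ε * Qy ε p (n + 1) + sxFun ε * invUy ε * Qy ε p (n + 2)) * hv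

theorem Dx_Dy_comm (f : Fun ε) : Dx ε p (Dy ε p f) = Dy ε p (Dx ε p f) := by
  have : ⁅Dx ε p, Dy ε p⁆ = 0 := derivation_ext fun c => by
    rw [Derivation.commutator_apply, Derivation.zero_apply, sub_eq_zero]
    cases c with
    | x => simp
    | y => simp
    | u k => simp
    | v k => rw [Dy_v, Dx_v, Dy_v, Function.iterate_succ_apply']
    | q n => rw [Dy_q, Dx_q, Dx_Qy]
  have h := DFunLike.congr_fun this f
  rwa [Derivation.commutator_apply, Derivation.zero_apply, sub_eq_zero] at h

/-! ### Commutators of partial and total derivatives -/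

/-- A derivation that kills the coefficients of the covering kills the right-hand sides. -/
theorem Qy_eq_zero_of {D : Derivation ℝ (Fun ε) (Fun ε)} (hs : D (sFun ε) = 0)
    (hv : D (coord ε (v 0)) = 0) (hq : ∀ n, D (Q ε p n) = 0) (n : ℕ) : D (Qy ε p n) = 0 := by
  induction n using Nat.strong_induction_on with
  | _ n ih =>
  rcases n with _ | _ | n
  · simp [Qy]
  · simp [Qy]
  · rw [Qy_succ_succ]
    simp [hs, hv, hq, derivation_invUy, ih n (by omega), ih (n + 1) (by omega)]

theorem pd_Q_eq_zero {c : Coord} (hy : c ≠ y) (hq : ∀ n, c ≠ q n) (n : ℕ) :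
    pd ε c (Q ε p n) = 0 := by
  rcases n with _ | _ | n
  · simp [Q]
  · simp [Q, pd_coord, hy]
  · simp [Q, pd_coord, hq]

theorem pd_Qy_eq_zero {c : Coord} (hy : c ≠ y) (hq : ∀ n, c ≠ q n) (hu : c ≠ u 0) (hu' : c ≠ u 1)
    (hv : c ≠ v 0) (n : ℕ) : pd ε c (Qy ε p n) = 0 :=
  Qy_eq_zero_of (by simp [sFun, pd_coord, hu, hu']) (by simp [pd_coord, hv])
    (pd_Q_eq_zero hy hq) n

theorem derivation_comm_of_coord {D D' D'' : Derivation ℝ (Fun ε) (Fun ε)}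
    (h : ∀ c, D (D' (coord ε c)) = D' (D (coord ε c)) + D'' (coord ε c)) (f : Fun ε) :
    D (D' f) = D' (D f) + D'' f := by
  have : ⁅D, D'⁆ = D'' := derivation_ext fun c => by
    rw [Derivation.commutator_apply, h, add_sub_cancel_left]
  rw [← this, Derivation.commutator_apply, add_sub_cancel]

theorem derivation_ite {P : Prop} [Decidable P] (D : Derivation ℝ (Fun ε) (Fun ε)) :
    D (if P then 1 else 0) = 0 := by
  split_ifs <;> simp

/-- The index starts at u₂ (at v₁ in the companion statement) because the derivatives of the
nonlocal variables involve u₀, u₁ and v₀; above these the commutator has no nonlocal contribution.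
-/
theorem pd_u_Dx (k : ℕ) (f : Fun ε) :
    pd ε (u (k + 2)) (Dx ε p f) = Dx ε p (pd ε (u (k + 2)) f) + pd ε (u (k + 1)) f := by
  refine derivation_comm_of_coord (fun c => ?_) f
  rw [pd_coord, derivation_ite, zero_add]
  cases c with
  | x => simp [pd_coord]
  | y => simp [pd_coord]
  | u k => simp [pd_coord]
  | v k => simp [pd_coord]
  | q n => simp [pd_coord, derivation_invUy, pd_Qy_eq_zero]

theorem pd_v_Dx (k : ℕ) (f : Fun ε) :
    pd ε (v (k + 1)) (Dx ε p f) = Dx ε p (pd ε (v (k + 1)) f) + pd ε (v k) f := by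
  refine derivation_comm_of_coord (fun c => ?_) f
  rw [pd_coord, derivation_ite, zero_add]
  cases c with
  | x => simp [pd_coord]
  | y => simp [pd_coord]
  | u k => simp [pd_coord]
  | v k => simp [pd_coord]
  | q n => simp [pd_coord, derivation_invUy, pd_Qy_eq_zero]

theorem pd_x_Dx (f : Fun ε) : pd ε x (Dx ε p f) = Dx ε p (pd ε x f) := by
  rw [derivation_comm_of_coord (D'' := 0) (fun c => ?_) f, Derivation.zero_apply, add_zero]
  rw [pd_coord, derivation_ite, zero_add]
  cases c with
  | x => simp
  | y => simp
  | u k => simp [pd_coord]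
  | v k => simp [pd_coord]
  | q n => simp [pd_coord, derivation_invUy, pd_Qy_eq_zero]

theorem pd_x_iterate_Dx (n : ℕ) (f : Fun ε) :
    pd ε x ((Dx ε p)^[n] f) = (Dx ε p)^[n] (pd ε x f) := by
  induction n generalizing f with
  | zero => rfl
  | succ n ih => rw [Function.iterate_succ_apply, ih, pd_x_Dx, Function.iterate_succ_apply]

theorem pd_x_Dy (f : Fun ε) : pd ε x (Dy ε p f) = Dy ε p (pd ε x f) := by
  rw [derivation_comm_of_coord (D'' := 0) (fun c => ?_) f, Derivation.zero_apply, add_zero]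
  rw [pd_coord, derivation_ite]
  cases c with
  | x => simp
  | y => simp
  | u k => simp [pd_coord]
  | v k =>
    have : pd ε x (rhs ε) = 0 := by simp [rhs_eq, sFun, sxFun, pd_coord]
    rw [Dy_v, pd_x_iterate_Dx, this, iterate_map_zero]
    simp
  | q n => simp [pd_Qy_eq_zero]

/-- The leading derivatives of the iterated total derivatives of the right-hand side. -/
theorem pd_iterate_rhs (n : ℕ) :
    (∀ k, pd ε (u (n + k + 2)) ((Dx ε p)^[n] (rhs ε)) = if k = 0 then coord ε (v 0) else 0) ∧
    ∀ k, pd ε (v (n + k + 1)) ((Dx ε p)^[n] (rhs ε)) = if k = 0 then -sFun ε else 0 := by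
  induction n with
  | zero =>
    constructor
    · intro k
      simp [rhs_eq, sFun, sxFun, pd_coord]
    · intro k
      simp only [zero_add, Function.iterate_zero_apply]
      rcases k with _ | k <;> simp [rhs_eq, sFun, sxFun, pd_coord]
  | succ n ih =>
    constructor
    · intro k
      rw [Function.iterate_succ_apply', show n + 1 + k + 2 = n + k + 1 + 2 by omega, pd_u_Dx,
        show n + k + 1 + 2 = n + (k + 1) + 2 by omega, ih.1, show n + k + 1 + 1 = n + k + 2 by omega,
        ih.1]
      simp
    · intro k
      rw [Function.iterate_succ_apply', show n + 1 + k + 1 = n + k + 1 + 1 by omega, pd_v_Dx,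
        show n + k + 1 + 1 = n + (k + 1) + 1 by omega, ih.2, ih.2]
      simp

end UHEReduction

namespace UHEReduction

variable {ε : ℤˣ}

open Coord (x y u v q)

/-! ### Frames adapted to the characteristics -/

/-- The reciprocals `α`, `β` of the roots of the characteristic polynomial. -/
structure Roots (ε : ℤˣ) where
  (α β a b w : Ext ε)
  α_mul : α * a = 1
  β_mul : β * b = 1
  w_mul : w * (β - α) = 1
  hs : inc ε (sFun ε) = a + b
  hv : inc ε (coord ε (v 0)) = -(a * b)

theorem inc_invUy_mul : inc ε (invUy ε) * inc ε (coord ε (v 0)) = 1 := by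
  rw [← map_mul, invUy_mul, map_one]

theorem exists_roots (ε : ℤˣ) : Nonempty (Roots ε) := by
  obtain ⟨w, hw⟩ := exists_inv_disc (ε := ε)
  have h := root_sq (ε := ε)
  have hv := inc_invUy_mul (ε := ε)
  -- From ab = -u_y: 1/a = -b/u_y and 1/b = -a/u_y, so β - α = (b - a)/u_y, with inverse -u_y/(2a -
  -- s).
  exact ⟨{
    α := -(inc ε (sFun ε) - root ε) * inc ε (invUy ε)
    β := -root ε * inc ε (invUy ε)
    a := root ε
    b := inc ε (sFun ε) - root ε
    w := -w * inc ε (coord ε (v 0))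
    α_mul := by linear_combination hv + inc ε (invUy ε) * h
    β_mul := by linear_combination hv + inc ε (invUy ε) * h
    w_mul := by
      linear_combination hw + (w * (2 * root ε - inc ε (sFun ε))) * hv
    hs := by ring
    hv := by linear_combination -h }⟩

namespace Roots

variable (r : Roots ε) (p : ℤ)

/-- Interchanging the roots. -/
def swap : Roots ε where
  α := r.β
  β := r.α
  a := r.b
  b := r.a
  w := -r.w
  α_mul := r.β_mul
  β_mul := r.α_mul
  w_mul := by linear_combination r.w_mul
  hs := by rw [r.hs, add_comm]
  hv := by rw [r.hv, mul_comm]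

/-- The characteristic vector field `β D_y + D_x`. -/
def d : Derivation ℝ (Ext ε) (Ext ε) := r.β • extend (Dy ε p) + extend (Dx ε p)

theorem d_apply (F : Ext ε) : r.d p F = r.β * extend (Dy ε p) F + extend (Dx ε p) F := rfl

theorem d_isRegular : (extChart ε).IsRegular (r.d p) :=
  ((extend_isRegular _).smul _).add (extend_isRegular _)

theorem derivation_a (D : Derivation ℝ (Ext ε) (Ext ε)) : D r.a = -r.a ^ 2 * D r.α := by
  have h := congrArg D r.α_mul
  rw [Derivation.leibniz, Derivation.map_one_eq_zero] at h
  simp only [smul_eq_mul] at h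
  linear_combination r.a * h - D r.a * r.α_mul

theorem derivation_w (D : Derivation ℝ (Ext ε) (Ext ε)) : D r.w = -r.w ^ 2 * (D r.β - D r.α) := by
  have h := congrArg D r.w_mul
  rw [Derivation.leibniz, Derivation.map_one_eq_zero, map_sub] at h
  simp only [smul_eq_mul] at h
  linear_combination r.w * h - D r.w * r.w_mul

theorem extend_α (D : Derivation ℝ (Fun ε) (Fun ε)) : extend D r.α =
    -r.w * r.α * r.β * (r.α ^ 2 * inc ε (D (coord ε (v 0))) + r.α * inc ε (D (sFun ε))) := by
  have h : inc ε (coord ε (v 0)) * (r.α * r.α) + inc ε (sFun ε) * r.α = 1 := by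
    rw [r.hs, r.hv]
    linear_combination (1 - r.b * r.α) * r.α_mul
  have h1 := congrArg (extend D) h
  simp only [map_add, Derivation.leibniz, Derivation.map_one_eq_zero, smul_eq_mul,
    extend_inc] at h1
  rw [r.hs, r.hv] at h1
  have h2 : (r.a - r.b) * (r.w * r.α * r.β) = 1 := by
    linear_combination r.w_mul + r.w * r.β * r.α_mul - r.w * r.α * r.β_mul
  linear_combination (r.w * r.α * r.β) * h1 - extend D r.α * h2
    + 2 * r.b * extend D r.α * (r.w * r.α * r.β) * r.α_mul

theorem extend_β (D : Derivation ℝ (Fun ε) (Fun ε)) : extend D r.β =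
    r.w * r.α * r.β * (r.β ^ 2 * inc ε (D (coord ε (v 0))) + r.β * inc ε (D (sFun ε))) := by
  have h := r.swap.extend_α D
  change extend D r.β = -(-r.w) * r.β * r.α * (r.β ^ 2 * _ + r.β * _) at h
  rw [h]
  ring

/-- All derivatives of s and u_y cancel: along d, the function α behaves like a Riemann invariant
with a source depending on α and β only. So d creates new derivatives of β alone, and d' of α alone,
which is what makes the adapted coordinates work. -/
theorem d_α : r.d p r.α = r.α * r.β * r.w := by
  rw [d_apply, extend_α, extend_α, Dy_v_zero, Dy_sFun, Dx_sFun, Dx_v]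
  simp only [map_sub, map_mul, map_add, r.hs, r.hv]
  set sx := inc ε (sxFun ε)
  set v1 := inc ε (coord ε (v 1))
  have h1 := r.α_mul
  have h2 := r.β_mul
  linear_combination r.w * r.α * r.β * ((sx * r.α + 1) * r.β * r.b + v1 * r.α * r.β) * h1 +
    r.w * r.α * r.β * (sx * r.α + 1 + v1 * r.α ^ 2) * h2

theorem d_swap_β : r.swap.d p r.β = -r.α * r.β * r.w := by
  have := r.swap.d_α p
  rw [show r.swap.α = r.β from rfl] at this
  rw [this]
  change r.β * r.α * (-r.w) = _
  ring

/-- As D_x and D_y commute, [d, d'] = (dα - d'β) D_y = 2αβw D_y, and D_y = w(d - d'). -/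
theorem d_lie (F : Ext ε) : r.d p (r.swap.d p F) = r.swap.d p (r.d p F) +
    2 * r.α * r.β * r.w ^ 2 * (r.d p F - r.swap.d p F) := by
  have hc : extend (Dx ε p) (extend (Dy ε p) F) = extend (Dy ε p) (extend (Dx ε p) F) := by
    have : ⁅extend (Dx ε p), extend (Dy ε p)⁆ = 0 := ext_derivation_eq_zero fun r => by
      simp only [Derivation.commutator_apply, extend_inc, Dx_Dy_comm, sub_self]
    have h := DFunLike.congr_fun this F
    rwa [Derivation.commutator_apply, Derivation.zero_apply, sub_eq_zero] at h
  have h1 := r.d_α p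
  have h2 := r.d_swap_β p
  have hw := r.w_mul
  simp only [d_apply, show r.swap.β = r.α from rfl, map_add, Derivation.leibniz, smul_eq_mul] at *
  rw [hc]
  linear_combination extend (Dy ε p) F * (h1 - h2) -
    2 * r.α * r.β * r.w * extend (Dy ε p) F * hw

theorem d_x : r.d p (inc ε (coord ε x)) = 1 := by simp [d_apply, extend_inc]

theorem d_y : r.d p (inc ε (coord ε y)) = r.β := by simp [d_apply, extend_inc]

theorem d_u : r.d p (inc ε (coord ε (u 0))) = r.b - inc ε (coord ε (u 0)) := by
  have hs := r.hs
  rw [sFun, map_add] at hs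
  simp only [d_apply, extend_inc, Dy_u, Dx_u, r.hv]
  linear_combination hs - r.a * r.β_mul

theorem d_Q_zero : r.d p (inc ε (Q ε p 0)) = 0 := by simp [Q]

/-- Because u_y β² + s β = 1, the two-step recursion for q_{i,y} becomes a one-step recursion along
d. Hence d q_i involves neither α nor derivatives of β. -/
theorem d_Q_succ (n : ℕ) : r.d p (inc ε (Q ε p (n + 1))) = r.β * (r.d p (inc ε (Q ε p n)) -
    algebraMap ℝ _ ((p : ℝ) - 1 + n) * inc ε (Q ε p n)) := by
  have hK : ∀ z : ℝ, inc ε (algebraMap ℝ (Fun ε) z) = algebraMap ℝ (Ext ε) z := fun z => rfl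
  rcases n with _ | n
  · rw [d_Q_zero, d_apply, extend_inc, extend_inc, Dy_Q, Dx_Q]
    simp only [Qy, Q, hK, mul_zero, map_zero, map_one, CharP.cast_eq_zero, add_zero,
      map_neg, map_sub]
    ring
  · simp only [d_apply, extend_inc, Dy_Q, Dx_Q, Qy_succ_succ, map_add, map_sub, map_mul, hK]
    have hv := inc_invUy_mul (ε := ε)
    have hβ : inc ε (coord ε (v 0)) * r.β ^ 2 + inc ε (sFun ε) * r.β = 1 := by
      rw [r.hs, r.hv]
      linear_combination (1 - r.a * r.β) * r.β_mul
    rw [Nat.cast_add, Nat.cast_one]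
    simp only [map_neg, map_add, map_one]
    linear_combination (-inc ε (invUy ε) * inc ε (Qy ε p (n + 1))) * hβ +
      r.β ^ 2 * inc ε (Qy ε p (n + 1)) * hv

end Roots

end UHEReduction

/-! ### Orders of functions and the adapted coordinates -/

namespace UHEReduction

variable {ε : ℤˣ}

open Coord (x y u v q)

/-- Dependence on the derivatives of `u_x + u` and of `u_y` of order at most `n` only. -/
def OrdLE (n : ℕ) (F : Ext ε) : Prop :=
  ∀ k, n < k → extend (pd ε (u (k + 1))) F = 0 ∧ extend (pd ε (v k)) F = 0

theorem extend_pd_comm {D : Derivation ℝ (Fun ε) (Fun ε)} {c c' : Coord}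
    (h : ∀ f, pd ε c (D f) = D (pd ε c f) + pd ε c' f) (F : Ext ε) :
    extend (pd ε c) (extend D F) = extend D (extend (pd ε c) F) + extend (pd ε c') F := by
  have : ⁅extend (pd ε c), extend D⁆ = extend (pd ε c') := ext_derivation_ext fun r => by
    simp only [Derivation.commutator_apply, extend_inc, h, map_add, add_sub_cancel_left]
  rw [← this, Derivation.commutator_apply, add_sub_cancel]

variable {p : ℤ}

theorem extend_pd_Dx {F : Ext ε} {n m : ℕ} (hF : OrdLE n F) (hm : n ≤ m) :
    extend (pd ε (u (m + 2))) (extend (Dx ε p) F) = extend (pd ε (u (m + 1))) F ∧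
    extend (pd ε (v (m + 1))) (extend (Dx ε p) F) = extend (pd ε (v m)) F := by
  constructor
  · rw [extend_pd_comm (pd_u_Dx m), (hF (m + 1) (by omega)).1, map_zero, zero_add]
  · rw [extend_pd_comm (pd_v_Dx m), (hF (m + 1) (by omega)).2, map_zero, zero_add]

theorem extend_pd_comm_sum {c : Coord} {D : Derivation ℝ (Fun ε) (Fun ε)} {F : Ext ε} {n : ℕ}
    (h0 : extend (pd ε c) F = 0)
    (h : ∀ e, e ≠ u (n + 1) → e ≠ v n → pd ε c (D (coord ε e)) = 0 ∨ extend (pd ε e) F = 0) :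
    extend (pd ε c) (extend D F) =
      inc ε (pd ε c (D (coord ε (u (n + 1))))) * extend (pd ε (u (n + 1))) F +
      inc ε (pd ε c (D (coord ε (v n)))) * extend (pd ε (v n)) F := by
  have hs : (extChart ε).supp F ⊆ (extChart ε).supp F ∪ {u (n + 1), v n} :=
    Finset.subset_union_left
  have key := (extChart ε).der_apply_comm (extend_isRegular D) c hs
  change extend (pd ε c) (extend D F) = extend D (extend (pd ε c) F) + ∑ e ∈ _,
    extend (pd ε c) (extend D (inc ε (coord ε e))) * extend (pd ε e) F at key
  rw [key, h0, map_zero, zero_add, ← Finset.sum_subset (s₁ := {u (n + 1), v n})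
    Finset.subset_union_right, Finset.sum_pair (by simp)]
  · simp only [extend_inc]
  · intro e _ he
    simp only [Finset.mem_insert, Finset.mem_singleton, not_or] at he
    rcases h e he.1 he.2 with h | h
    · rw [extend_inc, extend_inc, h, map_zero, zero_mul]
    · rw [h, mul_zero]

theorem extend_pd_Dy {F : Ext ε} {n m : ℕ} (hF : OrdLE n F) (hm : n ≤ m) :
    extend (pd ε (u (m + 2))) (extend (Dy ε p) F) =
      (if m = n then inc ε (coord ε (v 0)) * extend (pd ε (v n)) F else 0) ∧
    extend (pd ε (v (m + 1))) (extend (Dy ε p) F) =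
      if m = n then extend (pd ε (u (n + 1))) F - inc ε (sFun ε) * extend (pd ε (v n)) F else 0 := by
  constructor
  · rw [extend_pd_comm_sum (n := n) (hF (m + 1) (by omega)).1]
    · rw [Dy_u, Dy_v, show m + 2 = n + (m - n) + 2 by omega, (pd_iterate_rhs n).1]
      rcases hm.eq_or_lt with rfl | h
      · simp [pd_coord]
      · simp [pd_coord, show m - n ≠ 0 by omega, show m ≠ n by omega]
    · intro e he he'
      cases e with
      | x => left; simp
      | y => left; simp
      | u k => left; simp [pd_coord]
      | v k =>
        rcases lt_or_ge n k with hk | hk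
        · exact Or.inr (hF k hk).2
        · left
          have : k ≠ n := fun h => he' (by rw [h])
          rw [Dy_v, show m + 2 = k + (m - k) + 2 by omega, (pd_iterate_rhs k).1,
            if_neg (by omega)]
      | q k => left; simp [pd_Qy_eq_zero]
  · rw [extend_pd_comm_sum (n := n) (hF (m + 1) (by omega)).2]
    · rw [Dy_u, Dy_v, show m + 1 = n + (m - n) + 1 by omega, (pd_iterate_rhs n).2]
      rcases hm.eq_or_lt with rfl | h
      · simp [pd_coord]; ring
      · simp [pd_coord, show m - n ≠ 0 by omega, show m ≠ n by omega]
    · intro e he he'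
      cases e with
      | x => left; simp
      | y => left; simp
      | u k =>
        rcases eq_or_ne k (m + 1) with rfl | hk
        · right
          exact (hF m (by by_contra h; exact he (by rw [show m = n by omega]))).1
        · left; simp [pd_coord, hk.symm]
      | v k =>
        rcases lt_or_ge n k with hk | hk
        · exact Or.inr (hF k hk).2
        · left
          have : k ≠ n := fun h => he' (by rw [h])
          rw [Dy_v, show m + 1 = k + (m - k) + 1 by omega, (pd_iterate_rhs k).2,
            if_neg (by omega)]
      | q k => left; simp [pd_Qy_eq_zero]

namespace Roots

variable (r : Roots ε) (p : ℤ)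

theorem ordLE_d {F : Ext ε} {n : ℕ} (hF : OrdLE n F) : OrdLE (n + 1) (r.d p F) := by
  have hβ : ∀ k, 0 < k → extend (pd ε (u (k + 1))) r.β = 0 ∧ extend (pd ε (v k)) r.β = 0 := by
    intro k hk
    rw [extend_β, extend_β]
    simp [pd_coord, sFun, show k ≠ 0 by omega]
  intro k hk
  obtain ⟨m, rfl⟩ : ∃ m, k = m + 1 := ⟨k - 1, by omega⟩
  have h1 := extend_pd_Dx (p := p) hF (show n ≤ m by omega)
  have h2 := extend_pd_Dy (p := p) hF (show n ≤ m by omega)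
  have h3 := hF m (by omega)
  have h4 := hβ (m + 1) (by omega)
  have hmn : m ≠ n := by omega
  simp only [d_apply, map_add, Derivation.leibniz, smul_eq_mul, h4.1, h4.2, h1.1, h1.2, h2.1, h2.2,
    h3.1, h3.2, hmn, if_false, mul_zero, add_zero, and_self]

theorem ordLE_β : OrdLE 0 r.β := by
  intro k hk
  rw [extend_β, extend_β]
  simp [pd_coord, sFun, show k ≠ 0 by omega]

/-- The functions `dⁿ β`. -/
def B (n : ℕ) : Ext ε := (r.d p)^[n] r.β

theorem B_succ (n : ℕ) : r.B p (n + 1) = r.d p (r.B p n) := Function.iterate_succ_apply' _ _ _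

theorem ordLE_B (n : ℕ) : OrdLE n (r.B p n) := by
  induction n with
  | zero => exact r.ordLE_β
  | succ n ih => rw [B_succ]; exact r.ordLE_d p ih

/-- By `extend_pd_Dy`, D_y sends the pair of leading derivatives (F_u, F_v) to (u_y F_v, F_u - s
F_v). The vector (1, β) is an eigenvector with eigenvalue u_y β = -a, so d multiplies it by 1 - aβ =
-a(β - α), which is invertible. -/
theorem leading_B (n : ℕ) : ∃ μ : Ext ε, IsUnit μ ∧
    extend (pd ε (u (n + 1))) (r.B p n) = μ ∧ extend (pd ε (v n)) (r.B p n) = μ * r.β := by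
  have uα : IsUnit r.α := IsUnit.of_mul_eq_one _ r.α_mul
  have uβ : IsUnit r.β := IsUnit.of_mul_eq_one _ r.β_mul
  have uw : IsUnit r.w := IsUnit.of_mul_eq_one _ r.w_mul
  induction n with
  | zero =>
    refine ⟨r.w * r.α * r.β * r.β, ((uw.mul uα).mul uβ).mul uβ, ?_, ?_⟩
    · simp [B, extend_β, pd_coord, sFun]
    · simp [B, extend_β, pd_coord, sFun]; ring
  | succ n ih =>
    obtain ⟨μ, hμ, h1, h2⟩ := ih
    have u1 : IsUnit (1 - r.β * r.a) := by
      refine IsUnit.of_mul_eq_one (-r.α * r.w) ?_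
      linear_combination r.w_mul + r.β * r.w * r.α_mul
    have hβ := r.ordLE_β (n + 1) (by omega)
    have k1 := extend_pd_Dx (p := p) (r.ordLE_B p n) le_rfl
    have k2 := extend_pd_Dy (p := p) (r.ordLE_B p n) le_rfl
    refine ⟨μ * (1 - r.β * r.a), hμ.mul u1, ?_, ?_⟩
    · simp only [B_succ, d_apply, map_add, Derivation.leibniz, smul_eq_mul, hβ.1, k1.1, k2.1,
        if_true, h1, h2, r.hv]
      linear_combination -μ * r.β * r.a * r.β_mul
    · simp only [B_succ, d_apply, map_add, Derivation.leibniz, smul_eq_mul, hβ.2, k1.2, k2.2,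
        if_true, h1, h2, r.hs]
      linear_combination -μ * r.β * r.β_mul

/-- The adapted coordinates. -/
def newCoord : Coord → Ext ε
  | x => inc ε (coord ε x)
  | y => inc ε (coord ε y)
  | u 0 => inc ε (coord ε (u 0))
  | u (k + 1) => r.swap.B p k
  | v k => r.B p k
  | q n => inc ε (coord ε (q n))

/-- The leading vectors (1, α) of d'ⁿα and (1, β) of dⁿβ are independent since β - α is invertible;
the witnesses solve the resulting two-by-two system. -/
theorem exists_leading (n : ℕ) (e f : Ext ε) : ∃ c c' : Ext ε,
    (c • extend (pd ε (u (n + 1))) + c' • extend (pd ε (v n))) (r.swap.B p n) = e ∧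
    (c • extend (pd ε (u (n + 1))) + c' • extend (pd ε (v n))) (r.B p n) = f := by
  obtain ⟨μ, hμ, h1, h2⟩ := r.leading_B p n
  obtain ⟨ν, hν, h3, h4⟩ := r.swap.leading_B p n
  obtain ⟨μ', hμ'⟩ := hμ.exists_right_inv
  obtain ⟨ν', hν'⟩ := hν.exists_right_inv
  change _ = ν * r.α at h4
  refine ⟨e * ν' - r.α * (r.w * (f * μ' - e * ν')), r.w * (f * μ' - e * ν'), ?_, ?_⟩
  · simp only [Derivation.add_apply, Derivation.smul_apply, smul_eq_mul, h3, h4]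
    linear_combination e * hν'
  · simp only [Derivation.add_apply, Derivation.smul_apply, smul_eq_mul, h1, h2]
    linear_combination (f * μ' - e * ν') * μ * r.w_mul + f * hμ'

/-- There is a regular derivation with arbitrary values on the adapted coordinates. -/
theorem exists_derivation (z : Coord → Ext ε) : ∃ D : Derivation ℝ (Ext ε) (Ext ε),
    (extChart ε).IsRegular D ∧ ∀ c, D (r.newCoord p c) = z c := by
  choose! c c' hA hB using r.exists_leading p
  let T : Type := {D : Derivation ℝ (Ext ε) (Ext ε) // (extChart ε).IsRegular D}
  -- The n-th correction points along u_{n+1} and v_n only. It kills functions of order below n, so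
  -- values prescribed earlier persist.
  let step : ℕ → T → T := fun n D => ⟨D.1 +
    (c n (z (u (n + 1)) - D.1 (r.swap.B p n)) (z (v n) - D.1 (r.B p n)) • extend (pd ε (u (n + 1))) +
    c' n (z (u (n + 1)) - D.1 (r.swap.B p n)) (z (v n) - D.1 (r.B p n)) • extend (pd ε (v n))),
    D.2.add (((extend_isRegular _).smul _).add ((extend_isRegular _).smul _))⟩
  let D : ℕ → T := fun n => Nat.rec ⟨(extChart ε).vf fun
    | u (_ + 1) => 0
    | v _ => 0
    | c => z c, (extChart ε).isRegular_vf _⟩ step n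
  have hstep : ∀ n, (D (n + 1)).1 (r.swap.B p n) = z (u (n + 1)) ∧
      (D (n + 1)).1 (r.B p n) = z (v n) := fun n => by
    constructor
    · change ((D n).1 + _) _ = _
      rw [Derivation.add_apply, hA, add_sub_cancel]
    · change ((D n).1 + _) _ = _
      rw [Derivation.add_apply, hB, add_sub_cancel]
  have hstable : ∀ n e, e ≠ u (n + 1) → e ≠ v n →
      (D (n + 1)).1 (inc ε (coord ε e)) = (D n).1 (inc ε (coord ε e)) := fun n e he he' => by
    change ((D n).1 + _) _ = _
    simp [extend_inc, pd_coord, he.symm, he'.symm]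
  have hbase : ∀ n e, (∀ k, e ≠ u (k + 1)) → (∀ k, e ≠ v k) →
      (D n).1 (inc ε (coord ε e)) = z e := fun n e he he' => by
    induction n with
    | zero =>
      refine ((extChart ε).vf_coord _ e).trans ?_
      cases e with
      | u k => cases k with
        | zero => rfl
        | succ k => exact absurd rfl (he k)
      | v k => exact absurd rfl (he' k)
      | _ => rfl
    | succ n ih => rw [hstable n e (he n) (he' n), ih]
  have hu : ∀ k n, k < n → (D n).1 (inc ε (coord ε (u (k + 1)))) =
      (D (k + 1)).1 (inc ε (coord ε (u (k + 1)))) := fun k n hk => by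
    induction n, hk using Nat.le_induction with
    | base => rfl
    | succ n hn ih => rw [hstable n _ (by simp; omega) (by simp), ih]
  have hv : ∀ k n, k < n → (D n).1 (inc ε (coord ε (v k))) =
      (D (k + 1)).1 (inc ε (coord ε (v k))) := fun k n hk => by
    induction n, hk using Nat.le_induction with
    | base => rfl
    | succ n hn ih => rw [hstable n _ (by simp) (by simp; omega), ih]
  -- The limit field. The values on u_{k+1} and v_k do not change after stage k + 1, so on functions
  -- of order at most n it agrees with stage n + 1.
  let L := (extChart ε).vf fun
    | u (k + 1) => (D (k + 1)).1 (inc ε (coord ε (u (k + 1))))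
    | v k => (D (k + 1)).1 (inc ε (coord ε (v k)))
    | c => z c
  have hL : ∀ n F, OrdLE n F → L F = (D (n + 1)).1 F := fun n F hF => by
    rw [← sub_eq_zero, ← Derivation.sub_apply]
    refine (((extChart ε).isRegular_vf _).sub (D (n + 1)).2).apply_eq_zero fun e => ?_
    rw [Derivation.sub_apply, (extChart ε).vf_coord, sub_eq_zero]
    cases e with
    | x => exact Or.inl (hbase (n + 1) x (by simp) (by simp)).symm
    | y => exact Or.inl (hbase (n + 1) y (by simp) (by simp)).symm
    | u k => cases k with
      | zero => exact Or.inl (hbase (n + 1) (u 0) (by simp) (by simp)).symm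
      | succ k =>
        rcases lt_or_ge n k with hk | hk
        · exact Or.inr (hF k hk).1
        · exact Or.inl (hu k (n + 1) (by omega)).symm
    | v k =>
      rcases lt_or_ge n k with hk | hk
      · exact Or.inr (hF k hk).2
      · exact Or.inl (hv k (n + 1) (by omega)).symm
    | q k => exact Or.inl (hbase (n + 1) (q k) (by simp) (by simp)).symm
  refine ⟨L, (extChart ε).isRegular_vf _, fun e => ?_⟩
  cases e with
  | x => exact (extChart ε).vf_coord _ x
  | y => exact (extChart ε).vf_coord _ y
  | u k => cases k with
    | zero => exact (extChart ε).vf_coord _ (u 0)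
    | succ k => exact (hL k _ (r.swap.ordLE_B p k)).trans (hstep k).1
  | v k => exact (hL k _ (r.ordLE_B p k)).trans (hstep k).2
  | q k => exact (extChart ε).vf_coord _ (q k)

end Roots

end UHEReduction

/-! ### The chart of adapted coordinates -/

namespace UHEReduction

variable {ε : ℤˣ}

open Coord (x y u v q)

theorem adjoin_derivation_mem {A : Type} [CommRing A] [Algebra ℝ A] {s : Set A}
    {D : Derivation ℝ A A} (h : ∀ F ∈ s, D F ∈ Algebra.adjoin ℝ s) {F : A}
    (hF : F ∈ Algebra.adjoin ℝ s) : D F ∈ Algebra.adjoin ℝ s := by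
  induction hF using Algebra.adjoin_induction with
  | mem F hF => exact h F hF
  | algebraMap z => rw [Derivation.map_algebraMap]; exact zero_mem _
  | add F G _ _ hF hG => rw [map_add]; exact add_mem hF hG
  | mul F G h1 h2 hF hG =>
    rw [Derivation.leibniz]
    exact add_mem (mul_mem h1 hG) (mul_mem h2 hF)

namespace Roots

variable (r : Roots ε) (p : ℤ)

theorem derivation_b (D : Derivation ℝ (Ext ε) (Ext ε)) : D r.b = -r.b ^ 2 * D r.β :=
  r.swap.derivation_a D

/-- Algebraic functions of the derivatives of `β` along `d`. -/
def betaAlg : Subalgebra ℝ (Ext ε) :=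
  Algebra.adjoin ℝ ({r.α, r.a, r.b, r.w} ∪ Set.range (r.B p))

theorem d_mem_betaAlg {F : Ext ε} (hF : F ∈ r.betaAlg p) : r.d p F ∈ r.betaAlg p := by
  have hB : ∀ n, r.B p n ∈ r.betaAlg p := fun n => Algebra.subset_adjoin (Or.inr ⟨n, rfl⟩)
  have hα : r.α ∈ r.betaAlg p := Algebra.subset_adjoin (by simp)
  have ha : r.a ∈ r.betaAlg p := Algebra.subset_adjoin (by simp)
  have hb : r.b ∈ r.betaAlg p := Algebra.subset_adjoin (by simp)
  have hw : r.w ∈ r.betaAlg p := Algebra.subset_adjoin (by simp)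
  have hdα : r.d p r.α ∈ r.betaAlg p := by
    rw [d_α]; exact mul_mem (mul_mem hα (hB 0)) hw
  have hdβ : r.d p r.β ∈ r.betaAlg p := hB 1
  refine adjoin_derivation_mem (fun F hF => ?_) hF
  rcases hF with (rfl | rfl | rfl | rfl) | ⟨n, rfl⟩
  · exact hdα
  · rw [derivation_a]; exact mul_mem (neg_mem (pow_mem ha 2)) hdα
  · rw [derivation_b]; exact mul_mem (neg_mem (pow_mem hb 2)) hdβ
  · rw [derivation_w]; exact mul_mem (neg_mem (pow_mem hw 2)) (sub_mem hdβ hdα)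
  · rw [← B_succ]; exact hB _

theorem d_swap_B_succ (n : ℕ) : r.swap.d p (r.B p (n + 1)) = r.d p (r.swap.d p (r.B p n)) +
    2 * r.α * r.β * r.w ^ 2 * (r.swap.d p (r.B p n) - r.B p (n + 1)) := by
  rw [B_succ]
  linear_combination -r.d_lie p (r.B p n)

/-- Moving d' past d reduces d'(dⁿβ) to d'β = -αβw; no derivative of α along d' is ever produced. -/
theorem d_swap_B_mem (n : ℕ) : r.swap.d p (r.B p n) ∈ r.betaAlg p := by
  have hB : ∀ n, r.B p n ∈ r.betaAlg p := fun n => Algebra.subset_adjoin (Or.inr ⟨n, rfl⟩)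
  have hα : r.α ∈ r.betaAlg p := Algebra.subset_adjoin (by simp)
  have hw : r.w ∈ r.betaAlg p := Algebra.subset_adjoin (by simp)
  induction n with
  | zero =>
    change r.swap.d p r.β ∈ _
    rw [d_swap_β]
    exact mul_mem (mul_mem (neg_mem hα) (hB 0)) hw
  | succ n ih =>
    rw [d_swap_B_succ]
    exact add_mem (d_mem_betaAlg r p ih) (mul_mem (mul_mem (mul_mem (mul_mem (ofNat_mem _ 2) hα)
      (hB 0)) (pow_mem hw 2)) (sub_mem ih (hB _)))

/-- The generators of the algebra of algebraic functions of the adapted coordinates. -/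
def frameGen : Set (Ext ε) := {r.a, r.b, r.w} ∪ Set.range (r.newCoord p)

theorem frameGen_swap : r.swap.frameGen p ⊆ Algebra.adjoin ℝ (r.frameGen p) := by
  rintro F ((rfl | rfl | rfl) | ⟨c, rfl⟩)
  · exact Algebra.subset_adjoin (Or.inl (by simp [swap]))
  · exact Algebra.subset_adjoin (Or.inl (by simp [swap]))
  · exact neg_mem (Algebra.subset_adjoin (Or.inl (by simp)))
  · refine Algebra.subset_adjoin (Or.inr ?_)
    cases c with
    | x => exact ⟨x, rfl⟩
    | y => exact ⟨y, rfl⟩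
    | u k => cases k with
      | zero => exact ⟨u 0, rfl⟩
      | succ k => exact ⟨v k, rfl⟩
    | v k => exact ⟨u (k + 1), rfl⟩
    | q n => exact ⟨q n, rfl⟩

theorem swap_swap : r.swap.swap = r := by
  cases r
  simp [swap]

theorem adjoin_frameGen_swap :
    Algebra.adjoin ℝ (r.swap.frameGen p) = Algebra.adjoin ℝ (r.frameGen p) :=
  le_antisymm (Algebra.adjoin_le (r.frameGen_swap p))
    (Algebra.adjoin_le (by simpa only [swap_swap] using r.swap.frameGen_swap p))

/-- Both d and, by symmetry, d' preserve this algebra, and D_x is a combination of them. All jet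
coordinates are then recovered by differentiating s = a + b and u_y = -ab. -/
theorem d_mem_adjoin {F : Ext ε} (hF : F ∈ Algebra.adjoin ℝ (r.frameGen p)) :
    r.d p F ∈ Algebra.adjoin ℝ (r.frameGen p) := by
  have hN : ∀ c, r.newCoord p c ∈ Algebra.adjoin ℝ (r.frameGen p) :=
    fun c => Algebra.subset_adjoin (Or.inr ⟨c, rfl⟩)
  have ha : r.a ∈ Algebra.adjoin ℝ (r.frameGen p) := Algebra.subset_adjoin (Or.inl (by simp))
  have hb : r.b ∈ Algebra.adjoin ℝ (r.frameGen p) := Algebra.subset_adjoin (Or.inl (by simp))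
  have hw : r.w ∈ Algebra.adjoin ℝ (r.frameGen p) := Algebra.subset_adjoin (Or.inl (by simp))
  have hα : r.α ∈ Algebra.adjoin ℝ (r.frameGen p) := hN (u 1)
  have hβ : r.β ∈ Algebra.adjoin ℝ (r.frameGen p) := hN (v 0)
  have hdα : r.d p r.α ∈ Algebra.adjoin ℝ (r.frameGen p) := by
    rw [d_α]; exact mul_mem (mul_mem hα hβ) hw
  have hdβ : r.d p r.β ∈ Algebra.adjoin ℝ (r.frameGen p) := hN (v 1)
  have hQ : ∀ n, inc ε (Q ε p n) ∈ Algebra.adjoin ℝ (r.frameGen p) := fun n => by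
    rcases n with _ | _ | n
    · simp only [Q, map_one]; exact one_mem _
    · have : inc ε (Q ε p 1) = (-((p : ℝ) - 1)) • inc ε (coord ε y) := by
        rw [Q, Algebra.smul_def, map_mul, Algebra.smul_def]
        rfl
      rw [zero_add, this]
      exact Subalgebra.smul_mem _ (hN y) _
    · exact hN (q n)
  have hdQ : ∀ n, r.d p (inc ε (Q ε p n)) ∈ Algebra.adjoin ℝ (r.frameGen p) := fun n => by
    induction n with
    | zero => rw [d_Q_zero]; exact zero_mem _
    | succ n ih =>
      rw [d_Q_succ]
      exact mul_mem hβ (sub_mem ih (mul_mem (Subalgebra.algebraMap_mem _ _) (hQ n)))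
  have hle : r.swap.betaAlg p ≤ Algebra.adjoin ℝ (r.frameGen p) := by
    refine Algebra.adjoin_le ?_
    rintro F ((rfl | rfl | rfl | rfl) | ⟨n, rfl⟩)
    · exact hβ
    · exact hb
    · exact ha
    · exact neg_mem hw
    · exact hN (u (n + 1))
  refine adjoin_derivation_mem (fun F hF => ?_) hF
  rcases hF with (rfl | rfl | rfl) | ⟨c, rfl⟩
  · rw [derivation_a]; exact mul_mem (neg_mem (pow_mem ha 2)) hdα
  · rw [derivation_b]; exact mul_mem (neg_mem (pow_mem hb 2)) hdβ
  · rw [derivation_w]; exact mul_mem (neg_mem (pow_mem hw 2)) (sub_mem hdβ hdα)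
  · cases c with
    | x => exact (r.d_x p).symm ▸ one_mem _
    | y => exact (r.d_y p).symm ▸ hβ
    | u k => cases k with
      | zero => exact (r.d_u p).symm ▸ sub_mem hb (hN (u 0))
      | succ k => exact hle (r.swap.d_swap_B_mem p k)
    | v k => exact (r.B_succ p k) ▸ hN (v (k + 1))
    | q n => exact hdQ (n + 2)

/-- The original coordinates are algebraic functions of the adapted coordinates. -/
theorem coord_mem_adjoin (c : Coord) : inc ε (coord ε c) ∈ Algebra.adjoin ℝ (r.frameGen p) := by
  have hN : ∀ c, r.newCoord p c ∈ Algebra.adjoin ℝ (r.frameGen p) :=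
    fun c => Algebra.subset_adjoin (Or.inr ⟨c, rfl⟩)
  have ha : r.a ∈ Algebra.adjoin ℝ (r.frameGen p) := Algebra.subset_adjoin (Or.inl (by simp))
  have hb : r.b ∈ Algebra.adjoin ℝ (r.frameGen p) := Algebra.subset_adjoin (Or.inl (by simp))
  have hw : r.w ∈ Algebra.adjoin ℝ (r.frameGen p) := Algebra.subset_adjoin (Or.inl (by simp))
  have hDx : ∀ F ∈ Algebra.adjoin ℝ (r.frameGen p),
      extend (Dx ε p) F ∈ Algebra.adjoin ℝ (r.frameGen p) := fun F hF => by
    have h1 := r.d_mem_adjoin p hF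
    have h2 : r.swap.d p F ∈ Algebra.adjoin ℝ (r.frameGen p) := by
      rw [← adjoin_frameGen_swap] at hF ⊢
      exact r.swap.d_mem_adjoin p hF
    have : extend (Dx ε p) F = r.w * (r.β * r.swap.d p F - r.α * r.d p F) := by
      rw [d_apply, d_apply]
      change _ = r.w * (r.β * (r.α * _ + _) - _)
      linear_combination -extend (Dx ε p) F * r.w_mul
    rw [this]
    exact mul_mem hw (sub_mem (mul_mem (hN (v 0)) h2) (mul_mem (hN (u 1)) h1))
  have hu1 : inc ε (coord ε (u 1)) ∈ Algebra.adjoin ℝ (r.frameGen p) := by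
    have h := r.hs
    rw [sFun, map_add] at h
    rw [eq_sub_of_add_eq h]
    exact sub_mem (add_mem ha hb) (hN (u 0))
  cases c with
  | x => exact hN x
  | y => exact hN y
  | u k =>
    cases k with
    | zero => exact hN (u 0)
    | succ k =>
      induction k with
      | zero => exact hu1
      | succ k ih =>
        have := hDx _ ih
        rwa [extend_inc, Dx_u] at this
  | v k =>
    induction k with
    | zero => rw [r.hv]; exact neg_mem (mul_mem ha hb)
    | succ k ih =>
      have := hDx _ ih
      rwa [extend_inc, Dx_v] at this
  | q n => exact hN (q n)

theorem coord_mem_of_newCoord_mem {S : Subalgebra ℝ (Ext ε)} (h : ∀ c, r.newCoord p c ∈ S)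
    (hinv : ∀ a ∈ S, ∀ b, a * b = 1 → b ∈ S) (c : Coord) : inc ε (coord ε c) ∈ S := by
  refine Algebra.adjoin_le (S := S) ?_ (r.coord_mem_adjoin p c)
  rintro F ((rfl | rfl | rfl) | ⟨c, rfl⟩)
  · exact hinv _ (h (u 1)) _ r.α_mul
  · exact hinv _ (h (v 0)) _ r.β_mul
  · exact hinv _ (sub_mem (h (v 0)) (h (u 1))) _ ((mul_comm _ _).trans r.w_mul)
  · exact h c

theorem eq_of_newCoord {D D' : Derivation ℝ (Ext ε) (Ext ε)} (hD : (extChart ε).IsRegular D)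
    (hD' : (extChart ε).IsRegular D') (h : ∀ c, D (r.newCoord p c) = D' (r.newCoord p c)) :
    D = D' := by
  let S : Subalgebra ℝ (Ext ε) :=
    { carrier := {F | D F = D' F}
      mul_mem' := fun {a b} ha hb => by
        simp only [Set.mem_ofPred_eq] at *
        rw [Derivation.leibniz, ha, hb, Derivation.leibniz]
      add_mem' := fun {a b} ha hb => by
        simp only [Set.mem_ofPred_eq] at *
        rw [map_add, ha, hb, map_add]
      algebraMap_mem' := fun r => by simp }
  refine hD.eq_of_coord hD' fun c => r.coord_mem_of_newCoord_mem p (S := S) h ?_ c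
  intro a ha b hab
  have h1 := congrArg D hab
  have h2 := congrArg D' hab
  have ha' : D a = D' a := ha
  rw [Derivation.leibniz, Derivation.map_one_eq_zero] at h1 h2
  simp only [smul_eq_mul] at h1 h2
  change D b = D' b
  linear_combination b * (h1 - h2) - b * b * ha' - (D b - D' b) * hab

/-- The dual derivations of the adapted coordinates. -/
def newDer (c : Coord) : Derivation ℝ (Ext ε) (Ext ε) :=
  (r.exists_derivation p fun c' => if c = c' then 1 else 0).choose

theorem newDer_isRegular (c : Coord) : (extChart ε).IsRegular (r.newDer p c) :=
  (r.exists_derivation p fun c' => if c = c' then 1 else 0).choose_spec.1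

theorem newDer_newCoord (c c' : Coord) :
    r.newDer p c (r.newCoord p c') = if c = c' then 1 else 0 :=
  (r.exists_derivation p fun c' => if c = c' then 1 else 0).choose_spec.2 c'

/-- The adapted chart. -/
def chart : Chart (Ext ε) where
  ξ := r.newCoord p
  der := r.newDer p
  der_coord := r.newDer_newCoord p
  der_comm c c' F := by
    have : ⁅r.newDer p c, r.newDer p c'⁆ = 0 := by
      refine r.eq_of_newCoord p ((r.newDer_isRegular p c).lie (r.newDer_isRegular p c'))
        (by intro F; simp) fun e => ?_
      rw [Derivation.commutator_apply, newDer_newCoord, newDer_newCoord]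
      split_ifs <;> simp
    have h := DFunLike.congr_fun this F
    rwa [Derivation.commutator_apply, Derivation.zero_apply, sub_eq_zero] at h
  finite_der := by
    let S : Subalgebra ℝ (Ext ε) :=
      { carrier := {F | (Function.support fun c => r.newDer p c F).Finite}
        mul_mem' := fun {a b} ha hb => (ha.union hb).subset fun c hc => by
          by_contra h
          simp only [Set.mem_union, Function.mem_support, not_or, not_not] at h hc
          exact hc (by rw [Derivation.leibniz, h.1, h.2, smul_zero, smul_zero, add_zero])
        add_mem' := fun {a b} ha hb => (ha.union hb).subset fun c hc => by
          by_contra h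
          simp only [Set.mem_union, Function.mem_support, not_or, not_not] at h hc
          exact hc (by rw [map_add, h.1, h.2, add_zero])
        algebraMap_mem' := fun r => by simp }
    have hS : ∀ c, inc ε (coord ε c) ∈ S := by
      refine r.coord_mem_of_newCoord_mem p (fun c => (Set.finite_singleton c).subset ?_) ?_
      · intro c' hc'
        by_contra h
        exact hc' ((r.newDer_newCoord p c' c).trans (if_neg h))
      · intro a ha b hab
        refine (show Set.Finite _ from ha).subset fun c hc h => ?_
        have h : r.newDer p c a = 0 := h
        have h1 := congrArg (r.newDer p c) hab
        rw [Derivation.leibniz, h, Derivation.map_one_eq_zero] at h1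
        simp only [smul_eq_mul, Function.mem_support] at h1 hc
        exact hc (by linear_combination b * h1 - r.newDer p c b * hab)
    intro F
    refine ((extChart ε).supp F).finite_toSet.biUnion (fun c _ => hS c) |>.subset fun c hc => ?_
    by_contra h
    simp only [Set.mem_iUnion, not_exists] at h
    refine hc ((r.newDer_isRegular p c F).trans (Finset.sum_eq_zero fun e he => ?_))
    have : r.newDer p c (inc ε (coord ε e)) = 0 := by
      by_contra h'
      exact h e he h'
    change r.newDer p c (inc ε (coord ε e)) * _ = 0
    rw [this, zero_mul]

/-- The chain rule, available because every original coordinate is an algebraic expression in the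
adapted ones. -/
theorem chart_isRegular {D : Derivation ℝ (Ext ε) (Ext ε)} (hD : (extChart ε).IsRegular D) :
    (r.chart p).IsRegular D := by
  intro F
  have key : ∀ c, D (inc ε (coord ε c)) =
      (r.chart p).vf (fun c => D (r.newCoord p c)) (inc ε (coord ε c)) := by
    let D' := (r.chart p).vf (fun c => D (r.newCoord p c))
    let S : Subalgebra ℝ (Ext ε) :=
      { carrier := {F | D F = D' F}
        mul_mem' := fun {a b} ha hb => by
          simp only [Set.mem_ofPred_eq] at *
          rw [Derivation.leibniz, ha, hb, Derivation.leibniz]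
        add_mem' := fun {a b} ha hb => by
          simp only [Set.mem_ofPred_eq] at *
          rw [map_add, ha, hb, map_add]
        algebraMap_mem' := fun r => by simp }
    refine r.coord_mem_of_newCoord_mem p (S := S)
      (fun c => ((r.chart p).vf_coord (fun c => D (r.newCoord p c)) c).symm) ?_
    intro a ha b hab
    have h1 := congrArg D hab
    have h2 := congrArg D' hab
    have ha' : D a = D' a := ha
    rw [Derivation.leibniz, Derivation.map_one_eq_zero] at h1 h2
    simp only [smul_eq_mul] at h1 h2
    change D b = D' b
    linear_combination b * (h1 - h2) - b * b * ha' - (D b - D' b) * hab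
  set T := (r.chart p).supp F ∪
    ((extChart ε).supp F).biUnion fun c => (r.chart p).supp (inc ε (coord ε c)) with hT
  have h1 : D F = ∑ c ∈ (extChart ε).supp F, ∑ e ∈ T, D (r.newCoord p e) *
      (r.newDer p e (inc ε (coord ε c)) * extend (pd ε c) F) := by
    rw [hD F]
    refine Finset.sum_congr rfl fun c hc => ?_
    change D (inc ε (coord ε c)) * extend (pd ε c) F = _
    rw [key c]
    have : (r.chart p).supp (inc ε (coord ε c)) ⊆ T := fun e he =>
      Finset.mem_union_right _ (Finset.mem_biUnion.2 ⟨c, hc, he⟩)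
    refine (congrArg (· * extend (pd ε c) F) ((r.chart p).finsum_eq _ this)).trans ?_
    simp only [Finset.sum_mul, mul_assoc]
    rfl
  refine Eq.trans ?_ ((r.chart p).finsum_eq (fun c => D (r.newCoord p c))
    (Finset.subset_union_left : _ ⊆ T)).symm |>.trans ((r.chart p).finsum_eq _ subset_rfl)
  rw [h1, Finset.sum_comm]
  refine Finset.sum_congr rfl fun e _ => ?_
  rw [← Finset.mul_sum]
  exact congrArg _ (r.newDer_isRegular p e F).symm

end Roots

end UHEReduction

namespace UHEReduction

variable {ε : ℤˣ}

open Coord (x y u v q)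

/-! ### Expansions in a transcendental element -/

/-- The constants of a derivation. -/
def constants {A : Type} [CommRing A] [Algebra ℝ A] (D : Derivation ℝ A A) : Subalgebra ℝ A where
  carrier := {F | D F = 0}
  mul_mem' := fun {a b} ha hb => by
    simp only [Set.mem_ofPred_eq] at *
    rw [Derivation.leibniz, ha, hb, smul_zero, smul_zero, add_zero]
  add_mem' := fun {a b} ha hb => by
    simp only [Set.mem_ofPred_eq] at *
    rw [map_add, ha, hb, add_zero]
  algebraMap_mem' := fun r => D.map_algebraMap r

section

variable {A : Type} [CommRing A] [Algebra ℝ A] {D : Derivation ℝ A A}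

theorem derivation_two (D : Derivation ℝ A A) : D 2 = 0 := by
  have := D.map_natCast 2
  simpa using this

open Polynomial in
theorem derivation_aeval_constants (δ : A) (f : (constants D)[X]) :
    D (aeval δ f) = aeval δ (derivative f) * D δ := by
  induction f using Polynomial.induction_on' with
  | add f g hf hg => simp only [map_add, hf, hg, add_mul]
  | monomial n a =>
    have ha : D (algebraMap (constants D) A a) = 0 := a.2
    rw [aeval_monomial, derivative_monomial, aeval_monomial, Derivation.leibniz, ha,
      Derivation.leibniz_pow]
    simp only [smul_eq_mul, nsmul_eq_mul, map_mul, map_natCast]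
    ring

theorem natCast_mul_eq_zero {n : ℕ} (hn : n ≠ 0) {a : A} (h : (n : A) * a = 0) : a = 0 := by
  have : (algebraMap ℝ A (n : ℝ)⁻¹) * ((n : A) * a) = a := by
    rw [← mul_assoc, ← map_natCast (algebraMap ℝ A) n, ← map_mul, inv_mul_cancel₀
      (by exact_mod_cast hn), map_one, one_mul]
  rw [← this, h, mul_zero]

open Polynomial in
/-- An element with invertible derivative is transcendental over the constants. -/
theorem aeval_constants_injective {δ : A} (hδ : IsUnit (D δ)) (f : (constants D)[X])
    (hf : aeval δ f = 0) : f = 0 := by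
  induction hn : f.natDegree using Nat.strong_induction_on generalizing f with
  | _ n ih =>
  -- D(f(δ)) = f'(δ) Dδ with Dδ invertible, so a relation yields one of smaller degree.
  have h0 : aeval δ (derivative f) = 0 := by
    have := derivation_aeval_constants δ f
    rw [hf, map_zero] at this
    exact (hδ.mul_left_eq_zero.1 this.symm)
  have hconst : derivative f = 0 := by
    rcases Nat.eq_zero_or_pos n with rfl | hpos
    · rw [eq_C_of_natDegree_eq_zero hn, derivative_C]
    · exact ih _ (hn ▸ natDegree_derivative_lt (by omega)) _ h0 rfl
  have hc : ∀ n, f.coeff (n + 1) = 0 := fun n => by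
    have := congrArg (fun g => (g.coeff n : A)) hconst
    simp only [coeff_derivative, coeff_zero, ZeroMemClass.coe_zero] at this
    refine Subtype.ext (natCast_mul_eq_zero (n := n + 1) (by omega) ?_)
    push_cast at this ⊢
    rw [mul_comm]
    exact this
  have hC : f = C (f.coeff 0) := by
    ext n
    rcases n with _ | n
    · simp
    · rw [hc, coeff_C_succ]
  rw [hC, aeval_C] at hf
  rw [hC, show f.coeff 0 = 0 from Subtype.ext hf, C_0]

open Polynomial in
/-- `F` is a polynomial in `δ` over the constants of `D`, with constant term `c`. -/
def Lead (D : Derivation ℝ A A) (δ F c : A) : Prop :=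
  ∃ f : (constants D)[X], aeval δ f = F ∧ (f.coeff 0 : A) = c

namespace Lead

variable {δ F G c e : A}

theorem of_constant (h : D F = 0) : Lead D δ F F :=
  ⟨Polynomial.C ⟨F, h⟩, by rw [Polynomial.aeval_C]; rfl, by rw [Polynomial.coeff_C_zero]⟩

theorem self : Lead D δ δ 0 := ⟨Polynomial.X, by simp, by simp⟩

theorem add (h : Lead D δ F c) (h' : Lead D δ G e) : Lead D δ (F + G) (c + e) := by
  obtain ⟨f, rfl, rfl⟩ := h
  obtain ⟨g, rfl, rfl⟩ := h'
  exact ⟨f + g, by simp, by simp⟩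

theorem mul (h : Lead D δ F c) (h' : Lead D δ G e) : Lead D δ (F * G) (c * e) := by
  obtain ⟨f, rfl, rfl⟩ := h
  obtain ⟨g, rfl, rfl⟩ := h'
  exact ⟨f * g, by simp, by simp [Polynomial.mul_coeff_zero]⟩

theorem neg (h : Lead D δ F c) : Lead D δ (-F) (-c) := by
  obtain ⟨f, rfl, rfl⟩ := h
  exact ⟨-f, by simp, by simp⟩

theorem sub (h : Lead D δ F c) (h' : Lead D δ G e) : Lead D δ (F - G) (c - e) := by
  rw [sub_eq_add_neg, sub_eq_add_neg]; exact h.add h'.neg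

theorem real (z : ℝ) : Lead D δ (algebraMap ℝ A z) (algebraMap ℝ A z) :=
  of_constant (D.map_algebraMap z)

theorem pow (h : Lead D δ F c) (n : ℕ) : Lead D δ (F ^ n) (c ^ n) := by
  obtain ⟨f, rfl, rfl⟩ := h
  exact ⟨f ^ n, by simp, by simp [Polynomial.coeff_zero_eq_eval_zero]⟩

theorem sum {ι : Type} {s : Finset ι} {F c : ι → A} (h : ∀ i ∈ s, Lead D δ (F i) (c i)) :
    Lead D δ (∑ i ∈ s, F i) (∑ i ∈ s, c i) := by
  classical
  induction s using Finset.induction_on with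
  | empty => simpa using of_constant (map_zero D)
  | insert a s ha ih =>
    rw [Finset.sum_insert ha, Finset.sum_insert ha]
    exact (h a (Finset.mem_insert_self _ _)).add
      (ih fun i hi => h i (Finset.mem_insert_of_mem hi))

/-- Transcendence makes the constant term an invariant of the element. With δ = β - α, comparing
constant terms replaces comparing leading terms of poles at α = β. -/
theorem unique (hδ : IsUnit (D δ)) (h : Lead D δ F c) (h' : Lead D δ F e) : c = e := by
  obtain ⟨f, hf, rfl⟩ := h
  obtain ⟨g, hg, rfl⟩ := h'
  have := aeval_constants_injective hδ (f - g) (by rw [map_sub, hf, hg, sub_self])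
  rw [sub_eq_zero.1 this]

end Lead

end

namespace Roots

variable (r : Roots ε) (p : ℤ)

/-! ### Commutators in the adapted frame -/

/-- Interchanging the roots exchanges the two families of adapted coordinates, so each statement
about ∂/∂(dᵏβ) yields one about ∂/∂(d'ᵏα). -/
theorem newDer_swap (k : ℕ) : r.swap.newDer p (v k) = r.newDer p (u (k + 1)) := by
  refine r.eq_of_newCoord p (r.swap.newDer_isRegular p _) (r.newDer_isRegular p _) fun c => ?_
  rw [newDer_newCoord]
  cases c with
  | x => exact (r.swap.newDer_newCoord p (v k) x).trans (by simp)
  | y => exact (r.swap.newDer_newCoord p (v k) y).trans (by simp)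
  | u j => cases j with
    | zero => exact (r.swap.newDer_newCoord p (v k) (u 0)).trans (by simp)
    | succ j => exact (r.swap.newDer_newCoord p (v k) (v j)).trans (by simp)
  | v j =>
    have h := r.swap.newDer_newCoord p (v k) (u (j + 1))
    change r.swap.newDer p (v k) (r.swap.swap.B p j) = _ at h
    rw [swap_swap] at h
    exact h.trans (by simp)
  | q n => exact (r.swap.newDer_newCoord p (v k) (q n)).trans (by simp)

theorem newDer_A (c : Coord) (k : ℕ) :
    r.newDer p c (r.swap.B p k) = if c = u (k + 1) then 1 else 0 :=
  r.newDer_newCoord p c (u (k + 1))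

theorem newDer_B (c : Coord) (k : ℕ) : r.newDer p c (r.B p k) = if c = v k then 1 else 0 :=
  r.newDer_newCoord p c (v k)

theorem newDer_α (c : Coord) : r.newDer p c r.α = if c = u 1 then 1 else 0 :=
  r.newDer_newCoord p c (u 1)

theorem newDer_β (c : Coord) : r.newDer p c r.β = if c = v 0 then 1 else 0 :=
  r.newDer_newCoord p c (v 0)

theorem newDer_Q {c : Coord} (hy : c ≠ y) (hq : ∀ n, c ≠ q n) (n : ℕ) :
    r.newDer p c (inc ε (Q ε p n)) = 0 := by
  rcases n with _ | _ | n
  · simp [Q]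
  · have : inc ε (Q ε p 1) = algebraMap ℝ (Ext ε) (-((p : ℝ) - 1)) * r.newCoord p y := by
      rw [Q, Algebra.smul_def, map_mul]
      rfl
    rw [this, Derivation.leibniz, newDer_newCoord, Derivation.map_algebraMap]
    simp [hy]
  · exact (r.newDer_newCoord p c (q n)).trans (if_neg (hq n))

theorem newDer_d_Q {c : Coord} (hy : c ≠ y) (hq : ∀ n, c ≠ q n) (hβ : c ≠ v 0) (n : ℕ) :
    r.newDer p c (r.d p (inc ε (Q ε p n))) = 0 := by
  induction n with
  | zero => rw [d_Q_zero, map_zero]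
  | succ n ih =>
    rw [d_Q_succ, Derivation.leibniz, map_sub, Derivation.leibniz, Derivation.map_algebraMap, ih,
      newDer_Q _ _ hy hq, newDer_β, if_neg hβ]
    simp

theorem newDer_betaAlg {c : Coord} (hα : c ≠ u 1) (hB : ∀ k, c ≠ v k) {F : Ext ε}
    (hF : F ∈ r.betaAlg p) : r.newDer p c F = 0 := by
  have h : r.betaAlg p ≤ constants (r.newDer p c) := by
    refine Algebra.adjoin_le ?_
    have h1 : r.newDer p c r.α = 0 := by rw [newDer_α, if_neg hα]
    have h2 : r.newDer p c r.β = 0 := by rw [newDer_β, if_neg (hB 0)]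
    rintro F ((rfl | rfl | rfl | rfl) | ⟨n, rfl⟩)
    · exact h1
    · exact (r.derivation_a _).trans (by rw [h1, mul_zero])
    · exact (r.derivation_b _).trans (by rw [h2, mul_zero])
    · exact (r.derivation_w _).trans (by rw [h1, h2, sub_zero, mul_zero])
    · exact (r.newDer_B p c n).trans (if_neg (hB n))
  exact h hF

theorem d_chart_isRegular : (r.chart p).IsRegular (r.d p) := r.chart_isRegular p (r.d_isRegular p)

theorem d_swap_chart_isRegular : (r.chart p).IsRegular (r.swap.d p) :=
  r.chart_isRegular p (r.swap.d_isRegular p)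

/-- `[Z_{k+1}, d] = Z_k`. -/
theorem newDer_v_d (k : ℕ) (F : Ext ε) : r.newDer p (v (k + 1)) (r.d p F) =
    r.d p (r.newDer p (v (k + 1)) F) + r.newDer p (v k) F := by
  have : ⁅r.newDer p (v (k + 1)), r.d p⁆ = r.newDer p (v k) := by
    refine (((r.chart p).isRegular_der _).lie (r.d_chart_isRegular p)).eq_of_coord
      ((r.chart p).isRegular_der _) fun c => ?_
    change r.newDer p (v (k + 1)) (r.d p (r.newCoord p c)) -
      r.d p (r.newDer p (v (k + 1)) (r.newCoord p c)) = r.newDer p (v k) (r.newCoord p c)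
    have h0 : r.d p (r.newDer p (v (k + 1)) (r.newCoord p c)) = 0 := by
      rw [newDer_newCoord]; split_ifs <;> simp
    rw [h0, sub_zero, newDer_newCoord]
    have hα : r.newDer p (v (k + 1)) r.α = 0 := by rw [newDer_α]; simp
    have hβ : r.newDer p (v (k + 1)) r.β = 0 := by rw [newDer_β]; simp
    cases c with
    | x => rw [newCoord, d_x]; simp
    | y => rw [newCoord, d_y, hβ]; simp
    | u j => cases j with
      | zero =>
        have := r.newDer_newCoord p (v (k + 1)) (u 0)
        rw [newCoord] at this ⊢
        rw [d_u, map_sub, this, derivation_b, hβ]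
        simp
      | succ j =>
        have h := r.swap.d_swap_B_mem p j
        rw [swap_swap] at h
        have := r.swap.newDer_betaAlg p (c := u (k + 2)) (by simp) (by simp) h
        have h2 := r.swap.newDer_swap p (k + 1)
        rw [swap_swap] at h2
        rw [newCoord, h2, this]
        simp
    | v j => rw [newCoord, ← B_succ, newDer_B]; simp
    | q n => exact (r.newDer_d_Q p (by simp) (by simp) (by simp) (n + 2)).trans (by simp)
  rw [← this, Derivation.commutator_apply, add_sub_cancel]

/-- `[Y_{k+1}, d'] = Y_k`. -/
theorem newDer_u_d_swap (k : ℕ) (F : Ext ε) : r.newDer p (u (k + 2)) (r.swap.d p F) =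
    r.swap.d p (r.newDer p (u (k + 2)) F) + r.newDer p (u (k + 1)) F := by
  have := r.swap.newDer_v_d p k F
  rwa [newDer_swap, newDer_swap] at this

theorem newDer_v_d_swap_B_of_lt {j n : ℕ} (h : j < n) :
    r.newDer p (v n) (r.swap.d p (r.B p j)) = 0 := by
  have hα : ∀ n, r.newDer p (v n) r.α = 0 := fun n => by rw [newDer_α]; simp
  have hβ : ∀ n, r.newDer p (v (n + 1)) r.β = 0 := fun n => by rw [newDer_β]; simp
  have hw : ∀ n, r.newDer p (v (n + 1)) r.w = 0 := fun n => by
    rw [derivation_w, hα, hβ, sub_zero, mul_zero]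
  induction j generalizing n with
  | zero =>
    obtain ⟨m, rfl⟩ : ∃ m, n = m + 1 := ⟨n - 1, by omega⟩
    change r.newDer p _ (r.swap.d p r.β) = 0
    rw [d_swap_β]
    simp [Derivation.leibniz, hα, hβ, hw]
  | succ j ih =>
    obtain ⟨m, rfl⟩ : ∃ m, n = m + 1 := ⟨n - 1, by omega⟩
    rw [d_swap_B_succ, map_add, newDer_v_d, ih (by omega), ih (by omega)]
    simp [Derivation.leibniz, Derivation.leibniz_pow, hα, hβ, hw, ih (n := m + 1) (by omega), derivation_two,
      newDer_B, show m ≠ j by omega]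

/-- The initial value is ∂(-αβw)/∂β, and each of the n passages of d' through d contributes -2αβw².
-/
theorem newDer_v_d_swap_B (n : ℕ) : r.newDer p (v n) (r.swap.d p (r.B p n)) =
    (1 - 2 * n) * r.α * r.β * r.w ^ 2 - r.α * r.w := by
  have hα : ∀ n, r.newDer p (v n) r.α = 0 := fun n => by rw [newDer_α]; simp
  have hβ : ∀ n, r.newDer p (v n) r.β = if n = 0 then 1 else 0 := fun n => by
    rw [newDer_β]; simp
  induction n with
  | zero =>
    change r.newDer p _ (r.swap.d p r.β) = _
    rw [d_swap_β]
    simp [Derivation.leibniz, hα, hβ, derivation_w]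
    ring
  | succ n ih =>
    rw [d_swap_B_succ, map_add, newDer_v_d, ih, r.newDer_v_d_swap_B_of_lt p (by omega)]
    simp [Derivation.leibniz, Derivation.leibniz_pow, hα, hβ, derivation_w, derivation_two,
      r.newDer_v_d_swap_B_of_lt p (show n < n + 1 by omega), newDer_B]
    ring

/-- `[Z_n, d'] F = σ_n Z_n F` for functions `F` of order at most `n`. -/
theorem newDer_v_d_swap (n : ℕ) {F : Ext ε} (hF : ∀ k, n < k → r.newDer p (v k) F = 0) :
    r.newDer p (v n) (r.swap.d p F) = r.swap.d p (r.newDer p (v n) F) +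
      r.newDer p (v n) (r.swap.d p (r.B p n)) * r.newDer p (v n) F := by
  have key := (r.chart p).der_apply_comm (r.d_swap_chart_isRegular p) (v n)
    (Finset.subset_insert (v n) ((r.chart p).supp F))
  rw [Finset.sum_eq_single_of_mem (v n) (Finset.mem_insert_self _ _)] at key
  · exact key
  intro c _ hc
  change r.newDer p (v n) (r.swap.d p (r.newCoord p c)) * r.newDer p c F = 0
  have hα : r.newDer p (v n) r.α = 0 := by rw [newDer_α]; simp
  cases c with
  | x =>
    rw [newCoord, d_x]; simp
  | y =>
    rw [newCoord, d_y]
    change r.newDer p (v n) r.α * _ = 0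
    rw [hα, zero_mul]
  | u j => cases j with
    | zero =>
      have := r.newDer_newCoord p (v n) (u 0)
      rw [newCoord] at this ⊢
      rw [d_u, map_sub, this]
      change (r.newDer p (v n) r.a - _) * _ = 0
      rw [derivation_a, hα]
      simp
    | succ j => rw [newCoord, ← B_succ, newDer_A]; simp
  | v j =>
    rcases lt_or_gt_of_ne (show j ≠ n by rintro rfl; exact hc rfl) with h | h
    · rw [newCoord, r.newDer_v_d_swap_B_of_lt p h, zero_mul]
    · rw [hF j h, mul_zero]
  | q m =>
    have := r.swap.newDer_d_Q p (c := u (n + 1)) (by simp) (by simp) (by simp) (m + 2)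
    have h2 := r.swap.newDer_swap p n
    rw [swap_swap] at h2
    rw [h2]
    exact mul_eq_zero_of_left this _

end Roots

end UHEReduction

namespace UHEReduction

variable {ε : ℤˣ}

open Coord (x y u v q)

namespace Roots

variable (r : Roots ε) (p : ℤ)

/-! ### Characteristic equations without solutions -/

/-- Expansion in `β - α` over the functions independent of `α`. -/
abbrev HasLead (F c : Ext ε) : Prop := Lead (r.newDer p (u 1)) (r.β - r.α) F c

theorem isUnit_newDer_diff : IsUnit (r.newDer p (u 1) (r.β - r.α)) := by
  rw [map_sub, newDer_α, newDer_β]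
  simp

theorem hasLead_β : r.HasLead p r.β r.β := Lead.of_constant (by rw [newDer_β]; simp)

theorem hasLead_α : r.HasLead p r.α r.β := by
  have := (r.hasLead_β p).sub Lead.self
  rwa [sub_sub_cancel, sub_zero] at this

theorem hasLead_B (n : ℕ) : r.HasLead p (r.B p n) (r.B p n) :=
  Lead.of_constant (by rw [newDer_B]; simp)

/-- Polynomials in `α`, `β` and the derivatives of `β` along `d`. -/
def polyAlg : Subalgebra ℝ (Ext ε) := Algebra.adjoin ℝ ({r.α} ∪ Set.range (r.B p))

theorem exists_hasLead {F : Ext ε} (hF : F ∈ r.polyAlg p) : ∃ c, r.HasLead p F c := by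
  induction hF using Algebra.adjoin_induction with
  | mem F hF =>
    rcases hF with rfl | ⟨n, rfl⟩
    · exact ⟨_, r.hasLead_α p⟩
    · exact ⟨_, r.hasLead_B p n⟩
  | algebraMap z => exact ⟨_, Lead.real z⟩
  | add F G _ _ hF hG =>
    obtain ⟨c, hc⟩ := hF
    obtain ⟨e, he⟩ := hG
    exact ⟨_, hc.add he⟩
  | mul F G _ _ hF hG =>
    obtain ⟨c, hc⟩ := hF
    obtain ⟨e, he⟩ := hG
    exact ⟨_, hc.mul he⟩

theorem α_mem_polyAlg : r.α ∈ r.polyAlg p := Algebra.subset_adjoin (Or.inl rfl)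

theorem B_mem_polyAlg (n : ℕ) : r.B p n ∈ r.polyAlg p := Algebra.subset_adjoin (Or.inr ⟨n, rfl⟩)

theorem β_mem_polyAlg : r.β ∈ r.polyAlg p := r.B_mem_polyAlg p 0

theorem diff_mul_d_mem {F : Ext ε} (hF : F ∈ r.polyAlg p) :
    (r.β - r.α) * r.d p F ∈ r.polyAlg p := by
  have hδ := sub_mem (r.β_mem_polyAlg p) (r.α_mem_polyAlg p)
  refine adjoin_derivation_mem (D := (r.β - r.α) • r.d p) (fun F hF => ?_) hF
  change (r.β - r.α) * r.d p F ∈ r.polyAlg p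
  rcases hF with rfl | ⟨n, rfl⟩
  · have : (r.β - r.α) * r.d p r.α = r.α * r.β := by
      rw [d_α]; linear_combination r.α * r.β * r.w_mul
    rw [this]
    exact mul_mem (r.α_mem_polyAlg p) (r.β_mem_polyAlg p)
  · rw [← B_succ]
    exact mul_mem hδ (r.B_mem_polyAlg p _)

/-- With δ = β - α, the function d'(dˡβ) has a pole of exact order 2l + 1 at δ = 0. In the step to l
+ 1, differentiating δ^{-(2l+1)} along d contributes 2l + 1 times αβ/δ², because dδ contains -αβ/δ,
and the commutator [d, d'] contributes 2αβ/δ². The leading number is thus multiplied by 2l + 3. -/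
theorem hasLead_d_swap_B (l : ℕ) :
    (r.β - r.α) ^ (2 * l + 1) * r.swap.d p (r.B p l) ∈ r.polyAlg p ∧ ∃ z : ℝ, z ≠ 0 ∧
    r.HasLead p ((r.β - r.α) ^ (2 * l + 1) * r.swap.d p (r.B p l))
      (algebraMap ℝ _ z * r.β ^ (2 * l + 2)) := by
  have hδ := sub_mem (r.β_mem_polyAlg p) (r.α_mem_polyAlg p)
  have hαβ := mul_mem (r.α_mem_polyAlg p) (r.β_mem_polyAlg p)
  induction l with
  | zero =>
    have : (r.β - r.α) ^ (2 * 0 + 1) * r.swap.d p (r.B p 0) = -(r.α * r.β) := by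
      change _ * r.swap.d p r.β = _
      rw [d_swap_β]; linear_combination -r.α * r.β * r.w_mul
    rw [this]
    refine ⟨neg_mem hαβ, -1, by norm_num, ?_⟩
    have := ((r.hasLead_α p).mul (r.hasLead_β p)).neg
    rwa [show -(r.β * r.β) = algebraMap ℝ _ (-1) * r.β ^ (2 * 0 + 2) by simp; ring] at this
  | succ l ih =>
    obtain ⟨h1, z, hz, h2⟩ := ih
    set Ψ := (r.β - r.α) ^ (2 * l + 1) * r.swap.d p (r.B p l) with hΨ
    have key : (r.β - r.α) ^ (2 * (l + 1) + 1) * r.swap.d p (r.B p (l + 1)) =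
        (r.β - r.α) * ((r.β - r.α) * r.d p Ψ) -
        algebraMap ℝ _ (2 * l + 1) * ((r.β - r.α) * r.B p 1 - r.α * r.β) * Ψ +
        algebraMap ℝ _ 2 * (r.α * r.β) * Ψ -
        (r.β - r.α) * (algebraMap ℝ _ 2 * (r.α * r.β) * (r.β - r.α) ^ (2 * l) * r.B p (l + 1)) := by
      have hd : (r.β - r.α) * r.d p (r.β - r.α) = (r.β - r.α) * r.B p 1 - r.α * r.β := by
        rw [map_sub, d_α, show r.d p r.β = r.B p 1 from rfl]
        linear_combination -r.α * r.β * r.w_mul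
      rw [← hd, d_swap_B_succ, hΨ, Derivation.leibniz, Derivation.leibniz_pow]
      simp only [smul_eq_mul, nsmul_eq_mul, map_add, map_mul, map_ofNat, map_natCast, map_one,
        add_tsub_cancel_right]
      push_cast
      have hw2 : r.w ^ 2 * (r.β - r.α) ^ 2 = 1 := by
        rw [← mul_pow, r.w_mul, one_pow]
      linear_combination 2 * r.α * r.β * (r.swap.d p (r.B p l) - r.B p (l + 1)) *
        (r.β - r.α) ^ (2 * l + 1) * hw2
    rw [key]
    have h3 := r.diff_mul_d_mem p h1
    obtain ⟨c, hc⟩ := r.exists_hasLead p h3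
    have hr := fun z => Subalgebra.algebraMap_mem (r.polyAlg p) z
    refine ⟨sub_mem (add_mem (sub_mem (mul_mem hδ h3) (mul_mem (mul_mem (hr _)
      (sub_mem (mul_mem hδ (r.B_mem_polyAlg p 1)) hαβ)) h1)) (mul_mem (mul_mem (hr _) hαβ) h1))
      (mul_mem hδ (mul_mem (mul_mem (mul_mem (hr _) hαβ) (pow_mem hδ _)) (r.B_mem_polyAlg p _))),
      (2 * l + 3) * z, mul_ne_zero (by positivity) hz, ?_⟩
    have e1 := (Lead.self).mul hc
    have e2 := ((Lead.real (D := r.newDer p (u 1)) (δ := r.β - r.α) (2 * l + 1)).mul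
      ((Lead.self.mul (r.hasLead_B p 1)).sub ((r.hasLead_α p).mul (r.hasLead_β p)))).mul h2
    have e3 := ((Lead.real (D := r.newDer p (u 1)) (δ := r.β - r.α) 2).mul
      ((r.hasLead_α p).mul (r.hasLead_β p))).mul h2
    have e4 := Lead.self.mul ((((Lead.real (D := r.newDer p (u 1)) (δ := r.β - r.α) 2).mul
      ((r.hasLead_α p).mul (r.hasLead_β p))).mul (Lead.self.pow (2 * l))).mul
        (r.hasLead_B p (l + 1)))
    convert ((e1.sub e2).add e3).sub e4 using 1
    simp only [map_mul, map_add, map_ofNat, map_natCast, map_one]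
    ring

/-- The commutator of ∂/∂(d'^{k+1}α) with d' is ∂/∂(d'ᵏα). Applied to d'g = μg, it passes
independence of a higher derivative of α down to the next lower one. -/
theorem newDer_u_eq_zero {g μ : Ext ε} (hg : r.swap.d p g = μ * g)
    (hμ : ∀ k, r.newDer p (u (k + 2)) μ = 0) (k : ℕ) : r.newDer p (u (k + 1)) g = 0 := by
  obtain ⟨N, hN, hkN⟩ : ∃ N, r.newDer p (u (N + 1)) g = 0 ∧ k ≤ N := by
    obtain ⟨b, hb⟩ := Finset.exists_nat_subset_range
      (((r.chart p).supp g).image fun | u j => j | _ => 0)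
    refine ⟨max b k, (r.chart p).der_eq_zero fun h => ?_, le_max_right _ _⟩
    have := hb (Finset.mem_image_of_mem _ h)
    simp at this
    omega
  induction hkN using Nat.decreasingInduction with
  | self => exact hN
  | of_succ k _ ih =>
    have h := r.newDer_u_d_swap p k g
    rw [hg, Derivation.leibniz, hμ, ih] at h
    simpa using h.symm

theorem exists_hasLead_d_swap_Q (n : ℕ) :
    ∃ c, r.HasLead p (r.swap.d p (inc ε (Q ε p n))) c := by
  induction n with
  | zero => rw [d_Q_zero]; exact ⟨0, Lead.of_constant (map_zero _)⟩
  | succ n ih =>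
    obtain ⟨c, hc⟩ := ih
    rw [d_Q_succ]
    exact ⟨_, (r.hasLead_α p).mul (hc.sub ((Lead.real _).mul
      (Lead.of_constant (r.newDer_Q p (by simp) (by simp) n))))⟩

/-- The equation `d' g = μ g` has only the trivial solution if the leading coefficient of `μ` at
`α = β` does not vanish. -/
theorem eq_zero_of_d_swap_eq {g μ : Ext ε} (hg : r.swap.d p g = μ * g)
    (hμ : ∀ k, r.newDer p (u (k + 2)) μ = 0) {z : ℝ} (hz : z ≠ 0)
    (hlead : r.HasLead p ((r.β - r.α) ^ 2 * μ) (algebraMap ℝ _ z * r.β ^ 2)) : g = 0 := by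
  have hY := r.newDer_u_eq_zero p hg hμ
  have hD : ∀ c, r.newDer p (u 1) (r.newDer p c g) = 0 := fun c => by
    rw [show r.newDer p = (r.chart p).der from rfl, (r.chart p).der_comm]
    change r.newDer p c (r.newDer p (u 1) g) = 0
    rw [hY 0, map_zero]
  have hunit : ∀ (z : ℝ), z ≠ 0 → ∀ n F, r.β * (algebraMap ℝ _ z * r.β ^ n) * F = 0 → F = 0 := by
    intro z hz n F h
    have h1 : IsUnit r.β := IsUnit.of_mul_eq_one _ r.β_mul
    have h2 : IsUnit (algebraMap ℝ (Ext ε) z) := (IsUnit.mk0 z hz).map _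
    exact (h1.mul (h2.mul (h1.pow n))).mul_right_eq_zero.1 h
  -- If g contains derivatives of β only up to d^Lβ, the pole of order 2L + 1 in d'g comes from that
  -- coordinate alone. The factor α clears the denominator in d'u = a - u and becomes β at α = β.
  have main : ∀ L, (∀ l, L < l → r.newDer p (v l) g = 0) → ∃ z' : ℝ, z' ≠ 0 ∧
      r.HasLead p (r.α * (r.β - r.α) ^ (2 * L + 1) * r.swap.d p g)
        (r.β * (algebraMap ℝ _ z' * r.β ^ (2 * L + 2)) * r.newDer p (v L) g) := by
    intro L hL
    obtain ⟨-, z', hz', hz2⟩ := r.hasLead_d_swap_B p L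
    refine ⟨z', hz', ?_⟩
    rw [(r.d_swap_chart_isRegular p).apply_of_subset
      (Finset.subset_insert (v L) ((r.chart p).supp g)), Finset.mul_sum]
    set s := insert (v L) ((r.chart p).supp g)
    have hs : r.β * (algebraMap ℝ _ z' * r.β ^ (2 * L + 2)) * r.newDer p (v L) g =
        ∑ c ∈ s, if c = v L then
          r.β * (algebraMap ℝ _ z' * r.β ^ (2 * L + 2)) * r.newDer p (v L) g else 0 := by
      rw [Finset.sum_ite_eq' s (v L), if_pos (Finset.mem_insert_self _ _)]
    rw [hs]
    refine Lead.sum fun c _ => ?_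
    have hg' : r.HasLead p (r.newDer p c g) (r.newDer p c g) := Lead.of_constant (hD c)
    have hfree : ∀ e, c ≠ v L → r.HasLead p (r.α * r.swap.d p (r.newCoord p c)) e →
        r.HasLead p (r.α * (r.β - r.α) ^ (2 * L + 1) *
          (r.swap.d p (r.newCoord p c) * r.newDer p c g)) (if c = v L then
          r.β * (algebraMap ℝ _ z' * r.β ^ (2 * L + 2)) * r.newDer p (v L) g else 0) := by
      intro e hc he
      rw [if_neg hc]
      have := ((Lead.self.mul (Lead.self.pow (2 * L))).mul he).mul hg'
      rw [zero_mul, zero_mul, zero_mul] at this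
      convert this using 1
      ring
    change r.HasLead p (r.α * (r.β - r.α) ^ (2 * L + 1) *
          (r.swap.d p (r.newCoord p c) * r.newDer p c g)) _
    cases c with
    | x =>
      refine hfree r.β (by simp) ?_
      rw [newCoord, d_x, mul_one]
      exact r.hasLead_α p
    | y =>
      refine hfree (r.β * r.β) (by simp) ?_
      rw [newCoord, d_y]
      exact (r.hasLead_α p).mul (r.hasLead_α p)
    | u j => cases j with
      | zero =>
        refine hfree (1 - r.β * r.newCoord p (u 0)) (by simp) ?_
        have : r.α * r.swap.d p (r.newCoord p (u 0)) = 1 - r.α * r.newCoord p (u 0) := by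
          rw [newCoord, d_u]
          change r.α * (r.a - _) = _
          linear_combination r.α_mul
        rw [this]
        refine (Lead.of_constant (by simp)).sub ((r.hasLead_α p).mul (Lead.of_constant ?_))
        rw [newDer_newCoord]; simp
      | succ j =>
        rw [hY j, mul_zero, mul_zero, if_neg (by simp)]
        exact Lead.of_constant (map_zero _)
    | v l =>
      rcases lt_trichotomy l L with h | rfl | h
      · have hne : v l ≠ v L := by simp; omega
        rw [if_neg hne]
        obtain ⟨-, z'', -, hl⟩ := r.hasLead_d_swap_B p l
        have := ((((r.hasLead_α p).mul hl).mul hg').mul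
          (Lead.self.pow (2 * (L - l) - 1))).mul Lead.self
        rw [mul_zero] at this
        convert this using 1
        rw [newCoord, show 2 * L + 1 = (2 * l + 1) + (2 * (L - l) - 1) + 1 by omega, pow_succ,
          pow_add]
        ring
      · rw [if_pos rfl]
        have := ((r.hasLead_α p).mul hz2).mul hg'
        convert this using 1
        rw [newCoord]
        ring
      · have hne : v l ≠ v L := by simp; omega
        rw [if_neg hne, hL l h, mul_zero, mul_zero]
        exact Lead.of_constant (map_zero _)
    | q n =>
      obtain ⟨e, he⟩ := r.exists_hasLead_d_swap_Q p (n + 2)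
      exact hfree (r.β * e) (by simp) ((r.hasLead_α p).mul he)
  have hgl : r.HasLead p g g := Lead.of_constant (hY 0)
  -- For L ≥ 1 the order 2L + 1 exceeds the double pole of μg, so g cannot depend on d^Lβ.
  have hZ : ∀ l, 0 < l → r.newDer p (v l) g = 0 := by
    obtain ⟨N, hN⟩ : ∃ N, ∀ l, N < l → r.newDer p (v l) g = 0 := by
      obtain ⟨b, hb⟩ := Finset.exists_nat_subset_range
        (((r.chart p).supp g).image fun | v j => j | _ => 0)
      refine ⟨b, fun l hl => (r.chart p).der_eq_zero fun h => ?_⟩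
      have := hb (Finset.mem_image_of_mem _ h)
      simp at this
      omega
    induction N with
    | zero => exact hN
    | succ L ih =>
      refine ih fun l hl => ?_
      rcases (Nat.succ_le_of_lt hl).eq_or_lt with rfl | h
      · obtain ⟨z', hz', h1⟩ := main (L + 1) hN
        refine hunit z' hz' _ _ (h1.unique (r.isUnit_newDer_diff p) ?_)
        rw [hg]
        have := (((r.hasLead_α p).mul (hlead.mul hgl)).mul (Lead.self.pow (2 * L))).mul Lead.self
        rw [mul_zero] at this
        convert this using 1
        ring
      · exact hN l h
  -- Now d'g has at most a simple pole, so the double pole of μg forces zβ²g = 0.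
  obtain ⟨z', -, h1⟩ := main 0 hZ
  have h2 := Lead.self.mul h1
  rw [zero_mul, hg] at h2
  have h3 := ((r.hasLead_α p).mul hlead).mul hgl
  refine hunit z hz 2 g (Lead.unique (r.isUnit_newDer_diff p) h3 ?_)
  convert h2 using 1
  ring

end Roots

end UHEReduction

namespace UHEReduction

variable {ε : ℤˣ}

open Coord (x y u v q)

/-! ### Chains of functions -/

/-- The recurrence satisfied by the coefficients of a symmetry. -/
structure IsChain (p : ℤ) (P : ℕ → Fun ε) : Prop where
  first : ∀ i, coord ε (v 0) * Dx ε p (P (i + 1)) = coord ε (v 1) * P (i + 1) + Dy ε p (P i)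
  second : ∀ i, Dy ε p (P (i + 1)) + sFun ε * Dx ε p (P (i + 1)) =
    Dx ε p (P i) + algebraMap ℝ _ (1 - i) * P i + sxFun ε * P (i + 1)

theorem derivation_mul_of_eq_zero {A : Type} [CommRing A] [Algebra ℝ A] {D : Derivation ℝ A A}
    {a : A} (h : D a = 0) (F : A) : D (a * F) = a * D F := by
  rw [Derivation.leibniz, h, smul_zero, add_zero, smul_eq_mul]

namespace Roots

variable (r : Roots ε) {p : ℤ}

theorem d_β : r.d p r.β =
    -r.β ^ 2 * (inc ε (sxFun ε) + r.β * inc ε (coord ε (v 1))) - r.β ^ 2 * r.w := by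
  rw [d_apply, extend_β, extend_β, Dy_v_zero, Dy_sFun, Dx_sFun, Dx_v]
  simp only [map_sub, map_mul, map_add, r.hs, r.hv]
  set sx := inc ε (sxFun ε)
  set v1 := inc ε (coord ε (v 1))
  have h1 := r.α_mul
  have h2 := r.β_mul
  have h3 := r.w_mul
  linear_combination (-r.w * r.β ^ 4 * r.b * sx - r.w * r.β ^ 2 * (r.β * r.b) 
    - r.w * r.β ^ 4 * v1) * h1
    + (-r.w * r.β ^ 3 * sx - r.w * r.β ^ 2 - r.w * r.α * r.β ^ 3 * v1) * h2
    - (sx * r.β ^ 2 + v1 * r.β ^ 3) * h3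

/-- In β³·`first` + β²·`second` the derivatives of P_{i+1} combine to d P_{i+1}, because u_y β² + s
β = 1, and those of P_i to d P_i. -/
theorem d_chain {P : ℕ → Fun ε} (h : IsChain p P) (i : ℕ) :
    r.d p (r.β * inc ε (P (i + 1))) = r.β ^ 2 * r.d p (inc ε (P i)) +
      algebraMap ℝ _ (1 - i) * r.β ^ 2 * inc ε (P i) - r.β ^ 2 * r.w * inc ε (P (i + 1)) := by
  have h1 := congrArg (inc ε) (h.first i)
  have h2 := congrArg (inc ε) (h.second i)
  rw [Derivation.leibniz, d_β]
  simp only [d_apply, extend_inc, smul_eq_mul, map_add, map_mul,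
    show inc ε (algebraMap ℝ (Fun ε) (1 - i)) = algebraMap ℝ (Ext ε) (1 - i) from rfl] at h1 h2 ⊢
  have hβ : inc ε (coord ε (v 0)) * r.β ^ 2 + inc ε (sFun ε) * r.β = 1 := by
    rw [r.hs, r.hv]
    linear_combination (1 - r.a * r.β) * r.β_mul
  linear_combination r.β ^ 3 * h1 + r.β ^ 2 * h2 -
    r.β * inc ε (Dx ε p (P (i + 1))) * hβ

theorem d_swap_chain {P : ℕ → Fun ε} (h : IsChain p P) (i : ℕ) :
    r.swap.d p (r.α * inc ε (P (i + 1))) = r.α ^ 2 * r.swap.d p (inc ε (P i)) +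
      algebraMap ℝ _ (1 - i) * r.α ^ 2 * inc ε (P i) + r.α ^ 2 * r.w * inc ε (P (i + 1)) := by
  have := r.swap.d_chain h i
  change r.swap.d p (r.α * inc ε (P (i + 1))) = r.α ^ 2 * r.swap.d p (inc ε (P i)) +
      algebraMap ℝ _ (1 - i) * r.α ^ 2 * inc ε (P i) - r.α ^ 2 * (-r.w) * inc ε (P (i + 1)) at this
  rw [this]
  ring

-- The substitution g = αwf turns the hypothesis into d'g = μg. The coefficient of αβw² in μ, its
-- double pole at α = β, is 3 - c; hence the condition on c.
variable (p) in
theorem eq_zero_of_reduced {f σ : Ext ε} (i : ℕ) {c c' : ℝ} (hc : c ≠ 3)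
    (hσ : σ = algebraMap ℝ _ c * (r.α * r.β * r.w ^ 2) + algebraMap ℝ _ c' * (r.α * r.w))
    (h : r.swap.d p (r.α * f) + σ * (r.α * f) = r.α ^ 2 * (r.swap.d p (r.b * f) + σ * (r.b * f)) +
      algebraMap ℝ _ (1 - i) * r.α ^ 2 * (r.b * f) + r.α ^ 2 * r.w * f) : f = 0 := by
  have hg : r.swap.d p (r.α * r.w * f) =
      (algebraMap ℝ _ (3 - c) * (r.α * r.β * r.w ^ 2) + algebraMap ℝ _ (-c' - i) * (r.α * r.w)) *
        (r.α * r.w * f) := by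
    rw [Derivation.leibniz, Derivation.leibniz, derivation_b, d_swap_β, hσ] at h
    rw [Derivation.leibniz, Derivation.leibniz, derivation_w, d_swap_β]
    simp only [smul_eq_mul, map_sub, map_neg, map_one, map_natCast, map_ofNat] at h ⊢
    have h1 := r.w_mul
    have h2 := r.β_mul
    set D := r.swap.d p f
    set A := r.swap.d p r.α
    have h' : r.β * (A * f + r.α * D + σ * r.α * f) = r.α ^ 2 * (D + f * r.α * r.w + σ * f) +
        (1 - (i : Ext ε)) * r.α ^ 2 * f + r.α ^ 2 * r.β * r.w * f := by
      rw [hσ]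
      linear_combination r.β * h + (r.α ^ 2 * D + r.α ^ 2 * (algebraMap ℝ _ c *
        (r.α * r.β * r.w ^ 2) + algebraMap ℝ _ c' * (r.α * r.w)) * f +
        (1 - (i : Ext ε)) * r.α ^ 2 * f + r.α ^ 3 * f * r.w * (r.β * r.b + 1)) * h2
    rw [hσ] at h'
    linear_combination r.w ^ 2 * h' - (r.α * r.w * D + r.w * A * f + (algebraMap ℝ _ c *
      (r.α * r.β * r.w ^ 2) + algebraMap ℝ _ c' * (r.α * r.w)) * r.α * r.w * f +
      r.α ^ 2 * r.w ^ 2 * f) * h1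
  have h0 : r.α * r.w * f = 0 := by
    refine r.eq_zero_of_d_swap_eq p hg (fun k => ?_) (sub_ne_zero.2 hc.symm) ?_
    · have hα : r.newDer p (u (k + 2)) r.α = 0 := by rw [newDer_α]; simp
      have hβ : r.newDer p (u (k + 2)) r.β = 0 := by rw [newDer_β]; simp
      simp [Derivation.leibniz, Derivation.leibniz_pow, derivation_w, hα, hβ]
    · have := ((Lead.real (3 - c)).mul ((r.hasLead_α p).mul (r.hasLead_β p))).add
        (((Lead.real (-c' - i)).mul (r.hasLead_α p)).mul Lead.self)
      convert this using 1
      · linear_combination (algebraMap ℝ _ (3 - c) * (r.α * r.β) * (r.w * (r.β - r.α) + 1) +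
          algebraMap ℝ _ (-c' - i) * r.α * (r.β - r.α)) * r.w_mul
      · ring
  have uα : IsUnit r.α := IsUnit.of_mul_eq_one _ r.α_mul
  have uw : IsUnit r.w := IsUnit.of_mul_eq_one _ r.w_mul
  exact (uα.mul uw).mul_right_eq_zero.1 h0

theorem isUnit_β : IsUnit r.β := IsUnit.of_mul_eq_one _ r.β_mul

/-- Comparison of the leading derivatives of consecutive members of a chain. -/
theorem newDer_chain {P : ℕ → Fun ε} (h : IsChain p P) {i l : ℕ}
    (h0 : r.newDer p (v (l + 1)) (inc ε (P i)) = 0)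
    (h1 : r.newDer p (v (l + 1)) (inc ε (P (i + 1))) = 0) :
    r.newDer p (v l) (r.β * inc ε (P (i + 1))) = r.β ^ 2 * r.newDer p (v l) (inc ε (P i)) := by
  have key := congrArg (r.newDer p (v (l + 1))) (r.d_chain h i)
  have hα : r.newDer p (v (l + 1)) r.α = 0 := by rw [newDer_α]; simp
  have hβ : r.newDer p (v (l + 1)) r.β = 0 := by rw [newDer_β]; simp
  have hz : r.newDer p (v (l + 1)) (r.β * inc ε (P (i + 1))) = 0 := by
    rw [Derivation.leibniz, h1, hβ, smul_zero, smul_zero, add_zero]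
  rw [newDer_v_d, hz, map_zero, zero_add] at key
  rw [key]
  simp only [map_add, map_sub, Derivation.leibniz, Derivation.leibniz_pow, newDer_v_d, hα, hβ, h0,
    h1, derivation_w, smul_zero, add_zero, mul_zero, sub_zero, zero_add, map_zero,
    Derivation.map_algebraMap, smul_eq_mul]

theorem newDer_v_chain_succ {P : ℕ → Fun ε} (h : IsChain p P) {i l : ℕ}
    (h0 : r.newDer p (v (l + 2)) (inc ε (P i)) = 0)
    (h1 : r.newDer p (v (l + 2)) (inc ε (P (i + 1))) = 0) :
    r.newDer p (v (l + 1)) (inc ε (P (i + 1))) = r.β * r.newDer p (v (l + 1)) (inc ε (P i)) := by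
  have := r.newDer_chain h h0 h1
  rw [Derivation.leibniz, newDer_β, if_neg (by simp), smul_zero, add_zero, smul_eq_mul, pow_two,
    mul_assoc] at this
  exact r.isUnit_β.mul_left_cancel this

theorem exists_order (F : Ext ε) : ∃ N, ∀ l, N < l → r.newDer p (v l) F = 0 := by
  obtain ⟨b, hb⟩ := Finset.exists_nat_subset_range
    (((r.chart p).supp F).image fun | v j => j | _ => 0)
  refine ⟨b, fun l hl => (r.chart p).der_eq_zero fun h => ?_⟩
  have := hb (Finset.mem_image_of_mem _ h)
  simp at this
  omega

/-- Above the order of P_i the leading derivative of P_{i+1} equals β times a vanishing derivative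
of P_i, so every order bound of P₀ holds for the whole chain. -/
theorem exists_order_chain {P : ℕ → Fun ε} (h : IsChain p P) :
    ∃ n, ∀ i l, n < l → r.newDer p (v l) (inc ε (P i)) = 0 := by
  obtain ⟨n, hn⟩ := r.exists_order (p := p) (inc ε (P 0))
  refine ⟨n, fun i => ?_⟩
  induction i with
  | zero => exact hn
  | succ i ih =>
    obtain ⟨N, hN⟩ := r.exists_order (p := p) (inc ε (P (i + 1)))
    induction N with
    | zero => exact fun l hl => hN l (by omega)
    | succ N ihN =>
      rcases Nat.lt_or_ge N n with hlt | hge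
      · exact fun l hl => hN l (by omega)
      · refine ihN fun l hl => ?_
        rcases (Nat.succ_le_of_lt hl).eq_or_lt with rfl | hl
        · rw [r.newDer_v_chain_succ h (ih _ (by omega)) (hN _ (by omega)), ih _ (by omega),
            mul_zero]
        · exact hN l hl

/-- Given a common order bound n + 1, differentiating `d_swap_chain` by d^{n+1}β yields the relation
of `eq_zero_of_reduced` for the leading derivative of P_{i+1}. It vanishes, and the bound descends
to zero. -/
theorem newDer_v_succ_eq_zero {P : ℕ → Fun ε} (h : IsChain p P) (i k : ℕ) :
    r.newDer p (v (k + 1)) (inc ε (P i)) = 0 := by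
  obtain ⟨n, hn⟩ := r.exists_order_chain h
  suffices ∀ i l, 0 < l → r.newDer p (v l) (inc ε (P i)) = 0 from this i (k + 1) (by omega)
  clear i k
  induction n with
  | zero => exact hn
  | succ n ih =>
    refine ih fun i l hl => ?_
    rcases (Nat.succ_le_of_lt hl).eq_or_lt with rfl | hl
    swap
    · exact hn i l hl
    have hrec := fun i => r.newDer_v_chain_succ h (hn i (n + 2) (by omega))
      (hn (i + 1) (n + 2) (by omega))
    have hα : r.newDer p (v (n + 1)) r.α = 0 := by rw [newDer_α]; simp
    have hβ : r.newDer p (v (n + 1)) r.β = 0 := by rw [newDer_β]; simp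
    have hsucc : r.newDer p (v (n + 1)) (inc ε (P (i + 1))) = 0 := by
      -- The numbers are those of `newDer_v_d_swap_B` at n + 1; c is negative, hence not 3.
      refine r.eq_zero_of_reduced p i (c := 1 - 2 * (n + 1 : ℕ)) (c' := -1)
        (σ := r.newDer p (v (n + 1)) (r.swap.d p (r.B p (n + 1)))) ?_ ?_ ?_
      · push_cast
        have : (0 : ℝ) ≤ n := Nat.cast_nonneg n
        intro h
        linarith
      · rw [newDer_v_d_swap_B]
        simp only [map_sub, map_one, map_mul, map_ofNat, map_natCast, map_neg]
        ring
      · have key := congrArg (r.newDer p (v (n + 1))) (r.d_swap_chain h i)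
        have e : r.newDer p (v (n + 1)) (inc ε (P i)) =
            r.b * r.newDer p (v (n + 1)) (inc ε (P (i + 1))) := by
          rw [hrec i]
          linear_combination -r.newDer p (v (n + 1)) (inc ε (P i)) * r.β_mul
        have hαP : ∀ k, n + 1 < k → r.newDer p (v k) (r.α * inc ε (P (i + 1))) = 0 := by
          intro k hk
          rw [Derivation.leibniz, hn _ _ hk, newDer_α]
          simp
        have hα2 : r.newDer p (v (n + 1)) (r.α ^ 2) = 0 := by
          rw [Derivation.leibniz_pow, hα, smul_zero, smul_zero]
        have hc : r.newDer p (v (n + 1)) (algebraMap ℝ _ (1 - (i : ℝ)) * r.α ^ 2) = 0 := by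
          rw [Derivation.leibniz, hα2, Derivation.map_algebraMap, smul_zero, smul_zero, add_zero]
        have hw : r.newDer p (v (n + 1)) (r.α ^ 2 * r.w) = 0 := by
          rw [Derivation.leibniz, hα2, derivation_w, hα, hβ, sub_zero, mul_zero, smul_zero,
            smul_zero, add_zero]
        rw [r.newDer_v_d_swap p (n + 1) hαP, map_add, map_add, derivation_mul_of_eq_zero hα,
          derivation_mul_of_eq_zero hα2, derivation_mul_of_eq_zero hc, derivation_mul_of_eq_zero hw,
          r.newDer_v_d_swap p (n + 1) (hn i), e] at key
        linear_combination key
    have := hrec i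
    rw [hsucc] at this
    exact r.isUnit_β.mul_right_eq_zero.1 this.symm

end Roots

end UHEReduction

/-! ### Second derivatives of chains with respect to a root -/

namespace UHEReduction

variable {ε : ℤˣ}

open Coord (x y u v q)

namespace Roots

variable (r : Roots ε) (p : ℤ)

/-- The derivation `-∂/∂b`, where `b = 1 / β`. -/
def U : Derivation ℝ (Ext ε) (Ext ε) := r.β ^ 2 • r.newDer p (v 0)

theorem U_apply (F : Ext ε) : r.U p F = r.β ^ 2 * r.newDer p (v 0) F := rfl

theorem U_α : r.U p r.α = 0 := by rw [U_apply, newDer_α]; simp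

theorem U_β : r.U p r.β = r.β ^ 2 := by rw [U_apply, newDer_β]; simp

theorem U_b : r.U p r.b = -1 := by
  rw [derivation_b, U_β]
  linear_combination -(r.β * r.b + 1) * r.β_mul

theorem U_w : r.U p r.w = -r.β ^ 2 * r.w ^ 2 := by
  rw [derivation_w, U_β, U_α]; ring

theorem newDer_v_U {F : Ext ε} {k : ℕ} (hF : r.newDer p (v (k + 1)) F = 0) :
    r.newDer p (v (k + 1)) (r.U p F) = 0 := by
  have hβ : r.newDer p (v (k + 1)) r.β = 0 := by rw [newDer_β]; simp
  have : r.newDer p (v (k + 1)) (r.newDer p (v 0) F) = 0 := by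
    rw [show r.newDer p = (r.chart p).der from rfl, (r.chart p).der_comm]
    change r.newDer p (v 0) (r.newDer p (v (k + 1)) F) = 0
    rw [hF, map_zero]
  rw [U_apply, Derivation.leibniz, this, Derivation.leibniz_pow, hβ]
  simp

theorem U_d_swap {F : Ext ε} (hF : ∀ k, r.newDer p (v (k + 1)) F = 0) :
    r.U p (r.swap.d p F) = r.swap.d p (r.U p F) +
      (2 * (r.α * r.w) + (r.α * r.w) ^ 2) * r.U p F := by
  have hF' : ∀ k, 0 < k → r.newDer p (v k) F = 0 := fun k hk => by
    obtain ⟨m, rfl⟩ : ∃ m, k = m + 1 := ⟨k - 1, by omega⟩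
    exact hF m
  rw [U_apply, U_apply, r.newDer_v_d_swap p 0 hF', newDer_v_d_swap_B, Derivation.leibniz,
    Derivation.leibniz_pow, d_swap_β]
  simp only [smul_eq_mul, nsmul_eq_mul]
  push_cast
  linear_combination r.β ^ 2 * r.newDer p (v 0) F * r.α * r.w * r.w_mul

variable {p}

/-- The comparison of leading terms reads U P_i = P_{i+1} + b·U P_{i+1}; since U b = -1, another U
gives U²P_i = b·U²P_{i+1}. Applying U twice to `d_swap_chain` produces the reduced relation for
U²P_{i+1}, which therefore vanishes: the chain is affine in b. -/
theorem U_sq_chain {P : ℕ → Fun ε} (h : IsChain p P) (i : ℕ) :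
    r.U p (r.U p (inc ε (P i))) = 0 := by
  have hZ := r.newDer_v_succ_eq_zero h
  have hb : ∀ i, r.U p (inc ε (P i)) = inc ε (P (i + 1)) + r.b * r.U p (inc ε (P (i + 1))) := by
    intro i
    have h0 := r.newDer_chain h (l := 0) (hZ i 0) (hZ (i + 1) 0)
    rw [Derivation.leibniz, newDer_β, if_pos rfl] at h0
    simp only [smul_eq_mul] at h0
    rw [U_apply, U_apply]
    linear_combination -h0 - r.β * r.newDer p (v 0) (inc ε (P (i + 1))) * r.β_mul
  have hθ : ∀ i, r.U p (r.U p (inc ε (P i))) = r.b * r.U p (r.U p (inc ε (P (i + 1)))) := by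
    intro i
    rw [hb i, map_add, Derivation.leibniz, U_b]
    simp only [smul_eq_mul]
    ring
  rw [hθ]
  -- Each U passes d' at the cost 2αw + (αw)² = αβw² + αw (`U_d_swap`); two passages give c = c' =
  -- 2.
  refine mul_eq_zero_of_right _ (r.eq_zero_of_reduced p i (c := 2) (c' := 2)
    (σ := 2 * (2 * (r.α * r.w) + (r.α * r.w) ^ 2)) (by norm_num) ?_ ?_)
  · rw [map_ofNat]
    linear_combination -2 * r.α * r.w * r.w_mul
  · have hα := r.U_α p
    have hαm : ∀ F, r.U p (r.α * F) = r.α * r.U p F := derivation_mul_of_eq_zero hα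
    have hα2 : r.U p (r.α ^ 2) = 0 := by
      rw [Derivation.leibniz_pow, hα, smul_zero, smul_zero]
    have hc : r.U p (algebraMap ℝ _ (1 - (i : ℝ)) * r.α ^ 2) = 0 := by
      rw [Derivation.leibniz, hα2, Derivation.map_algebraMap, smul_zero, smul_zero, add_zero]
    have hZα : ∀ k F, r.newDer p (v (k + 1)) F = 0 → r.newDer p (v (k + 1)) (r.α * F) = 0 := by
      intro k F hF
      rw [Derivation.leibniz, hF, newDer_α]
      simp
    have h1 := congrArg (r.U p) (r.d_swap_chain h i)
    rw [r.U_d_swap p fun k => hZα k _ (hZ _ _), map_add, map_add, hαm,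
      derivation_mul_of_eq_zero hα2, derivation_mul_of_eq_zero hc, mul_assoc (r.α ^ 2),
      derivation_mul_of_eq_zero hα2, r.U_d_swap p (hZ i), Derivation.leibniz _ r.w, U_w] at h1
    simp only [smul_eq_mul] at h1
    have h2 := congrArg (r.U p) h1
    have hρ : r.U p (2 * (r.α * r.w) + (r.α * r.w) ^ 2) =
        -2 * r.α * r.β ^ 2 * r.w ^ 2 * (1 + r.α * r.w) := by
      rw [map_add, Derivation.leibniz_pow, Derivation.leibniz, hαm, U_w, derivation_two]
      simp only [smul_eq_mul, nsmul_eq_mul]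
      push_cast
      ring
    have hw2 : r.U p (-r.β ^ 2 * r.w ^ 2) = -2 * r.β ^ 3 * r.w ^ 2 + 2 * r.β ^ 4 * r.w ^ 3 := by
      rw [Derivation.leibniz, Derivation.map_neg, Derivation.leibniz_pow, Derivation.leibniz_pow,
        U_w, U_β]
      simp only [smul_eq_mul, nsmul_eq_mul]
      push_cast
      ring
    rw [map_add, r.U_d_swap p fun k => hZα k _ (r.newDer_v_U p (hZ _ _)), map_add, map_add,
      derivation_mul_of_eq_zero hα2, derivation_mul_of_eq_zero hc, derivation_mul_of_eq_zero hα2,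
      map_add, r.U_d_swap p fun k => r.newDer_v_U p (hZ i k), map_add, Derivation.leibniz _ (2 * _ + _),
      Derivation.leibniz _ (2 * _ + _), hρ, smul_eq_mul, smul_eq_mul, Derivation.leibniz _ r.w,
      smul_eq_mul, smul_eq_mul, Derivation.leibniz _ (inc ε _), hw2, U_w, hαm, hθ i, hb i] at h2
    simp only [smul_eq_mul] at h2
    set X := r.U p (inc ε (P (i + 1)))
    set F := inc ε (P (i + 1))
    linear_combination h2 - 2 * r.α ^ 2 * r.β ^ 2 * r.w ^ 2 * X * (r.α * r.w) * r.β_mul +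
      (2 * r.α ^ 2 * r.β ^ 2 * r.w ^ 2 * X * r.α * r.b +
        2 * r.α ^ 2 * r.β ^ 2 * r.w ^ 2 * (r.α + r.β) * F) * r.w_mul

end Roots

end UHEReduction

/-! ### Chains are affine in u_y and u_x + u -/

namespace UHEReduction

variable {ε : ℤˣ} {p : ℤ}

open Coord (x y u v q)

/-- Functions of `x`, `y`, `u`, `u_x`, `u_y` and the nonlocal variables only. -/
def Low (G : Fun ε) : Prop := ∀ k, pd ε (u (k + 2)) G = 0 ∧ pd ε (v (k + 1)) G = 0

theorem Low.pd {G : Fun ε} (h : Low G) (c : Coord) : Low (pd ε c G) := fun k => by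
  rw [pd_comm, (h k).1, pd_comm, (h k).2, map_zero, and_self]

theorem Low.ordLE {G : Fun ε} (h : Low G) : OrdLE 0 (inc ε G) := by
  intro k hk
  obtain ⟨m, rfl⟩ : ∃ m, k = m + 1 := ⟨k - 1, by omega⟩
  rw [extend_inc, extend_inc, (h m).1, (h m).2, map_zero, and_self]

namespace Roots

variable (r : Roots ε)

theorem newDer_u_succ_eq_zero {P : ℕ → Fun ε} (h : IsChain p P) (i k : ℕ) :
    r.newDer p (u (k + 2)) (inc ε (P i)) = 0 := by
  rw [← newDer_swap]
  exact r.swap.newDer_v_succ_eq_zero h i k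

/-- The chain rule for s = a + b and u_y = -ab, where U is -∂/∂b. -/
theorem U_low {G : Fun ε} (h : Low G) :
    r.U p (inc ε G) = -inc ε (pd ε (u 1) G) + r.a * inc ε (pd ε (v 0) G) := by
  have hα : r.newDer p (v 0) r.α = 0 := by rw [newDer_α]; simp
  have hβ : r.newDer p (v 0) r.β = 1 := by rw [newDer_β]; simp
  have hb : r.newDer p (v 0) r.b = -r.b ^ 2 := by rw [derivation_b, hβ, mul_one]
  have ha : r.newDer p (v 0) r.a = 0 := by rw [derivation_a, hα, mul_zero]
  have hu0 : r.newDer p (v 0) (inc ε (coord ε (u 0))) = 0 :=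
    (r.newDer_newCoord p (v 0) (u 0)).trans (by simp)
  have hu : r.newDer p (v 0) (inc ε (coord ε (u 1))) = -r.b ^ 2 := by
    have := r.hs
    rw [sFun, map_add] at this
    rw [eq_sub_of_add_eq this, map_sub, map_add, ha, hb, hu0]
    ring
  have hv : r.newDer p (v 0) (inc ε (coord ε (v 0))) = r.a * r.b ^ 2 := by
    rw [r.hv, Derivation.map_neg, Derivation.leibniz, ha, hb]
    simp
  have key := (r.newDer_isRegular p (v 0)).apply_of_subset
    (Finset.subset_union_left (s₂ := {u 1, v 0}) (s₁ := (extChart ε).supp (inc ε G)))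
  rw [← Finset.sum_subset (s₁ := {u 1, v 0}) Finset.subset_union_right, Finset.sum_pair (by simp)]
    at key
  · change r.newDer p (v 0) (inc ε G) = r.newDer p (v 0) (inc ε (coord ε (u 1))) *
      extend (UHEReduction.pd ε (u 1)) (inc ε G) + r.newDer p (v 0) (inc ε (coord ε (v 0))) *
      extend (UHEReduction.pd ε (v 0)) (inc ε G) at key
    rw [extend_inc, extend_inc, hu, hv] at key
    rw [U_apply, key]
    linear_combination (r.a * inc ε (UHEReduction.pd ε (v 0) G) -
      inc ε (UHEReduction.pd ε (u 1) G)) * (r.β * r.b + 1) * r.β_mul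
  · intro c _ hc
    simp only [Finset.mem_insert, Finset.mem_singleton, not_or] at hc
    change r.newDer p (v 0) (inc ε (coord ε c)) * extend (UHEReduction.pd ε c) (inc ε G) = 0
    rw [extend_inc]
    cases c with
    | x => exact mul_eq_zero_of_left ((r.newDer_newCoord p (v 0) x).trans (by simp)) _
    | y => exact mul_eq_zero_of_left ((r.newDer_newCoord p (v 0) y).trans (by simp)) _
    | u k =>
      rcases k with _ | _ | k
      · rw [hu0, zero_mul]
      · exact absurd rfl hc.1
      · rw [(h k).1, map_zero, mul_zero]
    | v k =>
      rcases k with _ | k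
      · exact absurd rfl hc.2
      · rw [(h k).2, map_zero, mul_zero]
    | q n => exact mul_eq_zero_of_left ((r.newDer_newCoord p (v 0) (q n)).trans (by simp)) _

end Roots

namespace IsChain

variable {P : ℕ → Fun ε}

/-- A chain depends on no dᵏβ or d'ᵏα with k ≥ 1, while α and β involve only s and u_y, so higher
jet coordinates cannot enter. -/
theorem low (h : IsChain p P) (i : ℕ) : Low (P i) := by
  obtain ⟨r⟩ := exists_roots ε
  have key : ∀ c, (∀ e, e ∈ ({x, y, u 0} ∪ Set.range q : Set Coord) → c ≠ e) →
      extend (pd ε c) r.α = 0 → extend (pd ε c) r.β = 0 → pd ε c (P i) = 0 := by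
    intro c hc hα hβ
    have h0 := (r.chart_isRegular p (extend_isRegular (pd ε c))).apply_eq_zero
      (F := inc ε (P i)) fun e => ?_
    · rw [extend_inc] at h0
      exact inc_injective (h0.trans (map_zero _).symm)
    · change extend (pd ε c) (r.newCoord p e) = 0 ∨ r.newDer p e (inc ε (P i)) = 0
      have hce : ∀ e, e ∈ ({x, y, u 0} ∪ Set.range q : Set Coord) →
          extend (pd ε c) (inc ε (coord ε e)) = 0 := fun e he => by
        rw [extend_inc, pd_coord, if_neg (hc e he), map_zero]
      cases e with
      | x => exact Or.inl (hce x (by simp))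
      | y => exact Or.inl (hce y (by simp))
      | u k =>
        rcases k with _ | _ | k
        · exact Or.inl (hce (u 0) (by simp))
        · exact Or.inl hα
        · exact Or.inr (r.newDer_u_succ_eq_zero h i k)
      | v k =>
        rcases k with _ | k
        · exact Or.inl hβ
        · exact Or.inr (r.newDer_v_succ_eq_zero h i k)
      | q n => exact Or.inl (hce (q n) (by simp))
  intro k
  have hα := r.swap.ordLE_β (k + 1) (by omega)
  have hβ := r.ordLE_β (k + 1) (by omega)
  exact ⟨key _ (by rintro e ((rfl | rfl | rfl) | ⟨n, rfl⟩) <;> simp) hα.1 hβ.1,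
    key _ (by rintro e ((rfl | rfl | rfl) | ⟨n, rfl⟩) <;> simp) hα.2 hβ.2⟩

/-- The derivative of the first recurrence with respect to u₂; only the leading parts of D_x and D_y
contribute. The derivative with respect to v₁ gives `pd_v_zero`. -/
theorem pd_u_one (h : IsChain p P) (i : ℕ) : pd ε (u 1) (P (i + 1)) = pd ε (v 0) (P i) := by
  have h1 := congrArg (fun f => extend (pd ε (u 2)) (inc ε f)) (h.first i)
  simp only [map_add, map_mul, ← extend_inc, Derivation.leibniz,
    (extend_pd_Dx (p := p) (h.low (i + 1)).ordLE le_rfl).1,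
    (extend_pd_Dy (p := p) (h.low i).ordLE le_rfl).1, if_true] at h1
  simp only [extend_inc, pd_coord, (h.low (i + 1) 0).1, smul_eq_mul] at h1
  simp at h1
  rw [← map_mul, ← map_mul] at h1
  have h2 := inc_injective h1
  have h3 := invUy_mul (ε := ε)
  linear_combination invUy ε * h2 - (pd ε (u 1) (P (i + 1)) - pd ε (v 0) (P i)) * h3

theorem pd_v_zero (h : IsChain p P) (i : ℕ) : coord ε (v 0) * pd ε (v 0) (P (i + 1)) =
    P (i + 1) + pd ε (u 1) (P i) - sFun ε * pd ε (v 0) (P i) := by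
  have h1 := congrArg (fun f => extend (pd ε (v 1)) (inc ε f)) (h.first i)
  simp only [map_add, map_mul, ← extend_inc, Derivation.leibniz,
    (extend_pd_Dx (p := p) (h.low (i + 1)).ordLE le_rfl).2,
    (extend_pd_Dy (p := p) (h.low i).ordLE le_rfl).2, if_true] at h1
  simp only [extend_inc, pd_coord, (h.low (i + 1) 0).2, smul_eq_mul] at h1
  simp at h1
  rw [← map_mul, ← map_mul, ← map_sub, ← map_add] at h1
  rw [inc_injective h1]
  ring

/-- In terms of s and u_y, U²P = 0 reads P_ss - 2a P_sv + a² P_vv = 0, and the same holds with b.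
Subtract, divide by a - b, and use a + b = s, ab = -u_y. -/
theorem second_derivatives (h : IsChain p P) (i : ℕ) : pd ε (u 1) (pd ε (u 1) (P i)) +
      coord ε (v 0) * pd ε (v 0) (pd ε (v 0) (P i)) = 0 ∧
    sFun ε * pd ε (v 0) (pd ε (v 0) (P i)) = 2 * pd ε (u 1) (pd ε (v 0) (P i)) := by
  obtain ⟨r⟩ := exists_roots ε
  have key : ∀ r : Roots ε, inc ε (pd ε (u 1) (pd ε (u 1) (P i))) -
      2 * r.a * inc ε (pd ε (u 1) (pd ε (v 0) (P i))) +
      r.a ^ 2 * inc ε (pd ε (v 0) (pd ε (v 0) (P i))) = 0 := by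
    intro r
    have ha : r.U p r.a = 0 := by rw [Roots.derivation_a, Roots.U_α, mul_zero]
    have h1 := r.U_sq_chain h i
    rw [r.U_low (h.low i), map_add, Derivation.map_neg, derivation_mul_of_eq_zero ha,
      r.U_low ((h.low i).pd _), r.U_low ((h.low i).pd _), pd_comm (v 0) (u 1)] at h1
    linear_combination h1
  have h1 := key r
  have h2 := key r.swap
  change _ - 2 * r.b * _ + r.b ^ 2 * _ = 0 at h2
  have hs := r.hs
  have hv := r.hv
  have hw := r.w_mul
  have hα := r.α_mul
  have hβ := r.β_mul
  have e2 : inc ε (sFun ε) * inc ε (pd ε (v 0) (pd ε (v 0) (P i))) =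
      2 * inc ε (pd ε (u 1) (pd ε (v 0) (P i))) := by
    have hu : (r.a - r.b) * (r.w * r.α * r.β) = 1 := by
      linear_combination hw + r.w * r.β * hα - r.w * r.α * hβ
    rw [hs]
    linear_combination (r.w * r.α * r.β) * (h1 - h2) -
      ((r.a + r.b) * inc ε (pd ε (v 0) (pd ε (v 0) (P i))) -
        2 * inc ε (pd ε (u 1) (pd ε (v 0) (P i)))) * hu
  have e1 : inc ε (pd ε (u 1) (pd ε (u 1) (P i))) +
      inc ε (coord ε (v 0)) * inc ε (pd ε (v 0) (pd ε (v 0) (P i))) = 0 := by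
    rw [hs] at e2
    rw [hv]
    linear_combination h1 - r.a * e2
  constructor
  · refine inc_injective ?_
    rw [map_add, map_mul, map_zero, e1]
  · refine inc_injective ?_
    rw [map_mul, map_mul, map_ofNat, e2]

/-- Differentiating `pd_v_zero` in u_y and inserting the previous identities makes s² + 4u_y
annihilate the second u_y-derivative of P_{i+1}. For P_i it then vanishes too, being s/2 times that
of P_{i+1}. -/
theorem pd_v_pd_v (h : IsChain p P) (i : ℕ) : pd ε (v 0) (pd ε (v 0) (P i)) = 0 := by
  have h1 := congrArg (pd ε (v 0)) (h.pd_u_one i)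
  rw [pd_comm] at h1
  have h2 := congrArg (pd ε (v 0)) (h.pd_v_zero i)
  have hs : pd ε (v 0) (sFun ε) = 0 := by simp [sFun, pd_coord]
  simp only [Derivation.leibniz, map_add, map_sub, hs, pd_coord, if_true, smul_eq_mul] at h2
  rw [pd_comm (v 0) (u 1)] at h2
  have h3 := (h.second_derivatives i).2
  have h4 := (h.second_derivatives (i + 1)).2
  have h5 : pd ε (v 0) (pd ε (v 0) (P (i + 1))) = 0 := by
    refine eq_zero_of_disc_mul ?_
    linear_combination 4 * h2 + sFun ε * h4 + 2 * sFun ε * h1 - 2 * h3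
  rw [h5] at h4
  rw [← h1]
  have : (2 : Fun ε) * ((2 : ℝ)⁻¹ • pd ε (u 1) (pd ε (v 0) (P (i + 1)))) = 0 := by
    rw [mul_smul_comm, ← h4, mul_zero, smul_zero]
  rwa [two_mul, ← two_smul ℝ, smul_smul, mul_inv_cancel₀ (two_ne_zero), one_smul] at this

theorem pd_u_pd_v (h : IsChain p P) (i : ℕ) : pd ε (u 1) (pd ε (v 0) (P i)) = 0 := by
  have h3 := (h.second_derivatives i).2
  rw [h.pd_v_pd_v, mul_zero] at h3
  have : (2 : Fun ε) * ((2 : ℝ)⁻¹ • pd ε (u 1) (pd ε (v 0) (P i))) = 0 := by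
    rw [mul_smul_comm, ← h3, smul_zero]
  rwa [two_mul, ← two_smul ℝ, smul_smul, mul_inv_cancel₀ (two_ne_zero), one_smul] at this

theorem pd_u_pd_u (h : IsChain p P) (i : ℕ) : pd ε (u 1) (pd ε (u 1) (P i)) = 0 := by
  have := (h.second_derivatives i).1
  rwa [h.pd_v_pd_v, mul_zero, add_zero] at this

/-- Every chain is affine in `u_y` and `u_x + u`. -/
theorem exists_coefficients (h : IsChain p P) : ∃ c : ℕ → Fun ε,
    (∀ i k, pd ε (u (k + 1)) (c i) = 0 ∧ pd ε (v k) (c i) = 0) ∧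
    ∀ i, P i = c (i + 2) * coord ε (v 0) + c (i + 1) * sFun ε - c i := by
  have hsu : pd ε (u 1) (sFun ε) = 1 := by simp [sFun, pd_coord]
  have hsv : ∀ k, pd ε (v k) (sFun ε) = 0 := by simp [sFun, pd_coord]
  have hsu' : ∀ k, pd ε (u (k + 2)) (sFun ε) = 0 := by simp [sFun, pd_coord]
  -- By `pd_u_one` the u_y-coefficient of P_i is the s-coefficient of P_{i+1}, and by `pd_v_zero`
  -- the free term of P_{i+1} is minus the s-coefficient of P_i. One sequence therefore suffices,
  -- with its first two members read off from P₀.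
  let c : ℕ → Fun ε
    | 0 => pd ε (v 0) (P 0) * coord ε (v 0) + pd ε (u 1) (P 0) * sFun ε - P 0
    | 1 => pd ε (u 1) (P 0)
    | i + 2 => pd ε (v 0) (P i)
  have hc : ∀ i, pd ε (u 1) (P i) = c (i + 1) := by
    rintro (_ | i)
    · rfl
    · exact h.pd_u_one i
  have h2 : ∀ i k, pd ε (u (k + 1)) (c (i + 2)) = 0 ∧ pd ε (v k) (c (i + 2)) = 0 := by
    rintro i (_ | k)
    · exact ⟨h.pd_u_pd_v i, h.pd_v_pd_v i⟩
    · exact (h.low i).pd _ k |>.imp id id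
  have h1 : ∀ k, pd ε (u (k + 1)) (c 1) = 0 ∧ pd ε (v k) (c 1) = 0 := by
    rintro (_ | k)
    · exact ⟨h.pd_u_pd_u 0, (pd_comm _ _ _).trans (h.pd_u_pd_v 0)⟩
    · exact (h.low 0).pd _ k |>.imp id id
  refine ⟨c, ?_, ?_⟩
  · rintro (_ | _ | i) k
    · change pd ε (u (k + 1)) (c 2 * coord ε (v 0) + c 1 * sFun ε - P 0) = 0 ∧
        pd ε (v k) (c 2 * coord ε (v 0) + c 1 * sFun ε - P 0) = 0
      simp only [map_sub, map_add, Derivation.leibniz, (h1 k).1, (h1 k).2, (h2 0 k).1, (h2 0 k).2,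
        hsv, pd_coord]
      rcases k with _ | k
      · simp [hsu, hc, show pd ε (v 0) (P 0) = c 2 from rfl]
      · simp [hsu', (h.low 0 k).1, (h.low 0 k).2]
    · exact h1 k
    · exact h2 i k
  · rintro (_ | i)
    · change P 0 = c 2 * coord ε (v 0) + c 1 * sFun ε -
        (c 2 * coord ε (v 0) + c 1 * sFun ε - P 0)
      ring
    · have := h.pd_v_zero i
      rw [hc] at this
      change P (i + 1) = pd ε (v 0) (P (i + 1)) * coord ε (v 0) + pd ε (v 0) (P i) * sFun ε - c (i + 1)
      linear_combination -this

end IsChain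

end UHEReduction

namespace UHEReduction

variable {ε : ℤˣ} {p : ℤ}

open Coord (x y u v q)

/-! ### Functions of `x`, `y`, `u` and the nonlocal variables -/

/-- Functions of `x`, `y`, `u` and the nonlocal variables only. -/
def Base (c : Fun ε) : Prop := ∀ k, pd ε (u (k + 1)) c = 0 ∧ pd ε (v k) c = 0

theorem Base.add {c e : Fun ε} (hc : Base c) (he : Base e) : Base (c + e) := fun k => by
  simp [hc k, he k]

theorem Base.sub {c e : Fun ε} (hc : Base c) (he : Base e) : Base (c - e) := fun k => by
  simp [hc k, he k]

theorem Base.mul {c e : Fun ε} (hc : Base c) (he : Base e) : Base (c * e) := fun k => by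
  simp [hc k, he k]

theorem base_algebraMap (z : ℝ) : Base (algebraMap ℝ (Fun ε) z) := fun k => by simp

theorem Base.pd {c : Fun ε} (hc : Base c) (e : Coord) : Base (pd ε e c) := fun k => by
  rw [pd_comm, (hc k).1, pd_comm, (hc k).2, map_zero, and_self]

theorem base_u : Base (coord ε (u 0)) := fun k => by simp [pd_coord]

/-- The fields `τₙ` given on the generating series `ρ` of the nonlocal variables by
`τₙ ρ = λ ^ (n + 1) ((p - 1) ρ + λ ρ')`. -/
def tau (ε : ℤˣ) (p : ℤ) (n : ℕ) : Derivation ℝ (Fun ε) (Fun ε) := vectorField fun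
  -- Forced by q₀ = -(p - 1) y, since τ₀ q₀ has to be p - 1.
  | y => if n = 0 then -1 else 0
  | q i => if n ≤ i + 1 then
      algebraMap ℝ _ ((p : ℝ) - 1 + (i + 1 - n : ℕ)) * Q ε p (i + 1 - n) else 0
  | _ => 0

@[simp] theorem tau_x (n : ℕ) : tau ε p n (coord ε x) = 0 := vectorField_coord _ _

@[simp] theorem tau_u (n k : ℕ) : tau ε p n (coord ε (u k)) = 0 := vectorField_coord _ _

@[simp] theorem tau_v (n k : ℕ) : tau ε p n (coord ε (v k)) = 0 := vectorField_coord _ _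

theorem tau_y (n : ℕ) : tau ε p n (coord ε y) = if n = 0 then -1 else 0 := vectorField_coord _ _

theorem tau_Q_zero (n : ℕ) : tau ε p n (Q ε p 0) = 0 := by simp [Q]

theorem tau_Q_succ (n i : ℕ) : tau ε p n (Q ε p (i + 1)) = if n ≤ i then
    algebraMap ℝ _ ((p : ℝ) - 1 + (i - n : ℕ)) * Q ε p (i - n) else 0 := by
  rcases i with _ | i
  · rcases n with _ | n <;> simp [Q, tau_y, Algebra.smul_def]
  · exact vectorField_coord _ _

theorem tau_succ_Q_succ (n i : ℕ) : tau ε p (n + 1) (Q ε p (i + 1)) = tau ε p n (Q ε p i) := by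
  rcases i with _ | i
  · rw [tau_Q_succ, tau_Q_zero, if_neg (by omega)]
  · simp only [tau_Q_succ, Nat.add_le_add_iff_right, Nat.add_sub_add_right]

theorem pd_tau_comm {e : Coord} (hy : e ≠ y) (hq : ∀ i, e ≠ q i) (n : ℕ) (f : Fun ε) :
    pd ε e (tau ε p n f) = tau ε p n (pd ε e f) := by
  rw [derivation_comm_of_coord (D'' := 0), Derivation.zero_apply, add_zero]
  intro f
  rw [pd_coord, derivation_ite, Derivation.zero_apply, add_zero]
  cases f with
  | x => simp
  | y => rw [tau_y]; split_ifs <;> simp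
  | u k => simp
  | v k => simp
  | q i =>
    rw [← Q_succ_succ (p := p), tau_Q_succ]
    split_ifs
    · rw [Derivation.leibniz, pd_Q_eq_zero hy hq, Derivation.map_algebraMap, smul_zero, smul_zero,
        add_zero]
    · exact map_zero _

theorem Base.tau {c : Fun ε} (hc : Base c) (n : ℕ) : Base (tau ε p n c) := fun k => by
  rw [pd_tau_comm (by simp) (by simp), (hc k).1, pd_tau_comm (by simp) (by simp), (hc k).2,
    map_zero, and_self]

/-- On ρ the field τ_n is the operator λ^{n+1}(p - 1 + λ d/dλ), and τ_r τ_n composes these operators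
in the opposite order. The case distinctions treat only indices falling below that of q_{-1} = 1. -/
theorem tau_tau (r n : ℕ) (f : Fun ε) : tau ε p r (tau ε p n f) =
    tau ε p n (tau ε p r f) + algebraMap ℝ _ (r - n : ℝ) * tau ε p (n + r + 1) f := by
  change _ = _ + ((algebraMap ℝ (Fun ε) (r - n : ℝ)) • tau ε p (n + r + 1)) f
  refine derivation_comm_of_coord (fun c => ?_) f
  have key : ∀ i, tau ε p r (tau ε p n (Q ε p i)) = tau ε p n (tau ε p r (Q ε p i)) +
      algebraMap ℝ _ (r - n : ℝ) * tau ε p (n + r + 1) (Q ε p i) := by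
    rintro (_ | i)
    · simp [tau_Q_zero]
    have h : ∀ r n, n ≤ i → tau ε p r (tau ε p n (Q ε p (i + 1))) = if n + r + 1 ≤ i then
        algebraMap ℝ _ (((p : ℝ) - 1 + (i - n : ℕ)) * ((p : ℝ) - 1 + (i - (n + r + 1) : ℕ))) *
          Q ε p (i - (n + r + 1)) else 0 := by
      intro r n hn
      rw [tau_Q_succ, if_pos hn, Derivation.leibniz, Derivation.map_algebraMap, smul_zero, add_zero]
      rcases Nat.eq_zero_or_pos (i - n) with h | h
      · rw [h, tau_Q_zero, if_neg (by omega), smul_zero]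
      · obtain ⟨k, hk⟩ : ∃ k, i - n = k + 1 := ⟨i - n - 1, by omega⟩
        rw [hk, tau_Q_succ]
        by_cases hr : r ≤ k
        · rw [if_pos hr, if_pos (by omega), map_mul, smul_eq_mul, mul_assoc,
            show i - (n + r + 1) = k - r by omega]
        · rw [if_neg hr, if_neg (by omega), smul_zero]
    have h' : ∀ r n, i < n → tau ε p r (tau ε p n (Q ε p (i + 1))) = 0 := fun r n hn => by
      rw [tau_Q_succ, if_neg (by omega), map_zero]
    rw [tau_Q_succ (n + r + 1)]
    rcases le_or_gt n i with hn | hn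
    · rcases le_or_gt r i with hr | hr
      · rw [h _ _ hn, h _ _ hr]
        by_cases hnr : n + r + 1 ≤ i
        · rw [if_pos hnr, if_pos (by omega), if_pos hnr, show r + n + 1 = n + r + 1 by ring,
            Nat.cast_sub hn, Nat.cast_sub hr]
          simp only [map_mul, map_add, map_sub]
          ring
        · rw [if_neg hnr, if_neg (by omega), if_neg hnr]
          simp
      · rw [h _ _ hn, h' _ _ hr, if_neg (by omega), if_neg (by omega)]
        simp
    · rcases le_or_gt r i with hr | hr
      · rw [h _ _ hr, h' _ _ hn, if_neg (by omega), if_neg (by omega)]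
        simp
      · rw [h' _ _ hr, h' _ _ hn, if_neg (by omega)]
        simp
  cases c with
  | x => simp
  | y => simp only [tau_y, apply_ite, map_neg, Derivation.map_one_eq_zero,
      map_zero, neg_zero, ite_self, zero_add, Derivation.smul_apply]; simp
  | u k => simp
  | v k => simp
  | q i => exact key (i + 2)

@[simp] theorem euler_x : euler ε (coord ε x) = 0 := vectorField_coord _ _

@[simp] theorem euler_y : euler ε (coord ε y) = coord ε y := vectorField_coord _ _

@[simp] theorem euler_u (k : ℕ) : euler ε (coord ε (u k)) = -coord ε (u k) :=
  (vectorField_coord _ _).trans (by simp)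

@[simp] theorem euler_v (k : ℕ) : euler ε (coord ε (v k)) = -2 * coord ε (v k) :=
  (vectorField_coord _ _).trans (by simp [Algebra.smul_def, map_ofNat])

theorem euler_Q (i : ℕ) : euler ε (Q ε p i) = (i : Fun ε) * Q ε p i := by
  rcases i with _ | _ | i
  · simp [Q]
  · simp [Q]
  · exact (vectorField_coord _ _).trans (by
      simp only [Q, Algebra.smul_def, map_add, map_natCast, map_ofNat]; push_cast; ring)

theorem euler_tau (n : ℕ) (f : Fun ε) : euler ε (tau ε p n f) =
    tau ε p n (euler ε f) - ((n : Fun ε) + 1) * tau ε p n f := by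
  rw [sub_eq_add_neg, ← neg_mul]
  change _ = _ + ((-((n : Fun ε) + 1)) • tau ε p n) f
  refine derivation_comm_of_coord (fun c => ?_) f
  rw [Derivation.smul_apply]
  cases c with
  | x => simp
  | y => rcases n with _ | n <;> simp [tau_y]
  | u k => simp
  | v k => simp [Derivation.leibniz, derivation_two]
  | q i =>
    rw [← Q_succ_succ (p := p), euler_Q, tau_Q_succ, Derivation.leibniz, tau_Q_succ,
      Derivation.map_natCast]
    split_ifs with h
    · rw [Derivation.leibniz, euler_Q, Derivation.map_algebraMap]
      simp only [Nat.cast_sub h, smul_eq_mul]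
      push_cast
      ring
    · simp

theorem exists_pd_q_eq_zero (f : Fun ε) : ∃ N, ∀ i, N ≤ i → pd ε (q i) f = 0 := by
  obtain ⟨b, hb⟩ := Finset.exists_nat_subset_range
    (((funChart ε).supp f).image fun | q j => j | _ => 0)
  refine ⟨b, fun l hl => (funChart ε).der_eq_zero fun h => ?_⟩
  have := hb (Finset.mem_image_of_mem _ h)
  simp at this
  omega

theorem exists_tau_eq_zero (f : Fun ε) : ∃ N, ∀ n, N ≤ n → tau ε p n f = 0 := by
  obtain ⟨N, hN⟩ := exists_pd_q_eq_zero f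
  refine ⟨N + 2, fun n hn => (funChart_isRegular _).apply_eq_zero fun c => ?_⟩
  change tau ε p n (coord ε c) = 0 ∨ pd ε c f = 0
  cases c with
  | x => simp
  | y => rw [tau_y, if_neg (by omega)]; simp
  | u k => simp
  | v k => simp
  | q i =>
    rcases le_or_gt N i with h | h
    · exact Or.inr (hN i h)
    · rw [← Q_succ_succ (p := p), tau_Q_succ, if_neg (by omega)]
      simp

theorem Chart.IsRegular.sum {A : Type} [CommRing A] [Algebra ℝ A] {χ : Chart A} {ι : Type}
    {s : Finset ι} {D : ι → Derivation ℝ A A} (h : ∀ i ∈ s, χ.IsRegular (D i)) :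
    χ.IsRegular (∑ i ∈ s, D i) := by
  classical
  induction s using Finset.induction_on with
  | empty => exact fun F => by simp
  | insert i s hi ih =>
    rw [Finset.sum_insert hi]
    exact (h i (Finset.mem_insert_self i s)).add (ih fun j hj => h j (Finset.mem_insert_of_mem hj))

theorem derivation_sum_apply {A : Type} [CommRing A] [Algebra ℝ A] {ι : Type} (s : Finset ι)
    (D : ι → Derivation ℝ A A) (F : A) : (∑ i ∈ s, D i) F = ∑ i ∈ s, D i F := by
  classical
  induction s using Finset.induction_on with
  | empty => simp
  | insert i s hi ih => rw [Finset.sum_insert hi, Finset.sum_insert hi, Derivation.add_apply, ih]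

namespace Roots

variable (r : Roots ε)

theorem d_Q_eq_sum {i N : ℕ} (h : i ≤ N) : r.d p (inc ε (Q ε p i)) =
    -∑ l ∈ Finset.range N, r.β ^ (l + 1) * inc ε (tau ε p l (Q ε p i)) := by
  induction i generalizing N with
  | zero => simp [d_Q_zero, tau_Q_zero]
  | succ i ih =>
    obtain ⟨N, rfl⟩ : ∃ M, N = M + 1 := ⟨N - 1, by omega⟩
    rw [d_Q_succ, ih (by omega : i ≤ N), Finset.sum_range_succ', tau_Q_succ, if_pos (Nat.zero_le _)]
    simp only [tau_succ_Q_succ, Nat.sub_zero, map_mul,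
      show ∀ z, inc ε (algebraMap ℝ (Fun ε) z) = algebraMap ℝ (Ext ε) z from fun _ => rfl]
    rw [mul_sub, mul_neg, Finset.mul_sum, neg_add, sub_eq_add_neg]
    congr 2
    · exact Finset.sum_congr rfl fun l _ => by ring
    · ring

/-- On these functions d is a Laurent polynomial in β with coefficients free of β: du = b - u
supplies the term 1/β, dy = β and `d_Q_eq_sum` the positive powers. `N` only has to exceed the
indices that occur. -/
theorem d_base {c : Fun ε} (hc : Base c) : ∃ N₀, ∀ N, N₀ ≤ N → r.d p (inc ε c) =
    inc ε (pd ε x c) + (r.b - inc ε (coord ε (u 0))) * inc ε (pd ε (u 0) c) -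
      ∑ l ∈ Finset.range N, r.β ^ (l + 1) * inc ε (tau ε p l c) := by
  obtain ⟨M, hM⟩ := exists_pd_q_eq_zero c
  refine ⟨M + 2, fun N hN => ?_⟩
  let D : Derivation ℝ (Ext ε) (Ext ε) := extend (pd ε x) +
    (r.b - inc ε (coord ε (u 0))) • extend (pd ε (u 0)) -
    ∑ l ∈ Finset.range N, r.β ^ (l + 1) • extend (tau ε p l)
  have hD : ∀ f, D (inc ε f) = inc ε (pd ε x f) +
      (r.b - inc ε (coord ε (u 0))) * inc ε (pd ε (u 0) f) -
      ∑ l ∈ Finset.range N, r.β ^ (l + 1) * inc ε (tau ε p l f) := fun f => by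
    simp only [D, Derivation.sub_apply, Derivation.add_apply, Derivation.smul_apply, extend_inc,
      smul_eq_mul, derivation_sum_apply]
  have hreg : (extChart ε).IsRegular (r.d p - D) := (r.d_isRegular p).sub
    ((((extend_isRegular _).add ((extend_isRegular _).smul _))).sub
      (Chart.IsRegular.sum fun l _ => (extend_isRegular _).smul _))
  have h0 := hreg.apply_eq_zero (F := inc ε c) fun e => ?_
  · rw [Derivation.sub_apply, hD, sub_eq_zero] at h0
    exact h0
  · change (r.d p - D) (inc ε (coord ε e)) = 0 ∨ extend (pd ε e) (inc ε c) = 0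
    rw [extend_inc, Derivation.sub_apply, hD]
    cases e with
    | x => left; simp [d_x, pd_coord]
    | y =>
      left
      obtain ⟨N, rfl⟩ : ∃ M, N = M + 1 := ⟨N - 1, by omega⟩
      rw [Finset.sum_range_succ']
      simp [d_y, pd_coord, tau_y]
    | u k =>
      rcases k with _ | k
      · left; simp [d_u, pd_coord]
      · right; rw [(hc k).1, map_zero]
    | v k => right; rw [(hc k).2, map_zero]
    | q i =>
      rcases le_or_gt M i with h | h
      · right; rw [hM i h, map_zero]
      · left
        rw [← Q_succ_succ (p := p), r.d_Q_eq_sum (by omega : i + 2 ≤ N), Q_succ_succ]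
        simp [pd_coord]

theorem newDer_base {c : Fun ε} (hc : Base c) {e : Coord} (he : e = v 0 ∨ e = u 1) :
    r.newDer p e (inc ε c) = 0 := by
  refine (r.newDer_isRegular p e).apply_eq_zero fun f => ?_
  change r.newDer p e (inc ε (coord ε f)) = 0 ∨ extend (pd ε f) (inc ε c) = 0
  rw [extend_inc]
  have key : ∀ f, r.newCoord p f = inc ε (coord ε f) → e ≠ f →
      r.newDer p e (inc ε (coord ε f)) = 0 := fun f hf h => by
    rw [← hf, newDer_newCoord, if_neg h]
  cases f with
  | x => exact Or.inl (key _ rfl (by rcases he with rfl | rfl <;> simp))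
  | y => exact Or.inl (key _ rfl (by rcases he with rfl | rfl <;> simp))
  | u k =>
    rcases k with _ | k
    · exact Or.inl (key _ rfl (by rcases he with rfl | rfl <;> simp))
    · right; rw [(hc k).1, map_zero]
  | v k => right; rw [(hc k).2, map_zero]
  | q i => exact Or.inl (key _ rfl (by rcases he with rfl | rfl <;> simp))

-- The coefficients are constants of ∂/∂β, and ∂β/∂β = 1, so β is transcendental over them.
open Polynomial in
theorem eq_zero_of_eval₂ (p : ℤ) {g : (Fun ε)[X]} (hg : ∀ n, Base (g.coeff n))
    (h : g.eval₂ (inc ε) r.β = 0) : g = 0 := by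
  have hl : g.map (inc ε) ∈ lifts (algebraMap (constants (r.newDer p (v 0))) (Ext ε)) := by
    rw [lifts_iff_coeff_lifts]
    intro n
    rw [coeff_map]
    exact ⟨⟨inc ε (g.coeff n), r.newDer_base (hg n) (Or.inl rfl)⟩, rfl⟩
  obtain ⟨f, hf⟩ := (mem_lifts _).1 hl
  have hβ : IsUnit (r.newDer p (v 0) r.β) := by rw [newDer_β]; simp
  have h0 := aeval_constants_injective hβ f (by
    rw [aeval_def, ← eval_map, hf, eval_map, h])
  rw [h0, Polynomial.map_zero] at hf
  exact Polynomial.map_injective _ inc_injective (hf.symm.trans (Polynomial.map_zero _).symm)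

open Polynomial in
theorem exists_polynomial {c : Fun ε} (hc : Base c) : ∃ G : (Fun ε)[X],
    G.eval₂ (inc ε) r.β = r.β * r.d p (inc ε c) ∧ G.coeff 0 = pd ε (u 0) c ∧
    G.coeff 1 = pd ε x c - coord ε (u 0) * pd ε (u 0) c ∧ ∀ n, G.coeff (n + 2) = -tau ε p n c := by
  obtain ⟨N₀, h₀⟩ := r.d_base (p := p) hc
  obtain ⟨N₁, h₁⟩ := exists_tau_eq_zero (p := p) c
  refine ⟨C (pd ε (u 0) c) + C (pd ε x c - coord ε (u 0) * pd ε (u 0) c) * X -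
    (∑ l ∈ Finset.range (N₀ + N₁), C (tau ε p l c) * X ^ l) * X ^ 2, ?_, ?_, ?_, fun n => ?_⟩
  · rw [h₀ (N₀ + N₁) (by omega)]
    simp only [eval₂_sub, eval₂_add, eval₂_mul, eval₂_C, eval₂_X, eval₂_X_pow, eval₂_finsetSum,
      mul_sub, Finset.mul_sum, Finset.sum_mul, map_sub, map_mul]
    have : ∑ i ∈ Finset.range (N₀ + N₁), inc ε (tau ε p i c) * r.β ^ i * r.β ^ 2 =
        ∑ i ∈ Finset.range (N₀ + N₁), r.β * (r.β ^ (i + 1) * inc ε (tau ε p i c)) :=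
      Finset.sum_congr rfl fun l _ => by ring
    rw [this]
    linear_combination -inc ε (pd ε (u 0) c) * r.β_mul
  · simp [coeff_X_pow]
  · simp [coeff_mul_X_pow']
  · rw [coeff_sub, coeff_mul_X_pow, coeff_add, coeff_C_of_ne_zero (by omega), coeff_C_mul, coeff_X,
      if_neg (by omega), finsetSum_coeff]
    simp only [coeff_C_mul, coeff_X_pow]
    rw [mul_zero, zero_add, zero_sub]
    congr 1
    rw [Finset.sum_eq_single n]
    · simp
    · intro b _ hb
      rw [if_neg hb.symm, mul_zero]
    · intro hn
      rw [Finset.mem_range, not_lt] at hn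
      rw [h₁ n (by omega), zero_mul]

/-- The recurrence satisfied by the coefficients of a chain. -/
theorem coefficient_relation {P c : ℕ → Fun ε} (h : IsChain p P) (hc : ∀ i, Base (c i))
    (hP : ∀ i, P i = c (i + 2) * coord ε (v 0) + c (i + 1) * sFun ε - c i) (i : ℕ) :
    r.d p (inc ε (c (i + 2))) - 2 * r.β * r.d p (inc ε (c (i + 1))) +
      r.β ^ 2 * r.d p (inc ε (c i)) + algebraMap ℝ _ (1 - i) * r.β *
        (r.β * inc ε (c i) - inc ε (c (i + 1))) = 0 := by
  let L : ℕ → Ext ε := fun i => r.d p (inc ε (c (i + 2))) - 2 * r.β * r.d p (inc ε (c (i + 1))) +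
    r.β ^ 2 * r.d p (inc ε (c i)) + algebraMap ℝ _ (1 - i) * r.β *
      (r.β * inc ε (c i) - inc ε (c (i + 1)))
  have hα : r.newDer p (u 1) r.α = 1 := by rw [newDer_α]; simp
  have hβ : r.newDer p (u 1) r.β = 0 := by rw [newDer_β]; simp
  have hb : r.newDer p (u 1) r.b = 0 := by rw [derivation_b, hβ, mul_zero]
  have ha : r.newDer p (u 1) r.a = -r.a ^ 2 := by rw [derivation_a, hα, mul_one]
  have hB : ∀ {f : Fun ε}, Base f → r.newDer p (u 1) (inc ε f) = 0 := fun hf =>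
    r.newDer_base hf (Or.inr rfl)
  have hdc : ∀ i, r.newDer p (u 1) (r.d p (inc ε (c i))) = 0 := fun i => by
    obtain ⟨N, hN⟩ := r.d_base (p := p) (hc i)
    rw [hN N le_rfl, map_sub, map_add, map_sum, Derivation.leibniz, hB ((hc i).pd _),
      hB ((hc i).pd _), map_sub, hb, hB base_u]
    rw [Finset.sum_eq_zero]
    · simp
    · intro l _
      rw [Derivation.leibniz, hB ((hc i).tau l), Derivation.leibniz_pow, hβ]
      simp
  have hL : ∀ i, r.newDer p (u 1) (L i) = 0 := fun i => by
    simp [L, Derivation.leibniz, Derivation.leibniz_pow, hβ, hdc, hB (hc _), derivation_two]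
  -- The recurrence along d yields only this. But no `L i` depends on α while ∂a/∂α = -a², so
  -- differentiation in α gives L (i + 1) = 0 and then L i = 0.
  have key : ∀ i, r.a * L (i + 1) = L i := by
    intro i
    have h1 := r.d_chain h i
    have hd : r.d p r.a = -r.a * r.β * r.w := by
      rw [derivation_a, d_α]
      linear_combination -r.a * r.β * r.w * r.α_mul
    have e1 := r.β_mul
    have hP1 : r.β * inc ε (P (i + 1)) = r.a * (r.β * inc ε (c (i + 2)) - inc ε (c (i + 3))) -
        (r.β * inc ε (c (i + 1)) - inc ε (c (i + 2))) := by
      rw [hP, map_sub, map_add, map_mul, map_mul, r.hs, r.hv]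
      linear_combination (inc ε (c (i + 2)) - r.a * inc ε (c (i + 3))) * e1
    have hP0 : inc ε (P i) = r.b * (r.a * (r.β * inc ε (c (i + 1)) - inc ε (c (i + 2))) -
        (r.β * inc ε (c i) - inc ε (c (i + 1)))) := by
      rw [hP, map_sub, map_add, map_mul, map_mul, r.hs, r.hv]
      linear_combination (inc ε (c i) - r.a * inc ε (c (i + 1))) * e1
    have h2 : r.β ^ 2 * r.w * inc ε (P (i + 1)) = r.β * r.w * (r.β * inc ε (P (i + 1))) := by ring
    rw [h2, hP1, hP0] at h1
    simp only [Derivation.leibniz, map_sub, smul_eq_mul, hd, r.derivation_b (r.d p)] at h1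
    simp only [L]
    rw [Nat.cast_add, Nat.cast_one]
    simp only [map_sub, map_add, map_one, map_natCast] at h1 ⊢
    set E := r.β * inc ε (c (i + 1)) - inc ε (c (i + 2)) with hE
    set F := r.β * inc ε (c i) - inc ε (c (i + 1)) with hF
    linear_combination -h1 + (r.β * (-r.a * (r.β * r.d p (inc ε (c (i + 1))) +
      inc ε (c (i + 1)) * r.d p r.β - r.d p (inc ε (c (i + 2)))) + r.a * r.β * r.w * E +
      (r.β * r.d p (inc ε (c i)) + inc ε (c i) * r.d p r.β - r.d p (inc ε (c (i + 1)))) -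
      (1 - (i : Ext ε)) * (r.a * E - F)) + r.d p r.β * (r.a * E - F) * (r.β * r.b + 1)) * e1 +
      r.a * r.β * E * r.w_mul + r.β * r.w * E * r.α_mul
  have h0 := congrArg (r.newDer p (u 1)) (key i)
  rw [hL, Derivation.leibniz, hL, ha, smul_zero, zero_add, smul_eq_mul] at h0
  have ua : IsUnit r.a := IsUnit.of_mul_eq_one r.α (by rw [mul_comm]; exact r.α_mul)
  have h1 : L (i + 1) = 0 := (ua.pow 2).mul_right_eq_zero.1 (by linear_combination -h0)
  change L i = 0
  rw [← key, h1, mul_zero]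

end Roots

/-- The relations between the coefficients of a chain. -/
structure IsCoefficients (p : ℤ) (c : ℕ → Fun ε) : Prop where
  base : ∀ i, Base (c i)
  pd_u : ∀ i, pd ε (u 0) (c (i + 2)) = 0
  pd_x : ∀ i, pd ε x (c (i + 2)) = 2 * pd ε (u 0) (c (i + 1))
  tau_zero : ∀ i, tau ε p 0 (c (i + 2)) = -2 * (pd ε x (c (i + 1)) -
    coord ε (u 0) * pd ε (u 0) (c (i + 1))) + pd ε (u 0) (c i) - algebraMap ℝ _ (1 - i) * c (i + 1)
  tau_one : ∀ i, tau ε p 1 (c (i + 2)) = 2 * tau ε p 0 (c (i + 1)) +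
    (pd ε x (c i) - coord ε (u 0) * pd ε (u 0) (c i)) + algebraMap ℝ _ (1 - i) * c i
  tau_add_two : ∀ i n, tau ε p (n + 2) (c (i + 2)) =
    2 * tau ε p (n + 1) (c (i + 1)) - tau ε p n (c i)

-- β times `coefficient_relation` is a polynomial in β with coefficients free of β. Its coefficients
-- in degrees 0, 1, 2, 3 and n + 4 are the listed relations.
open Polynomial in
theorem IsChain.isCoefficients {P c : ℕ → Fun ε} (h : IsChain p P) (hc : ∀ i, Base (c i))
    (hP : ∀ i, P i = c (i + 2) * coord ε (v 0) + c (i + 1) * sFun ε - c i) :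
    IsCoefficients p c := by
  obtain ⟨r⟩ := exists_roots ε
  choose G hG h0 h1 h2 using fun i => r.exists_polynomial (p := p) (hc i)
  have hGb : ∀ i n, Base ((G i).coeff n) := by
    rintro i (_ | _ | n)
    · rw [h0]; exact (hc i).pd _
    · rw [h1]; exact ((hc i).pd _).sub (base_u.mul ((hc i).pd _))
    · rw [h2, ← zero_sub]
      exact (by simpa using base_algebraMap 0 : Base (0 : Fun ε)).sub ((hc i).tau n)
  have hb0 : Base (0 : Fun ε) := by simpa using base_algebraMap (ε := ε) 0
  let K : ℕ → (Fun ε)[X] := fun i => G (i + 2) - X * (C 2 * G (i + 1)) + X * (X * G i) +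
    X * (X * (X * C (algebraMap ℝ _ (1 - i : ℝ) * c i) -
      C (algebraMap ℝ _ (1 - i : ℝ) * c (i + 1))))
  have k0 : ∀ i, (K i).coeff 0 = (G (i + 2)).coeff 0 := fun i => by simp [K]
  have k1 : ∀ i, (K i).coeff 1 = (G (i + 2)).coeff 1 - 2 * (G (i + 1)).coeff 0 := fun i => by
    simp [K]
  have k2 : ∀ i, (K i).coeff 2 = (G (i + 2)).coeff 2 - 2 * (G (i + 1)).coeff 1 + (G i).coeff 0 -
      algebraMap ℝ _ (1 - i : ℝ) * c (i + 1) := fun i => by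
    simp [K, coeff_one]
    ring
  have k3 : ∀ i, (K i).coeff 3 = (G (i + 2)).coeff 3 - 2 * (G (i + 1)).coeff 2 + (G i).coeff 1 +
      algebraMap ℝ _ (1 - i : ℝ) * c i := fun i => by
    simp [K, coeff_C, coeff_one]
  have k4 : ∀ i n, (K i).coeff (n + 4) = (G (i + 2)).coeff (n + 4) -
      2 * (G (i + 1)).coeff (n + 3) + (G i).coeff (n + 2) := fun i n => by
    simp [K, coeff_one]
  have hK : ∀ i, K i = 0 := fun i => by
    refine r.eq_zero_of_eval₂ p ?_ ?_
    · have h2b : Base (2 : Fun ε) := fun k => by simp [derivation_two]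
      have hrb : Base (algebraMap ℝ (Fun ε) (1 - i : ℝ)) := base_algebraMap _
      rintro (_ | _ | _ | _ | n)
      · rw [k0]; exact hGb _ _
      · rw [k1]; exact (hGb _ _).sub (h2b.mul (hGb _ _))
      · rw [k2]
        exact (((hGb _ _).sub (h2b.mul (hGb _ _))).add (hGb _ _)).sub (hrb.mul (hc _))
      · rw [k3]
        exact (((hGb _ _).sub (h2b.mul (hGb _ _))).add (hGb _ _)).add (hrb.mul (hc _))
      · rw [k4]
        exact ((hGb _ _).sub (h2b.mul (hGb _ _))).add (hGb _ _)
    · simp only [K, eval₂_add, eval₂_sub, eval₂_mul, eval₂_X, eval₂_C, hG, eval₂_ofNat, map_ofNat, map_mul,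
        show ∀ z, inc ε (algebraMap ℝ (Fun ε) z) = algebraMap ℝ (Ext ε) z from fun _ => rfl]
      linear_combination r.β * r.coefficient_relation h hc hP i
  have hu : ∀ i, pd ε (u 0) (c (i + 2)) = 0 := fun i => by rw [← h0, ← k0, hK, coeff_zero]
  refine ⟨hc, hu, fun i => ?_, fun i => ?_, fun i => ?_, fun i n => ?_⟩
  · have := k1 i
    rw [hK, coeff_zero, h1, h0, hu] at this
    linear_combination -this
  · have := k2 i
    rw [hK, coeff_zero, h1, h0, h2] at this
    linear_combination this
  · have := k3 i
    rw [hK, coeff_zero, h1, h2, h2] at this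
    linear_combination this
  · have := k4 i n
    rw [hK, coeff_zero, h2, h2, h2] at this
    linear_combination this

end UHEReduction

namespace UHEReduction

variable {ε : ℤˣ} {p : ℤ}

open Coord (x y u v q)

/-! ### The function `e⁻ˣ` -/

theorem isSmooth_exp_neg : IsSmooth (fun θ : Domain ε => Real.exp (-θ.1 x)) :=
  ⟨{x}, fun z => Real.exp (-z ⟨x, Finset.mem_singleton_self x⟩), fun θ => by fun_prop, fun _ => rfl⟩

theorem isSmooth_exp : IsSmooth (fun θ : Domain ε => Real.exp (θ.1 x)) :=
  ⟨{x}, fun z => Real.exp (z ⟨x, Finset.mem_singleton_self x⟩), fun θ => by fun_prop, fun _ => rfl⟩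

/-- The function `e⁻ˣ`. -/
def expNeg (ε : ℤˣ) : Fun ε := ⟨fun θ => Real.exp (-θ.1 x), isSmooth_exp_neg⟩

/-- The function `eˣ`. -/
def expPos (ε : ℤˣ) : Fun ε := ⟨fun θ => Real.exp (θ.1 x), isSmooth_exp⟩

theorem expNeg_mul_expPos : expNeg ε * expPos ε = 1 := by
  refine fun_ext fun θ => ?_
  change Real.exp (-θ.1 x) * Real.exp (θ.1 x) = 1
  rw [← Real.exp_add, neg_add_cancel, Real.exp_zero]

theorem pd_expNeg (c : Coord) : pd ε c (expNeg ε) = if c = x then -expNeg ε else 0 := by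
  split_ifs with h
  · subst h
    refine fun_ext fun θ => ?_
    have hg : ∀ θ : Domain ε, ContDiffAt ℝ ∞ (fun z : ({x} : Finset Coord) → ℝ =>
        Real.exp (-z ⟨x, Finset.mem_singleton_self x⟩)) (Finset.restrict {x} θ.1) :=
      fun θ => by fun_prop
    have h1 := (hasDerivAt_extend x (f := (expNeg ε).1) hg (fun _ => rfl) θ).deriv
    have h2 : HasDerivAt (fun t : ℝ => Function.extend Subtype.val (expNeg ε).1 0
        (Function.update θ.1 x t)) (-Real.exp (-θ.1 x)) (θ.1 x) := by
      have h3 : HasDerivAt (fun t : ℝ => Real.exp (-t)) (-Real.exp (-θ.1 x)) (θ.1 x) := by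
        simpa using (hasDerivAt_neg (θ.1 x)).exp
      refine h3.congr_of_eventuallyEq (Filter.Eventually.of_forall fun t => ?_)
      have ht : Function.update θ.1 x t ∈ Domain ε := by
        have := θ.2
        simpa [Domain] using this
      have := Subtype.val_injective.extend_apply (expNeg ε).1 0 (⟨_, ht⟩ : Domain ε)
      refine this.trans ?_
      change Real.exp (-Function.update θ.1 x t x) = _
      rw [Function.update_self]
    exact h2.deriv
  · refine Subtype.ext (partialAt_eq_zero (s := {x})
      (g := fun z => Real.exp (-z ⟨x, Finset.mem_singleton_self x⟩)) (fun θ => by fun_prop)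
      (fun _ => rfl) (by simpa using h))

theorem derivation_expNeg (D : Derivation ℝ (Fun ε) (Fun ε)) :
    D (expNeg ε) = -D (coord ε x) * expNeg ε := by
  have h := (funChart_isRegular (D - D (coord ε x) • pd ε x)).apply_eq_zero (F := expNeg ε)
    fun c => ?_
  · rw [Derivation.sub_apply, Derivation.smul_apply, pd_expNeg, if_pos rfl, smul_eq_mul] at h
    linear_combination h
  · change (D - D (coord ε x) • pd ε x) (coord ε c) = 0 ∨ pd ε c (expNeg ε) = 0
    rw [pd_expNeg, Derivation.sub_apply, Derivation.smul_apply, pd_coord]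
    rcases eq_or_ne c x with rfl | h
    · left; simp
    · right; rw [if_neg h]

/-! ### Classification of the coefficients -/

theorem isUnit_algebraMap {z : ℝ} (hz : z ≠ 0) : IsUnit (algebraMap ℝ (Fun ε) z) :=
  (isUnit_iff_ne_zero.2 hz).map _

/-- A function of `x`, `y`, `u` and the nonlocal variables that is annihilated by `∂/∂x`, `∂/∂u`
and all `τₙ` is constant. -/
theorem eq_algebraMap_of_base (hp : p ≠ 1) {G : Fun ε} (hG : Base G) (hx : pd ε x G = 0)
    (hu : pd ε (u 0) G = 0) (ht : ∀ n, tau ε p n G = 0) :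
    ∃ z : ℝ, G = algebraMap ℝ (Fun ε) z := by
  have hm : IsUnit (algebraMap ℝ (Fun ε) ((p : ℝ) - 1)) :=
    isUnit_algebraMap (sub_ne_zero.2 fun h => hp (by exact_mod_cast h))
  obtain ⟨N, hN⟩ := exists_pd_q_eq_zero G
  have hq : ∀ i, pd ε (q i) G = 0 := by
    induction N with
    | zero => exact fun i => hN i (Nat.zero_le i)
    | succ N ih =>
      refine ih fun i hi => ?_
      rcases hi.eq_or_lt with rfl | hi
      swap
      · exact hN i hi
      -- On functions free of `q j` with j > N, the field τ_{N+1} is (p - 1) ∂/∂(`q N`), as it kills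
      -- the lower variables. Here p ≠ 1 is essential.
      have h0 := (funChart_isRegular (tau ε p (N + 1) -
        (algebraMap ℝ (Fun ε) ((p : ℝ) - 1)) • pd ε (q N))).apply_eq_zero
        (F := G) fun c => ?_
      · rw [Derivation.sub_apply, ht, zero_sub, neg_eq_zero, Derivation.smul_apply,
          smul_eq_mul] at h0
        exact hm.mul_right_eq_zero.1 h0
      · change (tau ε p (N + 1) - (algebraMap ℝ (Fun ε) ((p : ℝ) - 1)) •
          pd ε (q N)) (coord ε c) = 0 ∨ pd ε c G = 0
        rw [Derivation.sub_apply, Derivation.smul_apply, pd_coord]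
        cases c with
        | x => exact Or.inr hx
        | y => left; simp [tau_y]
        | u k => left; simp
        | v k => left; simp
        | q j =>
          rcases lt_trichotomy j N with hj | rfl | hj
          · left
            rw [← Q_succ_succ (p := p), tau_Q_succ, if_neg (by omega)]
            simp [hj.ne']
          · left
            rw [← Q_succ_succ (p := p), tau_Q_succ, if_pos le_rfl, Nat.sub_self]
            simp [Q]
          · exact Or.inr (hN j hj)
  have hy : pd ε y G = 0 := by
    have h0 := (funChart_isRegular (tau ε p 0 + pd ε y)).apply_eq_zero
      (F := G) fun c => ?_
    · rwa [Derivation.add_apply, ht, zero_add] at h0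
    · change (tau ε p 0 + pd ε y) (coord ε c) = 0 ∨
        pd ε c G = 0
      rw [Derivation.add_apply, pd_coord]
      cases c with
      | x => exact Or.inr hx
      | y => left; simp [tau_y]
      | u k => left; simp
      | v k => left; simp
      | q j => exact Or.inr (hq j)
  refine eq_algebraMap_of_pd_eq_zero fun c => ?_
  cases c with
  | x => exact hx
  | y => exact hy
  | u k =>
    rcases k with _ | k
    · exact hu
    · exact (hG k).1
  | v k => exact (hG k).2
  | q i => exact hq i

/-- A doubly indexed family that is affine along the diagonals vanishes on a diagonal if it
vanishes there eventually. -/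
theorem diagonal_eq_zero {A : Type} [CommRing A] {T : ℕ → ℕ → A} {e : ℤ}
    (hT : ∀ n j : ℕ, (j : ℤ) - n = e → T (n + 2) (j + 2) = 2 * T (n + 1) (j + 1) - T n j) (N : ℕ)
    (h : ∀ n j : ℕ, (j : ℤ) - n = e → N ≤ n → T n j = 0) (n j : ℕ) (hj : (j : ℤ) - n = e) :
    T n j = 0 := by
  induction N with
  | zero => exact h n j hj (Nat.zero_le n)
  | succ N ih =>
    refine ih fun n j hj hn => ?_
    rcases hn.eq_or_lt with rfl | hn
    · have := hT N j hj
      rw [h _ _ (by push_cast; omega) (by omega), h _ _ (by push_cast; omega) (by omega)] at this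
      linear_combination this
    · exact h n j hj hn

namespace IsCoefficients

variable {c : ℕ → Fun ε}

theorem sub_smul {c' : ℕ → Fun ε} (h : IsCoefficients p c) (h' : IsCoefficients p c') (t : ℝ) :
    IsCoefficients p fun i => c i - algebraMap ℝ _ t * c' i where
  base i := (h.base i).sub ((base_algebraMap t).mul (h'.base i))
  pd_u i := by simp [Derivation.leibniz, h.pd_u, h'.pd_u]
  pd_x i := by
    simp only [Derivation.leibniz, map_sub, h.pd_x, h'.pd_x, Derivation.map_algebraMap,
      smul_eq_mul]
    ring
  tau_zero i := by
    simp only [Derivation.leibniz, map_sub, h.tau_zero, h'.tau_zero, Derivation.map_algebraMap,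
      smul_eq_mul]
    ring
  tau_one i := by
    simp only [Derivation.leibniz, map_sub, h.tau_one, h'.tau_one, Derivation.map_algebraMap,
      smul_eq_mul]
    ring
  tau_add_two i n := by
    simp only [Derivation.leibniz, map_sub, h.tau_add_two, h'.tau_add_two,
      Derivation.map_algebraMap, smul_eq_mul]
    ring

theorem pd_x_eq_zero (h : IsCoefficients p c) (i : ℕ) : pd ε x (c (i + 3)) = 0 := by
  rw [h.pd_x, h.pd_u, mul_zero]

/-- From c₃ on there is no dependence on x and u, so the relations become a linear two-step
recursion along the diagonal, solved by this formula. -/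
theorem tau_eq (h : IsCoefficients p c) (n i : ℕ) : tau ε p n (c (i + 3 + n + 1)) =
    algebraMap ℝ _ ((i : ℝ) + 1 - n) * c (i + 3) := by
  induction n using Nat.strong_induction_on with
  | _ n ih =>
  rcases n with _ | _ | n
  · rw [show i + 3 + 0 + 1 = i + 2 + 2 by ring, h.tau_zero, h.pd_x_eq_zero, h.pd_u, h.pd_u]
    simp only [map_sub, map_add, map_one, map_natCast, map_ofNat, map_zero, Nat.cast_add,
      Nat.cast_ofNat, Nat.cast_zero]
    ring
  · rw [show i + 3 + (0 + 1) + 1 = i + 3 + 2 by ring, zero_add, h.tau_one, h.pd_x_eq_zero,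
      h.pd_u, ih 0 (by omega)]
    simp only [map_sub, map_add, map_one, map_natCast, map_ofNat, map_zero, Nat.cast_add,
      Nat.cast_one, Nat.cast_ofNat, Nat.cast_zero]
    ring
  · rw [show i + 3 + (n + 2) + 1 = i + 3 + n + 1 + 2 by ring, h.tau_add_two,
      show i + 3 + n + 1 + 1 = i + 3 + (n + 1) + 1 by ring, ih n (by omega),
      ih (n + 1) (by omega)]
    simp only [map_sub, map_add, map_one, map_natCast, Nat.cast_add,
      Nat.cast_one]
    ring

/-- The coefficients from the third on are determined by the diagonals of `τₙ cⱼ`. -/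
theorem eq_zero_of_diagonal (h : IsCoefficients p c)
    (hd : ∀ n j, tau ε p n (c j) = 0) (i : ℕ) : c (i + 3) = 0 := by
  have := h.tau_eq 0 i
  rw [hd] at this
  refine (isUnit_algebraMap (ε := ε) (z := (i : ℝ) + 1 - (0 : ℕ)) ?_).mul_right_eq_zero.1 this.symm
  have : (0 : ℝ) ≤ i := Nat.cast_nonneg i
  push_cast
  linarith

/-- τ_n kills c₀ and c₁ for all large n, and the recursion carries this along the diagonals j - n =
const that start there. -/
theorem exists_diagonal_eq_zero (h : IsCoefficients p c) :
    ∃ e₀ : ℤ, ∀ n j : ℕ, (j : ℤ) - n ≤ e₀ → tau ε p n (c j) = 0 := by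
  obtain ⟨N, hN⟩ := exists_tau_eq_zero (p := p) (c 0)
  obtain ⟨M, hM⟩ := exists_tau_eq_zero (p := p) (c 1)
  refine ⟨-N - M, fun n j => ?_⟩
  induction j using Nat.strong_induction_on generalizing n with
  | _ j ih =>
  intro hj
  rcases j with _ | _ | j
  · exact hN n (by omega)
  · exact hM n (by omega)
  · obtain ⟨n, rfl⟩ : ∃ m, n = m + 2 := ⟨n - 2, by omega⟩
    rw [h.tau_add_two, ih j (by omega) n (by push_cast at hj; omega),
      ih (j + 1) (by omega) (n + 1) (by push_cast at hj ⊢; omega)]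
    ring

/-- On the first nonzero diagonal the values are constant. -/
theorem tau_tau_eq_zero (h : IsCoefficients p c) {e : ℤ}
    (he : ∀ n j : ℕ, (j : ℤ) - n < e → tau ε p n (c j) = 0) (r n j : ℕ) (hj : (j : ℤ) - n = e) :
    tau ε p r (tau ε p n (c j)) = 0 := by
  refine diagonal_eq_zero (T := fun n j => tau ε p r (tau ε p n (c j))) (e := e) ?_
    (r + 4 + e.natAbs) ?_ n j hj
  · intro n j _
    simp [h.tau_add_two, Derivation.leibniz, derivation_two]
  · intro n j hj hn
    obtain ⟨i, rfl⟩ : ∃ i, j = i + 3 + r + 1 := ⟨j - r - 4, by omega⟩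
    -- Both terms lie on lower diagonals: τ_r turns c_{i+r+4} into a multiple of c_{i+3}, and
    -- τ_{n+r+1} lowers j - n by r + 1.
    rw [tau_tau, h.tau_eq, Derivation.leibniz, he _ _ (by push_cast at hj ⊢; omega),
      he _ _ (by push_cast at hj ⊢; omega)]
    simp

theorem diagonal_constant (h : IsCoefficients p c) (hp : p ≠ 1) {e : ℤ}
    (he : ∀ n j : ℕ, (j : ℤ) - n < e → tau ε p n (c j) = 0) (n j : ℕ)
    (hj : ((j + 3 : ℕ) : ℤ) - n = e) : ∃ z : ℝ, tau ε p n (c (j + 3)) = algebraMap ℝ _ z := by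
  refine eq_algebraMap_of_base hp ((h.base _).tau n) ?_ ?_ fun r => h.tau_tau_eq_zero he r n _ hj
  · rw [pd_tau_comm (by simp) (by simp), h.pd_x_eq_zero, map_zero]
  · rw [pd_tau_comm (by simp) (by simp), h.pd_u, map_zero]

/-- The weight of `τₙ cⱼ`. -/
theorem euler_tau_coefficient {κ : ℝ} (n j : ℕ)
    (hw : euler ε (c j) = algebraMap ℝ _ ((j : ℝ) - 1 + κ) * c j) :
    euler ε (tau ε p n (c j)) = algebraMap ℝ _ ((j - n : ℤ) - 2 + κ) * tau ε p n (c j) := by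
  rw [euler_tau, hw, Derivation.leibniz, Derivation.map_algebraMap, smul_zero, add_zero,
    smul_eq_mul]
  push_cast
  simp only [map_ofNat]
  ring

/-- The first nonzero diagonal consists of constants, which have weight zero, while τ_n c_j has
weight j - n - 2 + κ. -/
theorem diagonal_eq_zero_of_weight (h : IsCoefficients p c) (hp : p ≠ 1) {κ : ℝ}
    (hw : ∀ j, euler ε (c (j + 2)) = algebraMap ℝ _ (((j + 2 : ℕ) : ℝ) - 1 + κ) * c (j + 2)) {e : ℤ}
    (hκ : (e : ℝ) - 2 + κ ≠ 0) (he : ∀ n j : ℕ, (j : ℤ) - n < e → tau ε p n (c j) = 0) (n j : ℕ)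
    (hj : (j : ℤ) - n = e) : tau ε p n (c j) = 0 := by
  refine diagonal_eq_zero (T := fun n j => tau ε p n (c j)) (e := e)
    (fun n j _ => h.tau_add_two j n) (3 + e.natAbs) (fun n j hj hn => ?_) n j hj
  obtain ⟨j, rfl⟩ : ∃ i, j = i + 3 := ⟨j - 3, by omega⟩
  obtain ⟨z, hz⟩ := h.diagonal_constant hp he n j hj
  have := euler_tau_coefficient (p := p) n (j + 3) (hw (j + 1))
  rw [hj, hz, Derivation.map_algebraMap, ← hz] at this
  exact (isUnit_algebraMap (ε := ε) hκ).mul_right_eq_zero.1 this.symm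

/-- The diagonal of weight zero. -/
theorem diagonal_linear (h : IsCoefficients p c) {e : ℤ} {n r i j : ℕ} {z w s : ℝ}
    (hi : ((i + 3 : ℕ) : ℤ) - n = e) (hj : ((j + 3 : ℕ) : ℤ) - r = e)
    (hz : tau ε p n (c (i + 3)) = algebraMap ℝ _ z) (hw : tau ε p r (c (j + 3)) = algebraMap ℝ _ w)
    (hs : tau ε p (n + r + 1) (c (i + 3 + r + 1)) = algebraMap ℝ _ s) :
    algebraMap ℝ (Fun ε) (((j : ℝ) + 1 - n) * w) =
      algebraMap ℝ (Fun ε) (((i : ℝ) + 1 - r) * z + (r - n) * s) := by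
  -- On c_{i+r+4} both products of τ_r and τ_n, and their commutator, reduce by `tau_eq` to values
  -- on this one diagonal.
  have h1 := tau_tau (ε := ε) (p := p) r n (c (i + 3 + r + 1))
  rw [h.tau_eq, show i + 3 + r + 1 = j + 3 + n + 1 by omega, h.tau_eq, Derivation.leibniz,
    Derivation.leibniz, Derivation.map_algebraMap, Derivation.map_algebraMap, hz, hw,
    show j + 3 + n + 1 = i + 3 + r + 1 by omega, hs] at h1
  simp only [mul_zero, add_zero, smul_eq_mul] at h1
  rw [map_mul, h1, map_add, map_mul, map_mul]

theorem diagonals_eq_zero (h : IsCoefficients p c) (hp : p ≠ 1) {κ : ℝ}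
    (hw : ∀ j, euler ε (c (j + 2)) = algebraMap ℝ _ (((j + 2 : ℕ) : ℝ) - 1 + κ) * c (j + 2))
    {e₁ e : ℤ} (h₁ : ∀ n j : ℕ, (j : ℤ) - n ≤ e₁ → tau ε p n (c j) = 0)
    (hκ : ∀ e' : ℤ, e₁ < e' → e' < e → (e' : ℝ) - 2 + κ ≠ 0) (n j : ℕ) (hj : (j : ℤ) - n < e) :
    tau ε p n (c j) = 0 := by
  have key : ∀ k : ℕ, e₁ + k < e → ∀ n j : ℕ, (j : ℤ) - n ≤ e₁ + k → tau ε p n (c j) = 0 := by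
    intro k
    induction k with
    | zero => exact fun _ n j hj => h₁ n j (by simpa using hj)
    | succ k ih =>
      intro hk n j hj
      push_cast at hk hj
      rcases hj.lt_or_eq with hj | hj
      · exact ih (by omega) n j (by omega)
      · refine h.diagonal_eq_zero_of_weight hp hw (hκ (e₁ + (k + 1)) (by omega) (by omega)) ?_ n j hj
        exact fun n j hj => ih (by omega) n j (by omega)
  rcases le_or_gt ((j : ℤ) - n) e₁ with h | h
  · exact h₁ n j h
  · exact key ((j : ℤ) - n - e₁).toNat (by omega) n j (by omega)

theorem eq_zero_of_weight (h : IsCoefficients p c) (hp : p ≠ 1) {κ : ℝ}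
    (hw : ∀ j, euler ε (c (j + 2)) = algebraMap ℝ _ (((j + 2 : ℕ) : ℝ) - 1 + κ) * c (j + 2))
    (hκ : ∀ e : ℤ, (e : ℝ) - 2 + κ ≠ 0) (i : ℕ) : c (i + 3) = 0 := by
  obtain ⟨e₁, h₁⟩ := h.exists_diagonal_eq_zero
  exact h.eq_zero_of_diagonal (fun n j => h.diagonals_eq_zero hp hw (e := (j : ℤ) - n + 1) h₁
    (fun e' _ _ => hκ e') n j (by omega)) i

/-- On the critical diagonal the values are constants in arithmetic progression. With difference
zero they all equal some z, and `diagonal_linear` for two neighbours gives z = 0. All higher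
diagonals then vanish by weight. -/
theorem eq_zero_of_difference (h : IsCoefficients p c) (hp : p ≠ 1) {e : ℤ}
    (hw : ∀ j, euler ε (c (j + 2)) = algebraMap ℝ _ (((j + 2 : ℕ) : ℝ) - 1 + (2 - e)) * c (j + 2))
    {n i : ℕ} (hi : ((i + 3 : ℕ) : ℤ) - n = e)
    (hd : tau ε p (n + 1) (c (i + 4)) = tau ε p n (c (i + 3))) (k : ℕ) : c (k + 3) = 0 := by
  obtain ⟨e₁, h₁⟩ := h.exists_diagonal_eq_zero
  have hlt := fun n j => h.diagonals_eq_zero hp hw (e := e) h₁ (fun e' _ he' => by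
    have : (e' : ℝ) < e := by exact_mod_cast he'
    intro h0
    linarith) n j
  obtain ⟨z, hz⟩ := h.diagonal_constant hp hlt n i hi
  have hall : ∀ t, tau ε p (n + t) (c (i + 3 + t)) = algebraMap ℝ _ z ∧
      tau ε p (n + t + 1) (c (i + 3 + t + 1)) = algebraMap ℝ _ z := by
    intro t
    induction t with
    | zero => exact ⟨hz, hd.trans hz⟩
    | succ t ih =>
      refine ⟨ih.2, ?_⟩
      rw [show n + (t + 1) + 1 = n + t + 2 by ring, show i + 3 + (t + 1) + 1 = i + 3 + t + 2 by ring,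
        h.tau_add_two, ih.1, ih.2]
      ring
  have hz0 : algebraMap ℝ (Fun ε) z = 0 := by
    have hs := (hall (n + 2)).1
    have hr : tau ε p (n + 1) (c (i + 1 + 3)) = algebraMap ℝ _ z := hd.trans hz
    have := h.diagonal_linear (r := n + 1) (j := i + 1) hi (by push_cast at hi ⊢; omega) hz hr
      (by rw [← hs]; rfl)
    rw [← sub_eq_zero, ← map_sub] at this
    rw [← this]
    congr 1
    push_cast
    ring
  rw [hz0] at hall
  have he : ∀ n j : ℕ, (j : ℤ) - n = e → tau ε p n (c j) = 0 := by
    refine diagonal_eq_zero (T := fun n j => tau ε p n (c j)) (e := e)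
      (fun n j _ => h.tau_add_two j n) n fun m j hj hm => ?_
    obtain ⟨t, rfl⟩ := Nat.exists_eq_add_of_le hm
    have := (hall t).1
    rwa [show i + 3 + t = j by push_cast at hi hj; omega] at this
  refine h.eq_zero_of_diagonal (fun n j => h.diagonals_eq_zero hp hw (e₁ := e)
    (e := (j : ℤ) - n + 1) ?_ ?_ n j (by omega)) k
  · intro n j hj
    rcases hj.lt_or_eq with hj | hj
    · exact hlt n j hj
    · exact he n j hj
  · intro e' he' _
    have : (e : ℝ) < e' := by exact_mod_cast he'
    intro h0
    linarith

/-- The coefficients of given weight are determined up to a factor. -/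
theorem proportional {c' : ℕ → Fun ε} (h : IsCoefficients p c) (h' : IsCoefficients p c')
    (hp : p ≠ 1) {e : ℤ}
    (hw : ∀ j, euler ε (c (j + 2)) = algebraMap ℝ _ (((j + 2 : ℕ) : ℝ) - 1 + (2 - e)) * c (j + 2))
    (hw' : ∀ j, euler ε (c' (j + 2)) =
      algebraMap ℝ _ (((j + 2 : ℕ) : ℝ) - 1 + (2 - e)) * c' (j + 2))
    (hne : ∃ i, c' (i + 3) ≠ 0) : ∃ t : ℝ, ∀ i, c (i + 3) = algebraMap ℝ _ t * c' (i + 3) := by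
  obtain ⟨n, i, hi⟩ : ∃ n i : ℕ, ((i + 3 : ℕ) : ℤ) - n = e :=
    ⟨(3 - e).toNat, (e - 3).toNat, by push_cast; omega⟩
  have key : ∀ {c : ℕ → Fun ε}, IsCoefficients p c → (∀ j, euler ε (c (j + 2)) =
      algebraMap ℝ _ (((j + 2 : ℕ) : ℝ) - 1 + (2 - e)) * c (j + 2)) →
      ∃ Y : ℝ, tau ε p (n + 1) (c (i + 4)) - tau ε p n (c (i + 3)) = algebraMap ℝ _ Y := by
    intro c h hw
    obtain ⟨e₁, h₁⟩ := h.exists_diagonal_eq_zero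
    have hlt := fun n j => h.diagonals_eq_zero hp hw (e := e) h₁ (fun e' _ he' => by
      have : (e' : ℝ) < e := by exact_mod_cast he'
      intro h0
      linarith) n j
    obtain ⟨z, hz⟩ := h.diagonal_constant hp hlt n i hi
    obtain ⟨w, hw⟩ := h.diagonal_constant hp hlt (n + 1) (i + 1) (by push_cast at hi ⊢; omega)
    exact ⟨w - z, by rw [hz, hw, map_sub]⟩
  obtain ⟨Y, hY⟩ := key h hw
  obtain ⟨Y', hY'⟩ := key h' hw'
  have hne' : Y' ≠ 0 := by
    rintro rfl
    obtain ⟨k, hk⟩ := hne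
    rw [map_zero, sub_eq_zero] at hY'
    exact hk (h'.eq_zero_of_difference hp hw' hi hY' k)
  -- This multiple cancels the common difference on the critical diagonal.
  refine ⟨Y / Y', fun k => sub_eq_zero.1 ?_⟩
  refine (h.sub_smul h' (Y / Y')).eq_zero_of_difference hp (e := e) (fun j => ?_) hi ?_ k
  · rw [map_sub, Derivation.leibniz, hw, hw', Derivation.map_algebraMap, smul_zero, add_zero,
      smul_eq_mul]
    ring
  · simp only [map_sub, Derivation.leibniz, Derivation.map_algebraMap,
      smul_eq_mul]
    have e1 : algebraMap ℝ (Fun ε) Y = algebraMap ℝ _ (Y / Y') * algebraMap ℝ _ Y' := by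
      rw [← map_mul, div_mul_cancel₀ _ hne']
    linear_combination hY - algebraMap ℝ (Fun ε) (Y / Y') * hY' + e1

/-- The coefficients if all but the first three vanish. -/
theorem exists_eq_of_eq_zero (h : IsCoefficients p c) (hp : p ≠ 1) (h0 : ∀ i, c (i + 3) = 0) :
    c 2 = 0 ∧ ∃ a b : ℝ, c 1 = algebraMap ℝ _ a ∧
      c 0 = algebraMap ℝ _ a * coord ε (u 0) + algebraMap ℝ _ b * expNeg ε := by
  have e0 := h.pd_x 0
  have e1 := h.tau_zero 1
  have e2 := h.tau_one 1
  have e3 := h.tau_add_two 1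
  have e4 := h.tau_one 2
  have e5 := h.tau_add_two 2
  have f1 := h.tau_zero 0
  have f2 := h.tau_one 0
  have f3 := h.tau_add_two 0
  have hu2 := h.pd_u 0
  have h3 := h0 0
  have h4 := h0 1
  simp only [Nat.reduceAdd, zero_add] at *
  simp only [h3, h4, map_zero, hu2, mul_zero, sub_zero, add_zero, zero_add, zero_sub,
    Nat.cast_one, Nat.cast_ofNat, Nat.cast_zero, sub_self, zero_mul, map_one, one_mul]
    at e0 e1 e2 e3 e4 e5 f1 f2 f3
  have ht2 : ∀ n, tau ε p n (c 2) = 0 := fun n => by linear_combination e5 n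
  simp only [ht2, mul_zero, zero_sub, zero_add] at e2 e3 f1 f2 f3
  have ht1 : ∀ n, tau ε p n (c 1) = 0 := fun n => by linear_combination e3 n
  simp only [ht1, mul_zero, zero_sub, zero_add] at f2 f3
  have ht0 : ∀ n, tau ε p n (c 0) = 0 := fun n => by linear_combination f3 n
  -- The relations reduce to ∂c₂/∂x = c₂, ∂c₂/∂x = 2 ∂c₁/∂u and ∂c₁/∂u = 2 ∂c₂/∂x, whence 3c₂ = 0.
  have hc2 : c 2 = 0 := by
    have h1 : pd ε x (c 2) = c 2 := by
      have : algebraMap ℝ (Fun ε) (1 - 2) = -1 := by norm_num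
      rw [this] at e4
      linear_combination -e4
    have h3 : (3 : Fun ε) * c 2 = 0 := by linear_combination -e0 + h1 + 2 * e1 - 4 * h1
    have := natCast_mul_eq_zero (n := 3) (by norm_num) (a := c 2) (by exact_mod_cast h3)
    exact this
  rw [hc2] at e0 e1
  simp only [map_zero, mul_zero, zero_add] at e0 e1
  have hu1 : pd ε (u 0) (c 1) = 0 := e1.symm
  have hx1 : pd ε x (c 1) = 0 := by rw [hu1] at e2; linear_combination -e2
  obtain ⟨a, ha⟩ := eq_algebraMap_of_base hp (h.base 1) hx1 hu1 ht1
  rw [hu1, hx1] at f1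
  have hu0 : pd ε (u 0) (c 0) = c 1 := by linear_combination -f1
  have hx0 : pd ε x (c 0) = coord ε (u 0) * c 1 - c 0 := by rw [hu0] at f2; linear_combination -f2
  have hE : ∀ e, pd ε e (expPos ε) * expNeg ε = -(pd ε e (expNeg ε)) * expPos ε := fun e => by
    have := congrArg (pd ε e) (expNeg_mul_expPos (ε := ε))
    rw [Derivation.leibniz, Derivation.map_one_eq_zero, smul_eq_mul, smul_eq_mul] at this
    linear_combination this
  have hm := expNeg_mul_expPos (ε := ε)
  have hpos : ∀ D : Derivation ℝ (Fun ε) (Fun ε), D (expPos ε) = D (coord ε x) * expPos ε := by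
    intro D
    have := congrArg D hm
    rw [Derivation.leibniz, Derivation.map_one_eq_zero, smul_eq_mul, smul_eq_mul,
      derivation_expNeg] at this
    linear_combination expPos ε * this + (-D (expPos ε) + expPos ε * D (coord ε x)) * hm
  -- The function c₀ - a u satisfies ∂f/∂x = -f, so its product with eˣ is constant.
  obtain ⟨b, hb⟩ := eq_algebraMap_of_base hp (G := expPos ε * (c 0 - algebraMap ℝ _ a * coord ε (u 0)))
    (Base.mul (fun k => by simp [hpos, pd_coord])
      ((h.base 0).sub ((base_algebraMap a).mul base_u)))
    (by
      simp only [Derivation.leibniz, map_sub, hpos, pd_coord, hx0, ha, Derivation.map_algebraMap,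
        smul_eq_mul]
      simp
      ring)
    (by
      simp only [Derivation.leibniz, map_sub, hpos, pd_coord, hu0, ha, Derivation.map_algebraMap,
        smul_eq_mul]
      simp)
    (fun n => by
      simp only [Derivation.leibniz, map_sub, hpos, tau_x, tau_u, ht0, Derivation.map_algebraMap,
        smul_eq_mul]
      simp)
  refine ⟨hc2, a, b, ha, ?_⟩
  linear_combination expNeg ε * hb - (c 0 - algebraMap ℝ _ a * coord ε (u 0)) * hm

end IsCoefficients

end UHEReduction

namespace UHEReduction

variable {ε : ℤˣ} {p : ℤ}

open Coord (x y u v q)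
open PowerSeries

/-! ### Derivations of power series -/

section

variable {A : Type} [CommRing A] [Algebra ℝ A]

/-- The derivation of power series that acts on the coefficients. -/
def hat (D : Derivation ℝ A A) : Derivation ℝ A⟦X⟧ A⟦X⟧ :=
  Derivation.mk'
    { toFun := fun f => PowerSeries.mk fun n => D (coeff n f)
      map_add' := fun f g => by ext n; simp
      map_smul' := fun r f => by ext n; simp }
    (fun f g => by
      ext n
      simp only [LinearMap.coe_mk, AddHom.coe_mk, coeff_mk, smul_eq_mul, coeff_mul, map_sum,
        Derivation.leibniz, map_add, Finset.sum_add_distrib]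
      congr 1
      exact Finset.Nat.sum_antidiagonal_swap (f := fun x => coeff x.1 g * D (coeff x.2 f)))

@[simp] theorem coeff_hat (D : Derivation ℝ A A) (n : ℕ) (f : A⟦X⟧) :
    coeff n (hat D f) = D (coeff n f) := by
  simp [hat]

@[simp] theorem constantCoeff_hat (D : Derivation ℝ A A) (f : A⟦X⟧) :
    constantCoeff (hat D f) = D (constantCoeff f) := by
  rw [← coeff_zero_eq_constantCoeff_apply, coeff_hat, coeff_zero_eq_constantCoeff_apply]

@[simp] theorem hat_X (D : Derivation ℝ A A) : hat D X = 0 := by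
  ext n
  rw [coeff_hat, coeff_X]
  split_ifs <;> simp

@[simp] theorem hat_C (D : Derivation ℝ A A) (a : A) : hat D (C a) = C (D a) := by
  ext n
  rw [coeff_hat, coeff_C, coeff_C]
  split_ifs <;> simp

/-- The derivative of power series, as a derivation over `ℝ`. -/
def ddX (A : Type) [CommRing A] [Algebra ℝ A] : Derivation ℝ A⟦X⟧ A⟦X⟧ :=
  (PowerSeries.derivative A).restrictScalars ℝ

@[simp] theorem coeff_ddX (n : ℕ) (f : A⟦X⟧) : coeff n (ddX A f) = coeff (n + 1) f * (n + 1) :=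
  coeff_derivative f n

@[simp] theorem ddX_X : ddX A X = 1 := derivative_X

@[simp] theorem ddX_C (a : A) : ddX A (C a) = 0 := derivative_C

theorem coeff_X_mul_ddX (n : ℕ) (f : A⟦X⟧) : coeff n (X * ddX A f) = (n : A) * coeff n f := by
  rcases n with _ | n
  · simp
  · rw [coeff_succ_X_mul, coeff_ddX]
    push_cast
    ring

theorem hat_ddX (D : Derivation ℝ A A) (f : A⟦X⟧) : hat D (ddX A f) = ddX A (hat D f) := by
  ext n
  simp only [coeff_hat, coeff_ddX, Derivation.leibniz, map_add, Derivation.map_natCast,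
    Derivation.map_one_eq_zero, add_zero, smul_eq_mul]
  ring

theorem hat_lie (D D' : Derivation ℝ A A) (f : A⟦X⟧) :
    hat ⁅D, D'⁆ f = hat D (hat D' f) - hat D' (hat D f) := by
  ext n
  simp [Derivation.commutator_apply]

theorem coeff_algebraMap_mul (z : ℝ) (n : ℕ) (f : A⟦X⟧) :
    coeff n (algebraMap ℝ A⟦X⟧ z * f) = algebraMap ℝ A z * coeff n f := by
  rw [PowerSeries.algebraMap_apply, coeff_C_mul]

end

/-! ### The generating series of the nonlocal variables -/

/-- The generating series of the nonlocal variables. -/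
def rho (ε : ℤˣ) (p : ℤ) : (Fun ε)⟦X⟧ := PowerSeries.mk (Q ε p)

/-- The series `(p - 1) ρ + λ ρ'`. -/
def rhoH (ε : ℤˣ) (p : ℤ) : (Fun ε)⟦X⟧ :=
  algebraMap ℝ _ ((p : ℝ) - 1) * rho ε p + X * ddX _ (rho ε p)

/-- The polynomial `u_y + (u_x + u) λ - λ²`. -/
def disc (ε : ℤˣ) : (Fun ε)⟦X⟧ := C (coord ε (v 0)) + C (sFun ε) * X - X ^ 2

theorem coeff_rhoH (n : ℕ) :
    coeff n (rhoH ε p) = algebraMap ℝ _ ((p : ℝ) - 1 + n) * Q ε p n := by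
  rw [rhoH, map_add, coeff_algebraMap_mul, coeff_X_mul_ddX, rho, coeff_mk, map_add, map_natCast]
  ring

theorem isUnit_v_zero : IsUnit (coord ε (v 0)) :=
  IsUnit.of_mul_eq_one (invUy ε) (by rw [mul_comm]; exact invUy_mul)

theorem isUnit_disc : IsUnit (disc ε) := by
  rw [isUnit_iff_constantCoeff]
  simpa [disc] using isUnit_v_zero

theorem isUnit_rhoH (hp : p ≠ 1) : IsUnit (rhoH ε p) := by
  rw [isUnit_iff_constantCoeff, ← coeff_zero_eq_constantCoeff_apply, coeff_rhoH]
  simpa [Q] using isUnit_algebraMap (ε := ε) (z := (p : ℝ) - 1)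
    (sub_ne_zero.2 fun h => hp (by exact_mod_cast h))

theorem X_mul_cancel' {A : Type} [CommRing A] {f g : A⟦X⟧} (h : X * f = X * g) : f = g :=
  X_mul_cancel h

/-- The relations q_{i,x} = q_{i-1,y}/u_y for all i form one equation for ρ; the recursion for
q_{i,y} becomes `rho_X₁`. Solving both for the derivatives of ρ produces the denominator `disc`. -/
theorem rho_X₂ : C (coord ε (v 0)) * hat (Dx ε p) (rho ε p) = X * hat (Dy ε p) (rho ε p) := by
  ext n
  rw [coeff_C_mul]
  rcases n with _ | n
  · simp [rho, Dx_Q_zero]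
  · rw [coeff_succ_X_mul, coeff_hat, coeff_hat, rho, coeff_mk, coeff_mk, Dx_Q, Dy_Q]
    linear_combination Qy ε p n * invUy_mul (ε := ε)

theorem rho_X₁ : hat (Dy ε p) (rho ε p) + (C (sFun ε) - X) * hat (Dx ε p) (rho ε p) +
    X * rhoH ε p = 0 := by
  ext n
  rw [sub_mul, map_add, map_add, map_sub, coeff_C_mul]
  rcases n with _ | _ | n
  · simp [rho, Dx_Q_zero, Dy_Q, Qy]
  · rw [coeff_succ_X_mul, coeff_succ_X_mul, coeff_rhoH]
    simp [rho, Q, Algebra.smul_def]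
  · rw [coeff_succ_X_mul, coeff_succ_X_mul, coeff_rhoH]
    simp only [coeff_hat, rho, coeff_mk, Dx_Q, Dy_Q, Qy_succ_succ, map_zero]
    simp only [map_sub, map_add, map_neg, map_one, map_natCast, Nat.cast_add, Nat.cast_one]
    ring

theorem disc_mul_Dx_rho : disc ε * hat (Dx ε p) (rho ε p) = -X ^ 2 * rhoH ε p := by
  rw [disc]
  linear_combination X * rho_X₁ (ε := ε) (p := p) + rho_X₂ (ε := ε) (p := p)

theorem disc_mul_Dy_rho : disc ε * hat (Dy ε p) (rho ε p) =
    -C (coord ε (v 0)) * X * rhoH ε p := by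
  refine X_mul_cancel' ?_
  linear_combination C (coord ε (v 0)) * disc_mul_Dx_rho (ε := ε) (p := p) -
    disc ε * rho_X₂ (ε := ε) (p := p)

/-- The derivation `u_y D_x - λ D_y`. -/
def X₂ (ε : ℤˣ) (p : ℤ) : Derivation ℝ (Fun ε)⟦X⟧ (Fun ε)⟦X⟧ :=
  C (coord ε (v 0)) • hat (Dx ε p) - (X : (Fun ε)⟦X⟧) • hat (Dy ε p)

/-- The derivation `D_y + (u_x + u - λ) D_x + λ² d/dλ`. -/
def X₁ (ε : ℤˣ) (p : ℤ) : Derivation ℝ (Fun ε)⟦X⟧ (Fun ε)⟦X⟧ :=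
  hat (Dy ε p) + (C (sFun ε) - X) • hat (Dx ε p) + (X ^ 2 : (Fun ε)⟦X⟧) • ddX _

theorem X₂_apply (f : (Fun ε)⟦X⟧) : X₂ ε p f =
    C (coord ε (v 0)) * hat (Dx ε p) f - X * hat (Dy ε p) f := rfl

theorem X₁_apply (f : (Fun ε)⟦X⟧) : X₁ ε p f =
    hat (Dy ε p) f + (C (sFun ε) - X) * hat (Dx ε p) f + X ^ 2 * ddX _ f := rfl

@[simp] theorem X₂_X : X₂ ε p X = 0 := by simp [X₂_apply]

@[simp] theorem X₁_X : X₁ ε p X = X ^ 2 := by simp [X₁_apply]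

theorem X₂_rho : X₂ ε p (rho ε p) = 0 := by rw [X₂_apply, rho_X₂, sub_self]

theorem X₁_rho : X₁ ε p (rho ε p) = -algebraMap ℝ _ ((p : ℝ) - 1) * X * rho ε p := by
  have := rho_X₁ (ε := ε) (p := p)
  rw [X₁_apply]
  rw [rhoH] at this
  linear_combination this

theorem X₂_disc : X₂ ε p (disc ε) = C (coord ε (v 1)) * disc ε - X ^ 2 * C (coord ε (v 0)) := by
  simp only [X₂_apply, disc, map_add, map_sub, Derivation.leibniz, Derivation.leibniz_pow, hat_C,
    hat_X, Dx_v, Dy_v_zero, Dx_sFun, Dy_sFun, smul_eq_mul, map_mul]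
  simp
  ring

theorem X₁_disc : X₁ ε p (disc ε) = (C (sxFun ε) + X) * disc ε - X ^ 3 := by
  simp only [X₁_apply, disc, map_add, map_sub, Derivation.leibniz, Derivation.leibniz_pow, hat_C,
    hat_X, Dx_v, Dy_v_zero, Dx_sFun, Dy_sFun, smul_eq_mul, map_mul, ddX_C, ddX_X]
  simp
  ring

theorem X₂_rhoH : disc ε * X₂ ε p (rhoH ε p) = -C (coord ε (v 0)) * X ^ 2 * rhoH ε p := by
  have h := congrArg (ddX _) (X₂_rho (ε := ε) (p := p))
  simp only [X₂_apply, map_sub, Derivation.leibniz, ddX_C, ddX_X, ← hat_ddX, smul_eq_mul,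
    map_zero] at h
  have h2 : X₂ ε p (ddX _ (rho ε p)) = hat (Dy ε p) (rho ε p) := by
    rw [X₂_apply]
    linear_combination h
  have h3 := disc_mul_Dy_rho (ε := ε) (p := p)
  nth_rw 1 [rhoH]
  rw [map_add, Derivation.leibniz, Derivation.leibniz, X₂_rho, h2, X₂_X,
    Derivation.map_algebraMap]
  simp only [smul_eq_mul, mul_zero, add_zero, zero_add]
  linear_combination X * h3

theorem X₁_rhoH : disc ε * X₁ ε p (rhoH ε p) =
    -algebraMap ℝ _ (p : ℝ) * X * disc ε * rhoH ε p - X ^ 3 * rhoH ε p := by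
  have h := congrArg (ddX _) (X₁_rho (ε := ε) (p := p))
  simp only [X₁_apply, map_sub, map_add, map_neg, Derivation.leibniz, Derivation.leibniz_pow,
    Derivation.map_algebraMap, ddX_C, ddX_X, ← hat_ddX, smul_eq_mul, nsmul_eq_mul] at h
  have h2 : X₁ ε p (ddX _ (rho ε p)) = -algebraMap ℝ _ ((p : ℝ) - 1) * rho ε p -
      algebraMap ℝ _ ((p : ℝ) - 1) * X * ddX _ (rho ε p) + hat (Dx ε p) (rho ε p) -
      2 * X * ddX _ (rho ε p) := by
    rw [X₁_apply, map_sub, map_one]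
    push_cast at h
    linear_combination h
  have h3 := disc_mul_Dx_rho (ε := ε) (p := p)
  have h4 : X₁ ε p (rhoH ε p) = -algebraMap ℝ _ (p : ℝ) * X * rhoH ε p +
      X * hat (Dx ε p) (rho ε p) := by
    rw [rhoH, map_add, Derivation.leibniz, Derivation.leibniz, X₁_rho, h2, X₁_X,
      Derivation.map_algebraMap]
    simp only [smul_eq_mul, mul_zero, add_zero, map_sub, map_one]
    ring
  linear_combination disc ε * h4 + X * h3

/-! ### Chains and symmetries -/

/-- In the generating series, P₀ affects only the constant terms, so a chain is a solution of two
first-order linear equations with inhomogeneity free of λ. -/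
theorem isChain_iff {P : ℕ → Fun ε} {π : (Fun ε)⟦X⟧} (hπ : π = PowerSeries.mk fun i => P (i + 1)) :
    IsChain p P ↔ X₂ ε p π = C (coord ε (v 1)) * π + C (Dy ε p (P 0)) ∧
      X₁ ε p π = C (sxFun ε) * π + C (Dx ε p (P 0) + P 0) := by
  have hc : ∀ n, coeff n π = P (n + 1) := fun n => by rw [hπ, coeff_mk]
  have e2 : ∀ n, coeff (n + 1) (X₂ ε p π) =
      coord ε (v 0) * Dx ε p (P (n + 2)) - Dy ε p (P (n + 1)) := fun n => by
    rw [X₂_apply, map_sub, coeff_C_mul, coeff_succ_X_mul, coeff_hat, coeff_hat, hc, hc]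
  have e1 : ∀ n, coeff (n + 1) (X₁ ε p π) = Dy ε p (P (n + 2)) + sFun ε * Dx ε p (P (n + 2)) -
      Dx ε p (P (n + 1)) + n * P (n + 1) := fun n => by
    rw [X₁_apply, sub_mul, map_add, map_add, map_sub, coeff_C_mul, coeff_succ_X_mul, pow_two,
      mul_assoc, coeff_succ_X_mul, coeff_X_mul_ddX, coeff_hat, coeff_hat, coeff_hat, hc, hc]
    ring
  constructor
  · intro h
    constructor
    · ext n
      rcases n with _ | n
      · have := h.first 0
        simp [X₂_apply, hπ] at this ⊢
        linear_combination this
      · rw [e2, map_add, coeff_C_mul, hc, coeff_C, if_neg (by omega)]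
        linear_combination h.first (n + 1)
    · ext n
      rcases n with _ | n
      · have := h.second 0
        simp [X₁_apply, hπ] at this ⊢
        linear_combination this
      · rw [e1, map_add, coeff_C_mul, hc, coeff_C, if_neg (by omega)]
        have := h.second (n + 1)
        simp only [map_sub, map_add, map_one, map_natCast, Nat.cast_add, Nat.cast_one] at this
        linear_combination this
  · rintro ⟨h2, h1⟩
    constructor
    · rintro (_ | n)
      · have := congrArg (coeff 0) h2
        simp [X₂_apply, hπ] at this ⊢
        linear_combination this
      · have := congrArg (coeff (n + 1)) h2
        rw [e2, map_add, coeff_C_mul, hc, coeff_C, if_neg (by omega)] at this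
        linear_combination this
    · rintro (_ | n)
      · have := congrArg (coeff 0) h1
        simp [X₁_apply, hπ] at this ⊢
        linear_combination this
      · have := congrArg (coeff (n + 1)) h1
        rw [e1, map_add, coeff_C_mul, hc, coeff_C, if_neg (by omega)] at this
        simp only [map_sub, map_add, map_one, map_natCast, Nat.cast_add, Nat.cast_one]
        linear_combination this

/-- Comparison of the equations for a chain and for the variation of the nonlocal variables. -/
theorem X₂_X₁_iff (hp : p ≠ 1) {ψ π : (Fun ε)⟦X⟧} (hψ : disc ε * ψ = X ^ 2 * π * rhoH ε p)
    (f g : Fun ε) :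
    (X₂ ε p π = C (coord ε (v 1)) * π + C f ∧ X₁ ε p π = C (sxFun ε) * π + C g) ↔
    (X₂ ε p ψ = -C f * hat (Dx ε p) (rho ε p) ∧
      X₁ ε p ψ + algebraMap ℝ _ ((p : ℝ) - 1) * X * ψ = -C g * hat (Dx ε p) (rho ε p)) := by
  have hΔ := isUnit_disc (ε := ε)
  have hH := isUnit_rhoH (ε := ε) hp
  have h2 := congrArg (X₂ ε p) hψ
  have h1 := congrArg (X₁ ε p) hψ
  simp only [Derivation.leibniz, Derivation.leibniz_pow, X₂_disc, X₁_disc, X₂_X, X₁_X,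
    smul_eq_mul, smul_zero, mul_zero, nsmul_eq_mul] at h1 h2
  have eH2 := X₂_rhoH (ε := ε) (p := p)
  have eH1 := X₁_rhoH (ε := ε) (p := p)
  -- X₂ and X₁ multiply Δ and H by factors whose parts with denominator Δ agree and cancel in H/Δ.
  -- So the equations for ψ = λ²πH/Δ are those of π times λ²H/Δ.
  have e2 : disc ε * X₂ ε p ψ = X ^ 2 * rhoH ε p * (X₂ ε p π - C (coord ε (v 1)) * π) := by
    refine hΔ.mul_left_cancel ?_
    linear_combination disc ε * h2 + X ^ 2 * π * eH2 -
      (disc ε * C (coord ε (v 1)) - X ^ 2 * C (coord ε (v 0))) * hψ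
  have e1 : disc ε * (X₁ ε p ψ + algebraMap ℝ _ ((p : ℝ) - 1) * X * ψ) =
      X ^ 2 * rhoH ε p * (X₁ ε p π - C (sxFun ε) * π) := by
    refine hΔ.mul_left_cancel ?_
    have : algebraMap ℝ (Fun ε)⟦X⟧ ((p : ℝ) - 1) = algebraMap ℝ _ (p : ℝ) - 1 := by
      rw [map_sub, map_one]
    rw [this]
    push_cast at h1
    linear_combination disc ε * h1 + X ^ 2 * π * eH1 - (disc ε * (C (sxFun ε) + X) - X ^ 3 -
      (algebraMap ℝ _ (p : ℝ) - 1) * X * disc ε) * hψ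
  have eρ := disc_mul_Dx_rho (ε := ε) (p := p)
  have hX : ∀ {a b : (Fun ε)⟦X⟧}, X ^ 2 * rhoH ε p * a = X ^ 2 * rhoH ε p * b → a = b := by
    intro a b h
    refine hH.mul_left_cancel (X_mul_cancel' (X_mul_cancel' ?_))
    linear_combination h
  constructor
  · rintro ⟨k2, k1⟩
    constructor <;> refine hΔ.mul_left_cancel ?_
    · rw [e2, k2]
      linear_combination C f * eρ
    · rw [e1, k1]
      linear_combination C g * eρ
  · rintro ⟨k2, k1⟩
    constructor
    · rw [← sub_eq_iff_eq_add']
      refine hX ?_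
      rw [← e2, k2]
      linear_combination -C f * eρ
    · rw [← sub_eq_iff_eq_add']
      refine hX ?_
      rw [← e1, k1]
      linear_combination -C g * eρ

end UHEReduction

namespace UHEReduction

variable {ε : ℤˣ} {p : ℤ}

open Coord (x y u v q)
open PowerSeries

/-! ### Symmetries and chains -/

theorem hat_comm {A : Type} [CommRing A] [Algebra ℝ A] {D D' : Derivation ℝ A A}
    (h : ∀ f, D (D' f) = D' (D f)) (f : A⟦X⟧) : hat D (hat D' f) = hat D' (hat D f) := by
  ext n
  simp only [coeff_hat, h]

theorem iterate_comm {A : Type} [CommRing A] [Algebra ℝ A] {D D' : Derivation ℝ A A}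
    (h : ∀ f, D (D' f) = D' (D f)) (k : ℕ) (f : A) : D (D'^[k] f) = D'^[k] (D f) := by
  induction k with
  | zero => rfl
  | succ k ih => rw [Function.iterate_succ_apply', h, ih, Function.iterate_succ_apply']

theorem hat_rho {S : Derivation ℝ (Fun ε) (Fun ε)} (hy : S (coord ε y) = 0) :
    hat S (rho ε p) = X ^ 2 * PowerSeries.mk fun n => S (coord ε (q n)) := by
  ext n
  rw [coeff_hat, rho, coeff_mk, pow_two, mul_assoc]
  rcases n with _ | _ | n
  · simp [Q]
  · rw [coeff_succ_X_mul]
    simp [Q, hy]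
  · rw [coeff_succ_X_mul, coeff_succ_X_mul, coeff_mk, Q_succ_succ]

theorem hat_rhoH (D : Derivation ℝ (Fun ε) (Fun ε)) : hat D (rhoH ε p) =
    algebraMap ℝ _ ((p : ℝ) - 1) * hat D (rho ε p) + X * ddX _ (hat D (rho ε p)) := by
  rw [rhoH, map_add, Derivation.leibniz, Derivation.leibniz, hat_X, hat_ddX,
    Derivation.map_algebraMap]
  simp

theorem hat_disc (D : Derivation ℝ (Fun ε) (Fun ε)) :
    hat D (disc ε) = C (D (coord ε (v 0))) + C (D (sFun ε)) * X := by
  simp only [disc, map_sub, map_add, Derivation.leibniz, Derivation.leibniz_pow, hat_C, hat_X,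
    smul_eq_mul]
  ring

section

variable {S T : Derivation ℝ (Fun ε) (Fun ε)}

theorem symmetry_u (hS : S ∈ symmetries ε p) (k : ℕ) :
    S (coord ε (u k)) = (Dx ε p)^[k] (S (coord ε (u 0))) := by
  induction k with
  | zero => rfl
  | succ k ih => rw [← Dx_u (p := p), hS.2.2.1, ih, Function.iterate_succ_apply']

theorem symmetry_v (hS : S ∈ symmetries ε p) (k : ℕ) :
    S (coord ε (v k)) = (Dx ε p)^[k] (Dy ε p (S (coord ε (u 0)))) := by
  rw [← Dy_u (p := p), hS.2.2.2, symmetry_u hS,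
    iterate_comm (D' := Dx ε p) (D := Dy ε p) fun f => (Dx_Dy_comm f).symm]

theorem symmetry_sFun (hS : S ∈ symmetries ε p) :
    S (sFun ε) = Dx ε p (S (coord ε (u 0))) + S (coord ε (u 0)) := by
  rw [sFun, map_add, symmetry_u hS 1]
  rfl

theorem symmetries_ext (hS : S ∈ symmetries ε p) (hT : T ∈ symmetries ε p)
    (hu : S (coord ε (u 0)) = T (coord ε (u 0)))
    (hq : hat S (rho ε p) = hat T (rho ε p)) : S = T := by
  refine derivation_ext fun c => ?_
  cases c with
  | x => rw [hS.1, hT.1]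
  | y => rw [hS.2.1, hT.2.1]
  | u k => rw [symmetry_u hS, symmetry_u hT, hu]
  | v k => rw [symmetry_v hS, symmetry_v hT, hu]
  | q n =>
    have := congrArg (coeff (n + 2)) hq
    rwa [coeff_hat, coeff_hat, rho, coeff_mk, Q_succ_succ] at this

/-- `P` is the chain of functions that corresponds to the field `S`. -/
structure HasChain (p : ℤ) (S : Derivation ℝ (Fun ε) (Fun ε)) (P : ℕ → Fun ε) : Prop where
  apply_u : S (coord ε (u 0)) = P 0
  disc_mul : disc ε * hat S (rho ε p) = X ^ 2 * (PowerSeries.mk fun i => P (i + 1)) * rhoH ε p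

/-- H has the invertible constant term p - 1, and S(ρ) is divisible by λ² because S kills q_{-1} = 1
and q₀, a multiple of y. -/
theorem exists_hasChain (hp : p ≠ 1) (hS : S ∈ symmetries ε p) : ∃ P, HasChain p S P := by
  have hH := isUnit_rhoH (ε := ε) hp
  let f : (Fun ε)⟦X⟧ := Ring.inverse (rhoH ε p) * disc ε *
    PowerSeries.mk fun n => S (coord ε (q n))
  refine ⟨fun | 0 => S (coord ε (u 0)) | i + 1 => coeff i f, rfl, ?_⟩
  change disc ε * hat S (rho ε p) = X ^ 2 * (PowerSeries.mk fun i => coeff i f) * rhoH ε p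
  have : (PowerSeries.mk fun i => coeff i f) = f := by ext n; rw [coeff_mk]
  rw [this, hat_rho hS.2.1]
  linear_combination (-disc ε * X ^ 2 * PowerSeries.mk fun n => S (coord ε (q n))) *
    Ring.inverse_mul_cancel _ hH

/-- S applied to the two equations of ρ gives their linearization, with inhomogeneities S(u_y) = D_y
P₀ and S(s) = D_x P₀ + P₀. -/
theorem HasChain.isChain {P : ℕ → Fun ε} (h : HasChain p S P) (hp : p ≠ 1)
    (hS : S ∈ symmetries ε p) : IsChain p P := by
  rw [isChain_iff rfl, X₂_X₁_iff hp h.disc_mul, ← h.apply_u, ← hS.2.2.2, Dy_u, ← symmetry_sFun hS]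
  have h2 := congrArg (hat S) (rho_X₂ (ε := ε) (p := p))
  have h1 := congrArg (hat S) (rho_X₁ (ε := ε) (p := p))
  simp only [map_add, map_sub, Derivation.leibniz, hat_X, hat_C, smul_eq_mul, hat_rhoH,
    hat_comm hS.2.2.1, hat_comm hS.2.2.2, map_zero, map_one] at h1 h2
  constructor
  · rw [X₂_apply]
    linear_combination h2
  · rw [X₁_apply, map_sub (algebraMap ℝ _), map_one]
    linear_combination h1

theorem HasChain.sub_smul {P P' : ℕ → Fun ε} (h : HasChain p S P) (h' : HasChain p T P') (t : ℝ) :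
    HasChain p (S - t • T) fun i => P i - algebraMap ℝ _ t * P' i where
  apply_u := by
    rw [Derivation.sub_apply, Derivation.smul_apply, h.apply_u, h'.apply_u, Algebra.smul_def]
  disc_mul := by
    have e1 : hat (S - t • T) (rho ε p) = hat S (rho ε p) - algebraMap ℝ _ t * hat T (rho ε p) := by
      ext n
      rw [map_sub, coeff_algebraMap_mul]
      simp [Algebra.smul_def]
    have e2 : (PowerSeries.mk fun i => P (i + 1) - algebraMap ℝ (Fun ε) t * P' (i + 1)) =
        (PowerSeries.mk fun i => P (i + 1)) -
          algebraMap ℝ _ t * PowerSeries.mk fun i => P' (i + 1) := by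
      ext n
      rw [map_sub, coeff_algebraMap_mul]
      simp
    rw [e1, e2]
    linear_combination h.disc_mul - algebraMap ℝ _ t * h'.disc_mul

theorem HasChain.ext {P : ℕ → Fun ε} (h : HasChain p S P) (h' : HasChain p T P)
    (hS : S ∈ symmetries ε p) (hT : T ∈ symmetries ε p) : S = T :=
  symmetries_ext hS hT (h.apply_u.trans h'.apply_u.symm)
    (isUnit_disc.mul_left_cancel (h.disc_mul.trans h'.disc_mul.symm))

end

/-- The linearized equation holds for the first member of a chain. -/
theorem IsChain.linearization {P : ℕ → Fun ε} (h : IsChain p P) :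
    Dy ε p (Dy ε p (P 0)) = Dy ε p (P 0) * sxFun ε + coord ε (v 0) * Dx ε p (Dx ε p (P 0) + P 0) -
      (Dx ε p (P 0) + P 0) * coord ε (v 1) - sFun ε * Dx ε p (Dy ε p (P 0)) := by
  have h1 := h.first 0
  have h2 := h.second 0
  -- Cross-differentiation of the two relations between P₀ and P₁ eliminates P₁.
  have hc := Dx_Dy_comm (p := p) (P 1)
  have k1 := congrArg (Dy ε p) h1
  have k2 := congrArg (Dx ε p) h2
  have k3 := congrArg (Dx ε p) h1
  have hv1 : Dy ε p (coord ε (v 1)) = Dx ε p (Dy ε p (coord ε (v 0))) := by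
    rw [← Dx_v (p := p), Dx_Dy_comm]
  simp only [map_add, Derivation.leibniz, smul_eq_mul, hv1, Dy_v_zero, Dx_v, Dx_sFun, map_sub,
    Nat.cast_zero, sub_zero, map_one, one_mul] at k1 k2 k3 h1 h2
  simp only [zero_add, Nat.reduceAdd] at *
  simp only [map_add]
  rw [hc] at k2
  linear_combination -k1 + coord ε (v 0) * k2 - sFun ε * k3 - coord ε (v 1) * h2 + sxFun ε * h1

/-- P₀ prescribes the values on the jet coordinates, and the remaining members those on the q_i.
Commutation on the q_i is the equivalence `X₂_X₁_iff`; commutation with D_y on the v_k is the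
linearized equation, a consequence of the chain relations. -/
theorem IsChain.exists_symmetry {P : ℕ → Fun ε} (h : IsChain p P) (hp : p ≠ 1) :
    ∃ S ∈ symmetries ε p, HasChain p S P := by
  have hΔ := isUnit_disc (ε := ε)
  let f : (Fun ε)⟦X⟧ := Ring.inverse (disc ε) * (PowerSeries.mk fun i => P (i + 1)) * rhoH ε p
  let S : Derivation ℝ (Fun ε) (Fun ε) := vectorField fun
    | x => 0
    | y => 0
    | u k => (Dx ε p)^[k] (P 0)
    | v k => (Dx ε p)^[k] (Dy ε p (P 0))
    | q n => coeff n f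
  have hx : S (coord ε x) = 0 := vectorField_coord _ _
  have hy : S (coord ε y) = 0 := vectorField_coord _ _
  have hu : ∀ k, S (coord ε (u k)) = (Dx ε p)^[k] (P 0) := fun k => vectorField_coord _ _
  have hv : ∀ k, S (coord ε (v k)) = (Dx ε p)^[k] (Dy ε p (P 0)) := fun k => vectorField_coord _ _
  have hq : ∀ n, S (coord ε (q n)) = coeff n f := fun n => vectorField_coord _ _
  have hv0 : S (coord ε (v 0)) = Dy ε p (P 0) := hv 0
  have hs : S (sFun ε) = Dx ε p (P 0) + P 0 := by
    rw [sFun, map_add, hu, hu]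
    rfl
  have hch : HasChain p S P := by
    refine ⟨hu 0, ?_⟩
    have : (PowerSeries.mk fun i => coeff i f) = f := by ext n; rw [coeff_mk]
    rw [hat_rho hy]
    simp only [hq]
    rw [this]
    linear_combination (X ^ 2 * (PowerSeries.mk fun i => P (i + 1)) * rhoH ε p) *
      Ring.mul_inverse_cancel _ hΔ
  obtain ⟨k2, k1⟩ := (X₂_X₁_iff hp hch.disc_mul _ _).1 ((isChain_iff rfl).1 h)
  rw [X₂_apply] at k2
  rw [X₁_apply] at k1
  have hDx : hat S (hat (Dx ε p) (rho ε p)) = hat (Dx ε p) (hat S (rho ε p)) := by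
    refine hΔ.mul_left_cancel ?_
    have e := congrArg (hat S) (disc_mul_Dx_rho (ε := ε) (p := p))
    simp only [Derivation.leibniz, Derivation.leibniz_pow, map_neg, hat_X, hat_disc, hat_rhoH, hv0,
      hs, smul_eq_mul, smul_zero, mul_zero, neg_zero, add_zero] at e
    rw [disc] at e ⊢
    linear_combination e - k2 - X * k1
  have hDy : hat S (hat (Dy ε p) (rho ε p)) = hat (Dy ε p) (hat S (rho ε p)) := by
    refine X_mul_cancel' ?_
    have e := congrArg (hat S) (rho_X₂ (ε := ε) (p := p))
    simp only [Derivation.leibniz, hat_X, hat_C, hv0, smul_eq_mul, hDx, mul_zero, add_zero] at e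
    linear_combination -e + k2
  have cx : ∀ g, S (Dx ε p g) = Dx ε p (S g) := by
    intro g
    have := derivation_comm_of_coord (D := S) (D' := Dx ε p) (D'' := 0) (fun c => ?_) g
    · rwa [Derivation.zero_apply, add_zero] at this
    rw [Derivation.zero_apply, add_zero]
    cases c with
    | x => simp [hx]
    | y => simp [hy]
    | u k => rw [Dx_u, hu, hu, Function.iterate_succ_apply']
    | v k => rw [Dx_v, hv, hv, Function.iterate_succ_apply']
    | q n =>
      have := congrArg (coeff (n + 2)) hDx
      simpa only [coeff_hat, rho, coeff_mk, Q_succ_succ] using this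
  have hrhs : S (rhs ε) = Dy ε p (Dy ε p (P 0)) := by
    have hsx : S (sxFun ε) = Dx ε p (Dx ε p (P 0) + P 0) := by rw [← Dx_sFun (p := p), cx, hs]
    have hv1 : S (coord ε (v 1)) = Dx ε p (Dy ε p (P 0)) := hv 1
    rw [h.linearization, rhs_eq]
    simp only [map_sub, Derivation.leibniz, hsx, hs, hv0, hv1, smul_eq_mul]
    ring
  refine ⟨S, ⟨hx, hy, cx, fun g => ?_⟩, hch⟩
  have := derivation_comm_of_coord (D := S) (D' := Dy ε p) (D'' := 0) (fun c => ?_) g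
  · rwa [Derivation.zero_apply, add_zero] at this
  rw [Derivation.zero_apply, add_zero]
  have hc : ∀ (k : ℕ) (f : Fun ε), Dy ε p ((Dx ε p)^[k] f) = (Dx ε p)^[k] (Dy ε p f) :=
    iterate_comm fun f => (Dx_Dy_comm f).symm
  cases c with
  | x => simp [hx]
  | y => simp [hy]
  | u k => rw [Dy_u, hv, hu, hc]
  | v k => rw [Dy_v, hv, hc, iterate_comm cx, hrhs]
  | q n =>
    have := congrArg (coeff (n + 2)) hDy
    simpa only [coeff_hat, rho, coeff_mk, Q_succ_succ] using this

end UHEReduction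

namespace UHEReduction

variable {ε : ℤˣ} {p : ℤ}

open Coord (x y u v q)
open PowerSeries

/-! ### Powers of the generating series -/

theorem isUnit_intCast {A : Type} [CommRing A] [Algebra ℝ A] {n : ℤ} (hn : n ≠ 0) :
    IsUnit (n : A) := by
  have := (isUnit_iff_ne_zero.2 (show (n : ℝ) ≠ 0 by exact_mod_cast hn)).map (algebraMap ℝ A)
  rwa [map_intCast] at this

theorem hasSubst_rho : HasSubst (rho ε p - 1) := by
  refine HasSubst.of_constantCoeff_zero' ?_
  rw [map_sub, rho, ← coeff_zero_eq_constantCoeff_apply, coeff_mk]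
  simp [Q]

/-- The real powers of the series `ρ`. -/
def rpow (ε : ℤˣ) (p : ℤ) (r : ℝ) : (Fun ε)⟦X⟧ :=
  substAlgHom (hasSubst_rho (ε := ε) (p := p)) (binomialSeries (Fun ε) r)

theorem rpow_add (r s : ℝ) : rpow ε p (r + s) = rpow ε p r * rpow ε p s := by
  rw [rpow, binomialSeries_add, map_mul, rpow, rpow]

theorem rpow_zero : rpow ε p 0 = 1 := by
  rw [rpow, binomialSeries_zero, map_one]

theorem rpow_one : rpow ε p 1 = rho ε p := by
  have h := binomialSeries_nat (R := ℝ) (A := Fun ε) 1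
  rw [Nat.cast_one, pow_one] at h
  rw [rpow, h, map_add, map_one, substAlgHom_X, add_sub_cancel]

/-- The series `W ^ k`, where `W ^ (p - 1) = ρ`. -/
def W (ε : ℤˣ) (p k : ℤ) : (Fun ε)⟦X⟧ := rpow ε p (k / (p - 1))

theorem W_add (k l : ℤ) : W ε p (k + l) = W ε p k * W ε p l := by
  rw [W, W, W, ← rpow_add, ← add_div, Int.cast_add]

theorem W_zero : W ε p 0 = 1 := by rw [W, Int.cast_zero, zero_div, rpow_zero]

theorem W_self (hp : p ≠ 1) : W ε p (p - 1) = rho ε p := by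
  rw [W, Int.cast_sub, Int.cast_one, div_self (sub_ne_zero.2 (by exact_mod_cast hp)), rpow_one]

theorem isUnit_W (k : ℤ) : IsUnit (W ε p k) :=
  IsUnit.of_mul_eq_one (W ε p (-k)) (by rw [← W_add, add_neg_cancel, W_zero])

/-- The logarithmic derivative of the powers. -/
theorem derivation_W (hp : p ≠ 1) (D : Derivation ℝ (Fun ε)⟦X⟧ (Fun ε)⟦X⟧) (k : ℤ) :
    ((p : (Fun ε)⟦X⟧) - 1) * rho ε p * D (W ε p k) = k * D (rho ε p) * W ε p k := by
  -- The logarithmic derivative is additive in k, hence k times its value at 1; k = p - 1 identifies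
  -- that value through ρ.
  let l : ℤ →+ (Fun ε)⟦X⟧ := AddMonoidHom.mk' (fun k => W ε p (-k) * D (W ε p k)) fun a b => by
    have ha : W ε p (-a) * W ε p a = 1 := by rw [← W_add, neg_add_cancel, W_zero]
    have hb : W ε p (-b) * W ε p b = 1 := by rw [← W_add, neg_add_cancel, W_zero]
    rw [neg_add, W_add, W_add, Derivation.leibniz, smul_eq_mul, smul_eq_mul]
    linear_combination W ε p (-b) * D (W ε p b) * ha + W ε p (-a) * D (W ε p a) * hb
  have hl : ∀ k, l k = k * l 1 := fun k => by
    rw [← zsmul_eq_mul, ← map_zsmul, smul_eq_mul, mul_one]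
  have hD : ∀ k, D (W ε p k) = W ε p k * l k := fun k => by
    change D (W ε p k) = W ε p k * (W ε p (-k) * D (W ε p k))
    rw [← mul_assoc, ← W_add, add_neg_cancel, W_zero, one_mul]
  have h1 := hD (p - 1)
  rw [W_self hp, hl] at h1
  rw [hD, hl, h1]
  push_cast
  ring

/-! ### The fundamental solutions -/

theorem rhoH_eq : rhoH ε p = ((p : (Fun ε)⟦X⟧) - 1) * rho ε p + X * ddX _ (rho ε p) := by
  rw [rhoH, map_sub, map_intCast, map_one]

/-- The series whose coefficients form the chains of the symmetries. -/
def fund (ε : ℤˣ) (p k : ℤ) : (Fun ε)⟦X⟧ :=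
  ((p : (Fun ε)⟦X⟧) - 1) * disc ε * W ε p (k + (p - 1)) * Ring.inverse (rhoH ε p)

theorem fund_mul (hp : p ≠ 1) (k : ℤ) : fund ε p k * rhoH ε p =
    ((p : (Fun ε)⟦X⟧) - 1) * disc ε * W ε p (k + (p - 1)) := by
  rw [fund, mul_assoc, Ring.inverse_mul_cancel _ (isUnit_rhoH hp), mul_one]

theorem fund_add (n k : ℤ) : fund ε p (n + k) = W ε p n * fund ε p k := by
  rw [fund, fund, add_assoc, W_add n]
  ring

theorem isUnit_sub_one (hp : p ≠ 1) : IsUnit ((p : (Fun ε)⟦X⟧) - 1) := by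
  have := isUnit_intCast (A := (Fun ε)⟦X⟧) (sub_ne_zero.2 hp)
  rwa [Int.cast_sub, Int.cast_one] at this

theorem isUnit_rho (hp : p ≠ 1) : IsUnit (rho ε p) := W_self (ε := ε) hp ▸ isUnit_W _

/-- All powers of W are constants of X₂, and the additional terms of X₂Δ and X₂H cancel in Δ/H. -/
theorem X₂_fund (hp : p ≠ 1) (k : ℤ) : X₂ ε p (fund ε p k) = C (coord ε (v 1)) * fund ε p k := by
  have hH := isUnit_rhoH (ε := ε) hp
  have hW : X₂ ε p (W ε p (k + (p - 1))) = 0 := by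
    have := derivation_W hp (X₂ ε p) (k + (p - 1))
    rw [X₂_rho, mul_zero, zero_mul] at this
    exact ((isUnit_sub_one hp).mul (isUnit_rho hp)).mul_right_eq_zero.1 this
  have h := congrArg (X₂ ε p) (fund_mul (ε := ε) hp k)
  simp only [Derivation.leibniz, hW, X₂_disc, map_sub, Derivation.map_intCast,
    Derivation.map_one_eq_zero, smul_eq_mul, mul_zero, add_zero, zero_add, sub_zero] at h
  refine (isUnit_disc.mul hH).mul_left_cancel ?_
  have e := fund_mul (ε := ε) hp k
  linear_combination disc ε * h - fund ε p k * X₂_rhoH (ε := ε) (p := p) -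
    (disc ε * C (coord ε (v 1)) - X ^ 2 * C (coord ε (v 0))) * e

/-- X₁ multiplies λ^{k-2} by (k - 2)λ, so λ^{k-2} times this series solves the homogeneous equations
of `isChain_iff`. -/
theorem X₁_fund (hp : p ≠ 1) (k : ℤ) : X₁ ε p (fund ε p k) =
    (C (sxFun ε) + (2 - (k : (Fun ε)⟦X⟧)) * X) * fund ε p k := by
  have hH := isUnit_rhoH (ε := ε) hp
  have hW : X₁ ε p (W ε p (k + (p - 1))) =
      -((k : (Fun ε)⟦X⟧) + ((p : (Fun ε)⟦X⟧) - 1)) * X * W ε p (k + (p - 1)) := by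
    have := derivation_W hp (X₁ ε p) (k + (p - 1))
    rw [X₁_rho, map_sub, map_intCast, map_one] at this
    refine ((isUnit_sub_one hp).mul (isUnit_rho hp)).mul_left_cancel ?_
    push_cast at this
    linear_combination this
  have h := congrArg (X₁ ε p) (fund_mul (ε := ε) hp k)
  simp only [Derivation.leibniz, hW, X₁_disc, map_sub, Derivation.map_intCast,
    Derivation.map_one_eq_zero, smul_eq_mul, mul_zero, add_zero, sub_zero] at h
  refine (isUnit_disc.mul hH).mul_left_cancel ?_
  have e := fund_mul (ε := ε) hp k
  have e1 := X₁_rhoH (ε := ε) (p := p)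
  rw [map_intCast] at e1
  linear_combination disc ε * h - fund ε p k * e1 -
    (disc ε * (C (sxFun ε) + X) - X ^ 3 - ((k : (Fun ε)⟦X⟧) + ((p : (Fun ε)⟦X⟧) - 1)) * X * disc ε) * e

theorem hat_fund_eq_zero (hp : p ≠ 1) {D : Derivation ℝ (Fun ε) (Fun ε)}
    (hv : D (coord ε (v 0)) = 0) (hs : D (sFun ε) = 0) (hρ : hat D (rho ε p) = 0) (k : ℤ) :
    hat D (rhoH ε p) = 0 ∧ hat D (disc ε) = 0 ∧ hat D (fund ε p k) = 0 := by
  have hH : hat D (rhoH ε p) = 0 := by rw [hat_rhoH, hρ, map_zero, mul_zero, mul_zero, add_zero]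
  have hd : hat D (disc ε) = 0 := by rw [hat_disc, hv, hs, map_zero, zero_mul, add_zero]
  have hW : hat D (W ε p (k + (p - 1))) = 0 := by
    have := derivation_W hp (hat D) (k + (p - 1))
    rw [hρ, mul_zero, zero_mul] at this
    exact ((isUnit_sub_one hp).mul (isUnit_rho hp)).mul_right_eq_zero.1 this
  refine ⟨hH, hd, ?_⟩
  have h := congrArg (hat D) (fund_mul (ε := ε) hp k)
  simp only [Derivation.leibniz, hW, hd, hH, map_sub, Derivation.map_intCast,
    Derivation.map_one_eq_zero, smul_eq_mul, mul_zero, add_zero, zero_add, sub_zero] at h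
  exact (isUnit_rhoH hp).mul_right_eq_zero.1 h

/-- The coefficients of a power series, with all integers as indices. -/
def zcoeff {A : Type} [CommRing A] (n : ℤ) (f : A⟦X⟧) : A := if 0 ≤ n then coeff n.toNat f else 0

section

variable {A : Type} [CommRing A]

theorem zcoeff_natCast (n : ℕ) (f : A⟦X⟧) : zcoeff (n : ℤ) f = coeff n f := by simp [zcoeff]

theorem zcoeff_of_neg {n : ℤ} (hn : n < 0) (f : A⟦X⟧) : zcoeff n f = 0 := if_neg (not_le.2 hn)

theorem zcoeff_add (n : ℤ) (f g : A⟦X⟧) : zcoeff n (f + g) = zcoeff n f + zcoeff n g := by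
  unfold zcoeff; split_ifs <;> simp

theorem zcoeff_sub (n : ℤ) (f g : A⟦X⟧) : zcoeff n (f - g) = zcoeff n f - zcoeff n g := by
  unfold zcoeff; split_ifs <;> simp

theorem zcoeff_C_mul (n : ℤ) (a : A) (f : A⟦X⟧) : zcoeff n (C a * f) = a * zcoeff n f := by
  unfold zcoeff; split_ifs <;> simp

theorem zcoeff_intCast_mul (n k : ℤ) (f : A⟦X⟧) :
    zcoeff n ((k : A⟦X⟧) * f) = k * zcoeff n f := by
  rw [← map_intCast (C : A →+* A⟦X⟧), zcoeff_C_mul]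

theorem zcoeff_X_mul (n : ℤ) (f : A⟦X⟧) : zcoeff n (X * f) = zcoeff (n - 1) f := by
  rcases lt_or_ge n 0 with hn | hn
  · rw [zcoeff_of_neg hn, zcoeff_of_neg (by omega)]
  · obtain ⟨n, rfl⟩ := Int.eq_ofNat_of_zero_le hn
    rcases n with _ | n
    · rw [zcoeff_of_neg (n := ((0 : ℕ) : ℤ) - 1) (by simp)]
      exact (zcoeff_natCast 0 _).trans (coeff_zero_X_mul _)
    · rw [zcoeff_natCast, coeff_succ_X_mul, ← zcoeff_natCast]
      congr 1
      push_cast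
      ring

theorem zcoeff_X_pow_mul (n : ℤ) (k : ℕ) (f : A⟦X⟧) :
    zcoeff n (X ^ k * f) = zcoeff (n - k) f := by
  induction k generalizing n with
  | zero => simp
  | succ k ih =>
    rw [pow_succ', mul_assoc, zcoeff_X_mul, ih]
    congr 1
    push_cast
    ring

variable [Algebra ℝ A]

theorem zcoeff_hat (n : ℤ) (D : Derivation ℝ A A) (f : A⟦X⟧) :
    zcoeff n (hat D f) = D (zcoeff n f) := by
  unfold zcoeff; split_ifs <;> simp

theorem zcoeff_X_mul_ddX (n : ℤ) (f : A⟦X⟧) : zcoeff n (X * ddX A f) = (n : A) * zcoeff n f := by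
  rcases lt_or_ge n 0 with hn | hn
  · rw [zcoeff_of_neg hn, zcoeff_of_neg hn, mul_zero]
  · obtain ⟨n, rfl⟩ := Int.eq_ofNat_of_zero_le hn
    rw [zcoeff_natCast, coeff_X_mul_ddX, zcoeff_natCast, Int.cast_natCast]

end

/-- The chain of functions of the symmetry of weight `-k`. -/
def fundChain (ε : ℤˣ) (p k : ℤ) (i : ℕ) : Fun ε := -zcoeff (i + 1 - k) (fund ε p k)

/-- P₀, P₁, … are the coefficients of -λ^{k-2}·`fund` at λ^{-1}, λ⁰, …. The recurrences hold at
every index and link only neighbours, so cutting off the lower coefficients does no harm. -/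
theorem isChain_fundChain (hp : p ≠ 1) (k : ℤ) : IsChain p (fundChain ε p k) where
  first i := by
    have := congrArg (zcoeff ((i + 1 : ℕ) + 1 - k : ℤ)) (X₂_fund (ε := ε) hp k)
    rw [X₂_apply, zcoeff_sub, zcoeff_C_mul, zcoeff_C_mul, zcoeff_X_mul, zcoeff_hat, zcoeff_hat,
      show ((i + 1 : ℕ) + 1 - k - 1 : ℤ) = i + 1 - k by push_cast; ring] at this
    rw [fundChain, fundChain, map_neg, map_neg]
    linear_combination -this
  second i := by
    have := congrArg (zcoeff ((i + 1 : ℕ) + 1 - k : ℤ)) (X₁_fund (ε := ε) hp k)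
    rw [X₁_apply, sub_mul, add_mul, pow_two, mul_assoc X X, zcoeff_add, zcoeff_add, zcoeff_sub,
      zcoeff_add, zcoeff_C_mul, zcoeff_C_mul, zcoeff_X_mul, zcoeff_X_mul, zcoeff_X_mul_ddX,
      zcoeff_hat, zcoeff_hat, zcoeff_hat,
      show (2 - (k : (Fun ε)⟦X⟧)) * X * fund ε p k =
        X * (((2 - k : ℤ) : (Fun ε)⟦X⟧) * fund ε p k) by push_cast; ring, zcoeff_X_mul,
      zcoeff_intCast_mul, show ((i + 1 : ℕ) + 1 - k - 1 : ℤ) = i + 1 - k by push_cast; ring] at this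
    rw [fundChain, fundChain, map_neg, map_neg, map_neg, map_sub, map_one, map_natCast]
    push_cast at this ⊢
    linear_combination -this

theorem mk_fundChain {n : ℤ} (j : ℕ) (hn : n = j + 2) :
    (PowerSeries.mk fun i => fundChain ε p n (i + 1)) = -X ^ j * fund ε p n := by
  ext i
  rw [coeff_mk, fundChain, neg_mul, map_neg, ← zcoeff_natCast, zcoeff_X_pow_mul]
  congr 2
  push_cast
  omega

end UHEReduction

namespace UHEReduction

variable {ε : ℤˣ} {p : ℤ}

open Coord (x y u v q)
open PowerSeries

/-! ### The basic symmetries -/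

section

variable {S T : Derivation ℝ (Fun ε) (Fun ε)}

theorem HasChain.smul {P : ℕ → Fun ε} (h : HasChain p S P) (t : ℝ) :
    HasChain p (t • S) fun i => algebraMap ℝ _ t * P i where
  apply_u := by rw [Derivation.smul_apply, h.apply_u, Algebra.smul_def]
  disc_mul := by
    have e1 : hat (t • S) (rho ε p) = algebraMap ℝ _ t * hat S (rho ε p) := by
      ext n
      rw [coeff_algebraMap_mul]
      simp [Algebra.smul_def]
    have e2 : (PowerSeries.mk fun i => algebraMap ℝ (Fun ε) t * P (i + 1)) =
        algebraMap ℝ _ t * PowerSeries.mk fun i => P (i + 1) := by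
      ext n
      rw [coeff_algebraMap_mul]
      simp
    rw [e1, e2]
    linear_combination algebraMap ℝ _ t * h.disc_mul

end

theorem exists_fundSym (hp : p ≠ 1) (k : ℤ) :
    ∃ S ∈ symmetries ε p, HasChain p S (fundChain ε p k) :=
  (isChain_fundChain hp k).exists_symmetry hp

open Classical in
/-- The homogeneous symmetry of weight `-k`. -/
def fundSym (ε : ℤˣ) (p k : ℤ) : Derivation ℝ (Fun ε) (Fun ε) :=
  if hp : p ≠ 1 then (exists_fundSym (ε := ε) hp k).choose else 0

theorem fundSym_mem (hp : p ≠ 1) (k : ℤ) : fundSym ε p k ∈ symmetries ε p := by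
  rw [fundSym, dif_pos hp]
  exact (exists_fundSym hp k).choose_spec.1

theorem hasChain_fundSym (hp : p ≠ 1) (k : ℤ) :
    HasChain p (fundSym ε p k) (fundChain ε p k) := by
  rw [fundSym, dif_pos hp]
  exact (exists_fundSym hp k).choose_spec.2

/-- The symmetry `D_x - ∂/∂x`. -/
def shiftSym (ε : ℤˣ) (p : ℤ) : Derivation ℝ (Fun ε) (Fun ε) := Dx ε p - pd ε x

theorem shiftSym_apply (f : Fun ε) : shiftSym ε p f = Dx ε p f - pd ε x f := rfl

theorem shiftSym_mem : shiftSym ε p ∈ symmetries ε p := by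
  refine ⟨?_, ?_, fun f => ?_, fun f => ?_⟩
  · simp [shiftSym_apply, pd_coord]
  · simp [shiftSym_apply, pd_coord]
  · rw [shiftSym_apply, shiftSym_apply, map_sub, pd_x_Dx]
  · rw [shiftSym_apply, shiftSym_apply, map_sub, pd_x_Dy, Dx_Dy_comm]

theorem hat_pd_x_rho : hat (pd ε x) (rho ε p) = 0 := by
  ext n
  rw [coeff_hat, rho, coeff_mk, pd_Q_eq_zero (by simp) (by simp), map_zero]

theorem hat_sub_apply (D D' : Derivation ℝ (Fun ε) (Fun ε)) (f : (Fun ε)⟦X⟧) :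
    hat (D - D') f = hat D f - hat D' f := by
  ext n
  simp

/-- The chain of the field `D_x - ∂/∂x`. -/
def shiftChain (ε : ℤˣ) : ℕ → Fun ε
  | 0 => coord ε (u 1)
  | 1 => -1
  | _ + 2 => 0

theorem hasChain_shiftSym : HasChain p (shiftSym ε p) (shiftChain ε) where
  apply_u := by simp [shiftSym_apply, shiftChain, pd_coord]
  disc_mul := by
    have : (PowerSeries.mk fun i => shiftChain ε (i + 1)) = -1 := by
      ext n
      rw [coeff_mk, map_neg, coeff_one]
      rcases n with _ | n <;> simp [shiftChain]
    rw [this, shiftSym, hat_sub_apply, hat_pd_x_rho, sub_zero, disc_mul_Dx_rho]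
    ring

/-- The chain of the symmetry in the direction of `e⁻ˣ`. -/
def expChain (ε : ℤˣ) : ℕ → Fun ε
  | 0 => expNeg ε
  | _ + 1 => 0

theorem isChain_expChain : IsChain p (expChain ε) where
  first i := by rcases i with _ | i <;> simp [expChain, derivation_expNeg]
  second i := by rcases i with _ | i <;> simp [expChain, derivation_expNeg]

open Classical in
/-- The symmetry with `u`-component `e⁻ˣ`. -/
def expSym (ε : ℤˣ) (p : ℤ) : Derivation ℝ (Fun ε) (Fun ε) :=
  if hp : p ≠ 1 then (isChain_expChain (ε := ε).exists_symmetry hp).choose else 0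

theorem expSym_mem (hp : p ≠ 1) : expSym ε p ∈ symmetries ε p := by
  rw [expSym, dif_pos hp]
  exact (isChain_expChain.exists_symmetry hp).choose_spec.1

theorem hasChain_expSym (hp : p ≠ 1) : HasChain p (expSym ε p) (expChain ε) := by
  rw [expSym, dif_pos hp]
  exact (isChain_expChain.exists_symmetry hp).choose_spec.2

theorem expSym_u (hp : p ≠ 1) : expSym ε p (coord ε (u 0)) = expNeg ε := (hasChain_expSym hp).apply_u

theorem hat_expSym_rho (hp : p ≠ 1) : hat (expSym ε p) (rho ε p) = 0 := by
  refine isUnit_disc.mul_left_cancel ?_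
  have : (PowerSeries.mk fun i => expChain ε (i + 1)) = 0 := by
    ext n
    simp [expChain]
  rw [(hasChain_expSym hp).disc_mul, this, mul_zero, zero_mul, mul_zero]

theorem fundSym_expNeg (hp : p ≠ 1) (k : ℤ) : fundSym ε p k (expNeg ε) = 0 := by
  rw [derivation_expNeg, (fundSym_mem hp k).1, neg_zero, zero_mul]

/-! ### Commutators -/

theorem fundChain_eq_zero (hp : p ≠ 1) {D : Derivation ℝ (Fun ε) (Fun ε)}
    (hv : D (coord ε (v 0)) = 0) (hs : D (sFun ε) = 0) (hρ : hat D (rho ε p) = 0) (k : ℤ) :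
    D (fundChain ε p k 0) = 0 ∧ hat D (hat (fundSym ε p k) (rho ε p)) = 0 := by
  obtain ⟨hH, hd, hF⟩ := hat_fund_eq_zero hp hv hs hρ k
  have hc : ∀ i, D (fundChain ε p k i) = 0 := fun i => by
    rw [fundChain, map_neg, ← zcoeff_hat, hF]
    simp [zcoeff]
  refine ⟨hc 0, isUnit_disc.mul_left_cancel ?_⟩
  have h := congrArg (hat D) (hasChain_fundSym (ε := ε) hp k).disc_mul
  have hm : hat D (PowerSeries.mk fun i => fundChain ε p k (i + 1)) = 0 := by
    ext n
    rw [coeff_hat, coeff_mk, hc, map_zero]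
  simpa [Derivation.leibniz, Derivation.leibniz_pow, hH, hd, hm] using h

theorem shiftSym_lie_fundSym (hp : p ≠ 1) (k : ℤ) : ⁅shiftSym ε p, fundSym ε p k⁆ = 0 := by
  have hS := fundSym_mem (ε := ε) hp k
  obtain ⟨h0, h1⟩ := fundChain_eq_zero (ε := ε) hp (D := pd ε x) (by simp [pd_coord])
    (by simp [sFun, pd_coord]) hat_pd_x_rho k
  refine symmetries_ext (LieSubalgebra.lie_mem _ shiftSym_mem hS) (zero_mem _) ?_ ?_
  · rw [Derivation.commutator_apply, shiftSym_apply, shiftSym_apply, map_sub, hS.2.2.1,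
      (hasChain_fundSym hp k).apply_u, h0, pd_coord]
    simp
  · rw [hat_lie, shiftSym, hat_sub_apply, hat_sub_apply, h1, hat_pd_x_rho, sub_zero, sub_zero,
      hat_comm hS.2.2.1, sub_self]
    ext n
    simp

theorem expSym_lie_fundSym (hp : p ≠ 1) (k : ℤ) : ⁅expSym ε p, fundSym ε p k⁆ = 0 := by
  have hE := expSym_mem (ε := ε) hp
  obtain ⟨h0, h1⟩ := fundChain_eq_zero (ε := ε) hp (D := expSym ε p)
    (by rw [symmetry_v hE 0, expSym_u hp, Function.iterate_zero_apply, derivation_expNeg]; simp)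
    (by rw [symmetry_sFun hE, expSym_u hp, derivation_expNeg]; simp) (hat_expSym_rho hp) k
  refine symmetries_ext (LieSubalgebra.lie_mem _ hE (fundSym_mem hp k)) (zero_mem _) ?_ ?_
  · rw [Derivation.commutator_apply, (hasChain_fundSym hp k).apply_u, h0, expSym_u hp,
      fundSym_expNeg hp]
    simp
  · rw [hat_lie, h1, hat_expSym_rho hp]
    ext n
    simp

theorem shiftSym_lie_expSym (hp : p ≠ 1) : ⁅shiftSym ε p, expSym ε p⁆ = expSym ε p := by
  have hE := expSym_mem (ε := ε) hp
  refine symmetries_ext (LieSubalgebra.lie_mem _ shiftSym_mem hE) hE ?_ ?_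
  · rw [Derivation.commutator_apply, shiftSym_apply, shiftSym_apply, expSym_u hp, map_sub, hE.2.2.1,
      expSym_u hp, pd_expNeg, pd_coord]
    simp
  · rw [hat_lie, shiftSym, hat_sub_apply, hat_sub_apply, hat_pd_x_rho, sub_zero,
      hat_comm hE.2.2.1, hat_expSym_rho hp]
    simp

theorem fundSym_u (hp : p ≠ 1) {n : ℤ} (hn : 2 ≤ n) : fundSym ε p n (coord ε (u 0)) = 0 := by
  rw [(hasChain_fundSym hp n).apply_u, fundChain, zcoeff_of_neg (by push_cast; omega), neg_zero]

/-- With n = j + 2 this says S(W) = -λⁿWⁿ⁺¹: the field acts as -zⁿ⁺¹ ∂/∂z on z = λW. -/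
theorem hat_fundSym_rho (hp : p ≠ 1) (j : ℕ) : hat (fundSym ε p (j + 2)) (rho ε p) =
    -X ^ (j + 2) * ((p : (Fun ε)⟦X⟧) - 1) * W ε p (j + 2) * rho ε p := by
  refine isUnit_disc.mul_left_cancel ?_
  rw [(hasChain_fundSym hp _).disc_mul, mk_fundChain j rfl]
  have e := fund_mul (ε := ε) hp (j + 2)
  rw [W_add, W_self hp] at e
  linear_combination -X ^ (j + 2) * e

/-- The action of the symmetries of positive degree on the generating series. -/
theorem hat_fundSym (hp : p ≠ 1) (j : ℕ) (k : ℤ) :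
    hat (fundSym ε p (j + 2)) (disc ε) = 0 ∧
    hat (fundSym ε p (j + 2)) (rhoH ε p) =
      -((p : (Fun ε)⟦X⟧) - 1 + ((j : (Fun ε)⟦X⟧) + 2)) * X ^ (j + 2) * W ε p (j + 2) * rhoH ε p ∧
    hat (fundSym ε p (j + 2)) (fund ε p k) =
      ((j : (Fun ε)⟦X⟧) + 2 - (k : (Fun ε)⟦X⟧)) * X ^ (j + 2) * fund ε p (j + 2 + k) := by
  have hS := fundSym_mem (ε := ε) hp (j + 2)
  have hu := fundSym_u (ε := ε) hp (n := j + 2) (by omega)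
  have hρ := hat_fundSym_rho (ε := ε) hp j
  have um := isUnit_sub_one (ε := ε) hp
  have uρ := isUnit_rho (ε := ε) hp
  have hd : hat (fundSym ε p (j + 2)) (disc ε) = 0 := by
    rw [hat_disc, symmetry_v hS 0, symmetry_sFun hS, hu]
    simp
  have hH : hat (fundSym ε p (j + 2)) (rhoH ε p) =
      -((p : (Fun ε)⟦X⟧) - 1 + ((j : (Fun ε)⟦X⟧) + 2)) * X ^ (j + 2) * W ε p (j + 2) * rhoH ε p := by
    have hW := derivation_W (ε := ε) hp (ddX _) (j + 2)
    have hX : X * ddX (Fun ε) (X ^ (j + 2)) = ((j : (Fun ε)⟦X⟧) + 2) * X ^ (j + 2) := by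
      rw [Derivation.leibniz_pow, ddX_X, Nat.add_sub_cancel_right (n := j + 1) (m := 1)]
      simp only [nsmul_eq_mul, smul_eq_mul, mul_one]
      push_cast
      ring
    rw [hat_rhoH, hρ, map_sub, map_intCast, map_one]
    simp only [Derivation.leibniz, map_neg, map_sub, Derivation.map_intCast,
      Derivation.map_one_eq_zero, smul_eq_mul, neg_mul]
    rw [rhoH_eq]
    push_cast at hW
    linear_combination (-((p : (Fun ε)⟦X⟧) - 1) * W ε p (j + 2) * rho ε p) * hX -
      X ^ (j + 3) * hW
  refine ⟨hd, hH, ?_⟩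
  have hW : hat (fundSym ε p (j + 2)) (W ε p (k + (p - 1))) =
      -((k : (Fun ε)⟦X⟧) + ((p : (Fun ε)⟦X⟧) - 1)) * X ^ (j + 2) * W ε p (j + 2) *
        W ε p (k + (p - 1)) := by
    refine (um.mul uρ).mul_left_cancel ?_
    have := derivation_W (ε := ε) hp (hat (fundSym ε p (j + 2))) (k + (p - 1))
    rw [hρ] at this
    push_cast at this
    linear_combination this
  have e := fund_mul (ε := ε) hp k
  have h := congrArg (hat (fundSym ε p (j + 2))) e
  simp only [Derivation.leibniz, hW, hd, hH, map_sub, Derivation.map_intCast,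
    Derivation.map_one_eq_zero, smul_eq_mul, mul_zero, add_zero, sub_zero] at h
  refine (isUnit_rhoH hp).mul_left_cancel ?_
  rw [fund_add]
  linear_combination h + ((k : (Fun ε)⟦X⟧) + ((p : (Fun ε)⟦X⟧) - 1)) * X ^ (j + 2) *
    W ε p (j + 2) * e

/-- For n ≥ 2 the field kills u and Δ and acts explicitly on W and H. Its action on the chain of
index k is therefore explicit, and the bracket is recognised by its chain. -/
theorem fundSym_lie_fundSym_of_le (hp : p ≠ 1) {n : ℤ} (hn : 2 ≤ n) (k : ℤ) :
    ⁅fundSym ε p n, fundSym ε p k⁆ = ((n : ℝ) - k) • fundSym ε p (n + k) := by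
  obtain ⟨j, rfl⟩ : ∃ j : ℕ, n = j + 2 := ⟨(n - 2).toNat, by omega⟩
  obtain ⟨hd, hH, hF⟩ := hat_fundSym (ε := ε) hp j k
  have hS := fundSym_mem (ε := ε) hp (j + 2)
  have hT := fundSym_mem (ε := ε) hp k
  have hc : ∀ i, fundSym ε p (j + 2) (fundChain ε p k i) =
      algebraMap ℝ _ (((j + 2 : ℤ) : ℝ) - k) * fundChain ε p (j + 2 + k) i := fun i => by
    have e : ((j : (Fun ε)⟦X⟧) + 2 - (k : (Fun ε)⟦X⟧)) * X ^ (j + 2) * fund ε p (j + 2 + k) =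
        ((j + 2 - k : ℤ) : (Fun ε)⟦X⟧) * (X ^ (j + 2) * fund ε p (j + 2 + k)) := by
      push_cast
      ring
    rw [fundChain, map_neg, ← zcoeff_hat, hF, e, zcoeff_intCast_mul, zcoeff_X_pow_mul, fundChain,
      ← Int.cast_sub, map_intCast,
      show (i + 1 - k - (j + 2 : ℕ) : ℤ) = i + 1 - (j + 2 + k) by push_cast; ring]
    ring
  refine HasChain.ext (p := p) (P := fun i =>
    algebraMap ℝ _ (((j + 2 : ℤ) : ℝ) - k) * fundChain ε p (j + 2 + k) i) ⟨?_, ?_⟩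
    ((hasChain_fundSym hp _).smul _) (LieSubalgebra.lie_mem _ hS hT)
    (LieSubalgebra.smul_mem _ _ (fundSym_mem hp _))
  · rw [Derivation.commutator_apply, (hasChain_fundSym hp k).apply_u, hc,
      fundSym_u hp (n := j + 2) (by omega), map_zero, sub_zero]
  · have h1 := (hasChain_fundSym (ε := ε) hp k).disc_mul
    have h := congrArg (hat (fundSym ε p (j + 2))) h1
    have hm : hat (fundSym ε p (j + 2)) (PowerSeries.mk fun i => fundChain ε p k (i + 1)) =
        PowerSeries.mk fun i => algebraMap ℝ (Fun ε) (((j + 2 : ℤ) : ℝ) - k) *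
          fundChain ε p (j + 2 + k) (i + 1) := by
      ext i
      rw [coeff_hat, coeff_mk, coeff_mk, hc]
    simp only [Derivation.leibniz, Derivation.leibniz_pow, hat_X, hd, hH, hm, smul_eq_mul, smul_zero,
      mul_zero, add_zero] at h
    have hW : hat (fundSym ε p k) (hat (fundSym ε p (j + 2)) (rho ε p)) =
        -((p : (Fun ε)⟦X⟧) - 1 + ((j : (Fun ε)⟦X⟧) + 2)) * X ^ (j + 2) * W ε p (j + 2) *
          hat (fundSym ε p k) (rho ε p) := by
      have := derivation_W (ε := ε) hp (hat (fundSym ε p k)) (j + 2)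
      rw [hat_fundSym_rho hp]
      simp only [Derivation.leibniz, Derivation.leibniz_pow, map_neg, map_sub, hat_X,
        Derivation.map_intCast, Derivation.map_one_eq_zero, smul_eq_mul, smul_zero, mul_zero,
        sub_zero, add_zero, neg_mul]
      push_cast at this
      linear_combination -X ^ (j + 2) * this
    rw [hat_lie, hW]
    linear_combination h + ((p : (Fun ε)⟦X⟧) - 1 + ((j : (Fun ε)⟦X⟧) + 2)) * X ^ (j + 2) * W ε p (j + 2) * h1

theorem nontrivial_fun : Nontrivial (Fun ε) := by
  refine ⟨1, 0, fun h => ?_⟩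
  have hv : (fun _ : Coord => ((ε : ℤ) : ℝ)) ∈ Domain ε := by
    change (0 : ℝ) < ((ε : ℤ) : ℝ) * ((ε : ℤ) : ℝ)
    rcases Int.units_eq_one_or ε with rfl | rfl <;> simp
  have := congrFun (congrArg Subtype.val h) ⟨_, hv⟩
  exact one_ne_zero this

/-- For index at least 2 the action on ρ is visibly nonzero. In general a bracket with a high field
is a nonzero multiple of such a field. -/
theorem fundSym_ne_zero (hp : p ≠ 1) (k : ℤ) : fundSym ε p k ≠ 0 := by
  have key : ∀ j : ℕ, fundSym ε p (j + 2) ≠ 0 := by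
    intro j h
    have h1 := hat_fundSym_rho (ε := ε) hp j
    have u := ((isUnit_sub_one (ε := ε) hp).mul (isUnit_W (ε := ε) (p := p) (j + 2))).mul
      (isUnit_rho hp)
    have h2 : X ^ (j + 2) * (((p : (Fun ε)⟦X⟧) - 1) * W ε p (j + 2) * rho ε p) = 0 := by
      have : hat (fundSym ε p (j + 2)) (rho ε p) = 0 := by
        ext n
        rw [coeff_hat, h, Derivation.zero_apply, map_zero]
      linear_combination h1 - this
    have h3 : (X ^ (j + 2) : (Fun ε)⟦X⟧) = 0 := u.mul_left_eq_zero.1 h2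
    have h4 := congrArg (coeff (j + 2)) h3
    rw [coeff_X_pow, if_pos rfl, map_zero] at h4
    have := nontrivial_fun (ε := ε)
    exact one_ne_zero h4
  intro h
  obtain ⟨j, hj, hk⟩ : ∃ j : ℕ, (j + 2 + k : ℤ) ≥ 2 ∧ (j + 2 : ℤ) ≠ k :=
    ⟨2 * k.natAbs + 1, by omega, by omega⟩
  have h1 := fundSym_lie_fundSym_of_le (ε := ε) hp (n := j + 2) (by omega) k
  rw [h, lie_zero] at h1
  have h2 := (smul_eq_zero.1 h1.symm).resolve_left
    (sub_ne_zero.2 (by exact_mod_cast hk))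
  obtain ⟨i, hi⟩ : ∃ i : ℕ, (j + 2 + k : ℤ) = i + 2 := ⟨(j + k).toNat, by omega⟩
  rw [hi] at h2
  exact key i h2

end UHEReduction

namespace UHEReduction

variable {ε : ℤˣ} {p : ℤ}

open Coord (x y u v q)
open PowerSeries

/-! ### Weights -/

theorem euler_invUy : euler ε (invUy ε) = 2 * invUy ε := by
  have h : invUy ε * coord ε (v 0) = 1 := invUy_mul
  have h' := congrArg (euler ε) h
  rw [Derivation.leibniz, euler_v, Derivation.map_one_eq_zero, smul_eq_mul, smul_eq_mul] at h'
  linear_combination invUy ε * h' + (2 * invUy ε - euler ε (invUy ε)) * h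

theorem euler_sFun : euler ε (sFun ε) = -sFun ε := by
  rw [sFun, map_add, euler_u, euler_u]
  ring

theorem euler_Qy (i : ℕ) : euler ε (Qy ε p i) = ((i : Fun ε) - 1) * Qy ε p i ∧
    euler ε (Qy ε p (i + 1)) = (i : Fun ε) * Qy ε p (i + 1) := by
  induction i with
  | zero => simp [Qy]
  | succ i ih =>
    obtain ⟨h0, h1⟩ := ih
    refine ⟨by rw [h1]; push_cast; ring, ?_⟩
    have hs : coord ε (u 1) + coord ε (u 0) = sFun ε := rfl
    rw [Qy, hs]
    generalize (-(p : ℝ) - ((i : ℝ) + 1) + 1) = z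
    simp only [map_add, map_sub, Derivation.leibniz, h0, h1, euler_sFun,
      euler_invUy, euler_Q, smul_eq_mul, Algebra.smul_def, Derivation.map_algebraMap]
    push_cast
    ring

theorem euler_Dx (f : Fun ε) : euler ε (Dx ε p f) = Dx ε p (euler ε f) := by
  have := derivation_comm_of_coord (D := euler ε) (D' := Dx ε p) (D'' := 0) (fun c => ?_) f
  · rwa [Derivation.zero_apply, add_zero] at this
  rw [Derivation.zero_apply, add_zero]
  cases c with
  | x => simp
  | y => simp
  | u k => simp
  | v k => simp [Derivation.leibniz, derivation_two]
  | q n =>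
    rw [← Q_succ_succ (p := p), euler_Q, Derivation.leibniz, Derivation.map_natCast, Dx_Q,
      Derivation.leibniz, euler_invUy, (euler_Qy _).2]
    simp only [smul_eq_mul]
    push_cast
    ring

theorem iterate_smul {A : Type} [CommRing A] [Algebra ℝ A] (D : Derivation ℝ A A) (t : ℝ) (k : ℕ)
    (f : A) : D^[k] (t • f) = t • D^[k] f := by
  induction k with
  | zero => rfl
  | succ k ih => rw [Function.iterate_succ_apply', ih, Derivation.map_smul, Function.iterate_succ_apply']

theorem euler_rhs : euler ε (rhs ε) = -3 * rhs ε := by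
  rw [rhs]
  simp only [map_add, map_sub, Derivation.leibniz, euler_u, euler_v, smul_eq_mul]
  ring

theorem euler_Dy (f : Fun ε) : euler ε (Dy ε p f) = Dy ε p (euler ε f) - Dy ε p f := by
  have := derivation_comm_of_coord (D := euler ε) (D' := Dy ε p) (D'' := -Dy ε p) (fun c => ?_) f
  · rwa [Derivation.neg_apply, ← sub_eq_add_neg] at this
  rw [Derivation.neg_apply, ← sub_eq_add_neg]
  cases c with
  | x => simp
  | y => simp
  | u k =>
    rw [Dy_u, euler_v, euler_u, map_neg, Dy_u]
    ring
  | v k =>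
    rw [euler_v, Derivation.leibniz, map_neg, derivation_two, Dy_v, iterate_comm euler_Dx,
      euler_rhs, show (-3 : Fun ε) * rhs ε = (-3 : ℝ) • rhs ε by
        rw [Algebra.smul_def, map_neg, map_ofNat], iterate_smul, Algebra.smul_def, map_neg, map_ofNat]
    simp only [smul_eq_mul]
    ring
  | q n =>
    rw [← Q_succ_succ (p := p), euler_Q, Derivation.leibniz, Derivation.map_natCast, Dy_Q,
      (euler_Qy _).2]
    simp only [smul_eq_mul]
    push_cast
    ring

/-- E commutes with D_x, and [E, D_y] = -D_y. -/
theorem euler_lie_mem {S : Derivation ℝ (Fun ε) (Fun ε)} (hS : S ∈ symmetries ε p) :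
    ⁅euler ε, S⁆ ∈ symmetries ε p := by
  refine ⟨?_, ?_, fun f => ?_, fun f => ?_⟩
  · rw [Derivation.commutator_apply, hS.1, euler_x, map_zero, map_zero, sub_zero]
  · rw [Derivation.commutator_apply, hS.2.1, euler_y, hS.2.1, map_zero, sub_zero]
  · rw [Derivation.commutator_apply, Derivation.commutator_apply, hS.2.2.1, euler_Dx, euler_Dx,
      hS.2.2.1, map_sub]
  · rw [Derivation.commutator_apply, Derivation.commutator_apply, hS.2.2.2, euler_Dy, euler_Dy,
      map_sub, map_sub, hS.2.2.2, hS.2.2.2]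
    ring

/-- The Euler operator on power series for which `rho` has weight zero. -/
def hatEuler (ε : ℤˣ) : Derivation ℝ (Fun ε)⟦X⟧ (Fun ε)⟦X⟧ := hat (euler ε) - (X : (Fun ε)⟦X⟧) • ddX (Fun ε)

theorem hatEuler_apply (f : (Fun ε)⟦X⟧) : hatEuler ε f = hat (euler ε) f - X * ddX _ f := rfl

theorem coeff_hatEuler (n : ℕ) (f : (Fun ε)⟦X⟧) :
    coeff n (hatEuler ε f) = euler ε (coeff n f) - n * coeff n f := by
  rw [hatEuler_apply, map_sub, coeff_hat, coeff_X_mul_ddX]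

theorem hatEuler_X : hatEuler ε X = -X := by
  rw [hatEuler_apply, hat_X, ddX_X]
  ring

theorem hatEuler_rho : hatEuler ε (rho ε p) = 0 := by
  ext n
  rw [coeff_hatEuler, rho, coeff_mk, euler_Q, sub_self, map_zero]

theorem hatEuler_hat (S : Derivation ℝ (Fun ε) (Fun ε)) :
    hat ⁅euler ε, S⁆ (rho ε p) = hatEuler ε (hat S (rho ε p)) := by
  have h : hat S (hatEuler ε (rho ε p)) = 0 := by rw [hatEuler_rho, map_zero]
  rw [hatEuler_apply, map_sub, Derivation.leibniz, hat_X, hat_ddX, smul_zero, add_zero,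
    smul_eq_mul] at h
  rw [hat_lie, hatEuler_apply]
  linear_combination -h

theorem hatEuler_disc : hatEuler ε (disc ε) = -2 * disc ε := by
  have h : ∀ a : Fun ε, hatEuler ε (C a) = C (euler ε a) := fun a => by
    ext n
    rw [coeff_hatEuler, coeff_C, coeff_C]
    split_ifs with hn <;> simp [hn]
  simp only [disc, map_sub, map_add, Derivation.leibniz, Derivation.leibniz_pow, h, hatEuler_X,
    smul_eq_mul, euler_v, euler_sFun, map_mul, map_neg, map_ofNat, nsmul_eq_mul]
  push_cast
  ring

theorem hatEuler_rhoH : hatEuler ε (rhoH ε p) = 0 := by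
  ext n
  rw [coeff_hatEuler, rhoH, map_add, coeff_algebraMap_mul, coeff_X_mul_ddX, rho, coeff_mk, map_add,
    Derivation.leibniz, Derivation.leibniz, Derivation.map_algebraMap, Derivation.map_natCast,
    euler_Q, map_zero]
  simp only [smul_eq_mul]
  ring

theorem hatEuler_W (hp : p ≠ 1) (k : ℤ) : hatEuler ε (W ε p k) = 0 := by
  have := derivation_W hp (hatEuler ε) k
  rw [hatEuler_rho, mul_zero, zero_mul] at this
  exact ((isUnit_sub_one hp).mul (isUnit_rho hp)).mul_right_eq_zero.1 this

theorem hatEuler_fund (hp : p ≠ 1) (k : ℤ) : hatEuler ε (fund ε p k) = -2 * fund ε p k := by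
  have e := fund_mul (ε := ε) hp k
  have h := congrArg (hatEuler ε) e
  simp only [Derivation.leibniz, hatEuler_W hp, hatEuler_disc, hatEuler_rhoH, map_sub,
    Derivation.map_intCast, Derivation.map_one_eq_zero, smul_eq_mul, mul_zero, add_zero, zero_add,
    sub_zero] at h
  refine (isUnit_rhoH (ε := ε) hp).mul_left_cancel ?_
  linear_combination h + 2 * e

/-- If λ has weight -1, then ρ and H have weight 0 and both Δ and λ² have weight -2, so the weight
operator passes through the defining relation of the chain to its members. -/
theorem HasChain.euler_lie {S : Derivation ℝ (Fun ε) (Fun ε)} {P : ℕ → Fun ε}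
    (h : HasChain p S P) :
    HasChain p ⁅euler ε, S⁆ fun i => euler ε (P i) - ((i : Fun ε) - 1) * P i where
  apply_u := by
    rw [Derivation.commutator_apply, euler_u, map_neg, h.apply_u]
    push_cast
    ring
  disc_mul := by
    have e : (PowerSeries.mk fun i => euler ε (P (i + 1)) - (((i + 1 : ℕ) : Fun ε) - 1) * P (i + 1)) =
        hatEuler ε (PowerSeries.mk fun i => P (i + 1)) := by
      ext i
      rw [coeff_hatEuler, coeff_mk, coeff_mk]
      push_cast
      ring
    have h' := congrArg (hatEuler ε) h.disc_mul
    simp only [Derivation.leibniz, Derivation.leibniz_pow, hatEuler_X, hatEuler_disc, hatEuler_rhoH,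
      smul_eq_mul, nsmul_eq_mul] at h'
    push_cast at h'
    rw [hatEuler_hat, e]
    linear_combination h' + 2 * h.disc_mul

theorem HasChain.unique {S : Derivation ℝ (Fun ε) (Fun ε)} {P P' : ℕ → Fun ε} (hp : p ≠ 1)
    (h : HasChain p S P) (h' : HasChain p S P') (i : ℕ) : P i = P' i := by
  rcases i with _ | i
  · rw [← h.apply_u, h'.apply_u]
  · have e := (isUnit_rhoH hp).mul_right_cancel (h.disc_mul.symm.trans h'.disc_mul)
    rw [pow_two, mul_assoc, mul_assoc] at e
    simpa using congrArg (coeff i) (X_mul_cancel' (X_mul_cancel' e))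

theorem euler_lie_fundSym (hp : p ≠ 1) (k : ℤ) :
    ⁅euler ε, fundSym ε p k⁆ = (-(k : ℝ)) • fundSym ε p k := by
  have h := (hasChain_fundSym (ε := ε) hp k).euler_lie
  have e : (fun i : ℕ => euler ε (fundChain ε p k i) - ((i : Fun ε) - 1) * fundChain ε p k i) =
      fun i => algebraMap ℝ _ (-(k : ℝ)) * fundChain ε p k i := by
    funext i
    have := congrArg (zcoeff (i + 1 - k)) (hatEuler_fund (ε := ε) hp k)
    rw [hatEuler_apply, zcoeff_sub, zcoeff_hat, zcoeff_X_mul_ddX,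
      show (-2 : (Fun ε)⟦X⟧) = ((-2 : ℤ) : (Fun ε)⟦X⟧) by norm_num, zcoeff_intCast_mul] at this
    rw [fundChain, map_neg, map_neg, map_intCast]
    push_cast at this
    linear_combination -this
  rw [e] at h
  exact h.ext ((hasChain_fundSym hp k).smul _) (euler_lie_mem (fundSym_mem hp k))
    (LieSubalgebra.smul_mem _ _ (fundSym_mem hp k))

theorem euler_lie_shiftSym : ⁅euler ε, shiftSym ε p⁆ = 0 := by
  have h := (hasChain_shiftSym (ε := ε) (p := p)).euler_lie
  have h0 := (hasChain_shiftSym (ε := ε) (p := p)).smul 0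
  have e : (fun i : ℕ => euler ε (shiftChain ε i) - ((i : Fun ε) - 1) * shiftChain ε i) =
      fun i => algebraMap ℝ _ 0 * shiftChain ε i := by
    funext i
    rcases i with _ | _ | i <;> simp [shiftChain]
  rw [e] at h
  rw [← zero_smul ℝ (shiftSym ε p)]
  exact h.ext h0 (euler_lie_mem shiftSym_mem) (LieSubalgebra.smul_mem _ _ shiftSym_mem)

theorem euler_lie_expSym (hp : p ≠ 1) : ⁅euler ε, expSym ε p⁆ = expSym ε p := by
  have h := (hasChain_expSym (ε := ε) hp).euler_lie
  have e : (fun i : ℕ => euler ε (expChain ε i) - ((i : Fun ε) - 1) * expChain ε i) =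
      expChain ε := by
    funext i
    rcases i with _ | i <;> simp [expChain, derivation_expNeg]
  rw [e] at h
  exact h.ext (hasChain_expSym hp) (euler_lie_mem (expSym_mem hp)) (expSym_mem hp)

end UHEReduction

namespace UHEReduction

variable {ε : ℤˣ} {p : ℤ}

open Coord (x y u v q)

/-! ### Classification of the homogeneous symmetries -/

section

variable {S : Derivation ℝ (Fun ε) (Fun ε)} {P c : ℕ → Fun ε}

/-- Only c₁ = a and c₀ = a u + b e^{-x} survive, so P₀ = a u_x - b e^{-x}, P₁ = -a, and the later
members vanish. -/
theorem eq_combination (hp : p ≠ 1) (hS : S ∈ symmetries ε p) (h : HasChain p S P)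
    (hc : IsCoefficients p c) (hP : ∀ i, P i = c (i + 2) * coord ε (v 0) + c (i + 1) * sFun ε - c i)
    (h0 : ∀ i, c (i + 3) = 0) : ∃ a b : ℝ, S = a • shiftSym ε p - b • expSym ε p := by
  obtain ⟨h2, a, b, h1, hc0⟩ := hc.exists_eq_of_eq_zero hp h0
  refine ⟨a, b, ?_⟩
  have h' := (hasChain_shiftSym.smul a).sub_smul (hasChain_expSym (ε := ε) hp) b
  have e : P = fun i => algebraMap ℝ _ a * shiftChain ε i - algebraMap ℝ _ b * expChain ε i := by
    funext i
    rw [hP]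
    rcases i with _ | _ | i
    · rw [zero_add, zero_add, h2, h1, hc0, sFun]
      simp only [shiftChain, expChain]
      ring
    · rw [show 0 + 1 + 2 = 0 + 3 from rfl, h0, zero_add, show 1 + 1 = 2 from rfl, h2, h1]
      simp [shiftChain, expChain]
    · rw [show i + 1 + 1 + 2 = (i + 1) + 3 from rfl, h0, show i + 1 + 1 + 1 = i + 3 from rfl, h0,
        show c (i + 1 + 1) = 0 by rcases i with _ | i; exacts [h2, h0 i]]
      simp [shiftChain, expChain]
  rw [e] at h
  exact h.ext h' hS (Submodule.sub_mem _ (LieSubalgebra.smul_mem _ _ shiftSym_mem)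
    (LieSubalgebra.smul_mem _ _ (expSym_mem hp)))

/-- c_{j+2} is the u_y-derivative of P_j, and ∂/∂u_y raises weights by 2. -/
theorem euler_coefficient (hp : p ≠ 1) {κ : ℝ} (h : HasChain p S P) (hb : ∀ i, Base (c i))
    (hP : ∀ i, P i = c (i + 2) * coord ε (v 0) + c (i + 1) * sFun ε - c i)
    (hκ : ⁅euler ε, S⁆ = κ • S) (j : ℕ) :
    euler ε (c (j + 2)) = algebraMap ℝ _ (((j + 2 : ℕ) : ℝ) - 1 + κ) * c (j + 2) := by
  have hv : pd ε (v 0) (P j) = c (j + 2) := by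
    rw [hP]
    simp [Derivation.leibniz, (hb _ 0).2, sFun, pd_coord]
  have hE : ∀ f, euler ε (pd ε (v 0) f) = pd ε (v 0) (euler ε f) + 2 * pd ε (v 0) f := fun f => by
    change _ = _ + ((2 : Fun ε) • pd ε (v 0)) f
    refine derivation_comm_of_coord (fun c => ?_) f
    rw [Derivation.smul_apply, smul_eq_mul]
    cases c with
    | x => simp [pd_coord]
    | y => simp [pd_coord]
    | u k => simp [pd_coord]
    | v k => rcases k with _ | k <;> simp [pd_coord, Derivation.leibniz, derivation_two]
    | q n =>
      rw [← Q_succ_succ (p := 0), euler_Q, Derivation.leibniz, Derivation.map_natCast, Q_succ_succ,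
        pd_coord]
      simp
  have hw := h.euler_lie.unique hp (hκ ▸ h.smul κ) j
  rw [← hv, hE, eq_add_of_sub_eq hw, map_add, Derivation.leibniz, Derivation.leibniz,
    Derivation.map_algebraMap, map_sub, Derivation.map_natCast, Derivation.map_one_eq_zero]
  simp only [smul_eq_mul, map_sub, map_add, map_one, map_natCast, Nat.cast_add, Nat.cast_ofNat,
    map_ofNat]
  ring

end

theorem exists_coefficients_of_mem (hp : p ≠ 1) {S : Derivation ℝ (Fun ε) (Fun ε)} {P : ℕ → Fun ε}
    (hS : S ∈ symmetries ε p) (h : HasChain p S P) :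
    ∃ c, IsCoefficients p c ∧
      ∀ i, P i = c (i + 2) * coord ε (v 0) + c (i + 1) * sFun ε - c i := by
  obtain ⟨c, hb, hP⟩ := (h.isChain hp hS).exists_coefficients
  exact ⟨c, (h.isChain hp hS).isCoefficients hb hP, hP⟩

theorem expSym_ne_zero (hp : p ≠ 1) : expSym ε p ≠ 0 := fun h => by
  have h1 := expSym_u (ε := ε) hp
  rw [h, Derivation.zero_apply] at h1
  have h2 := expNeg_mul_expPos (ε := ε)
  rw [← h1, zero_mul] at h2
  have := nontrivial_fun (ε := ε)
  exact zero_ne_one h2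

/-- A homogeneous symmetry of integral weight. -/
theorem eq_combination_of_weight (hp : p ≠ 1) (k : ℤ) {S : Derivation ℝ (Fun ε) (Fun ε)}
    (hS : S ∈ symmetries ε p) (hk : ⁅euler ε, S⁆ = (-(k : ℝ)) • S) :
    ∃ t a b : ℝ, S = t • fundSym ε p k + a • shiftSym ε p - b • expSym ε p := by
  have hF := fundSym_mem (ε := ε) hp k
  have hQ := hasChain_fundSym (ε := ε) hp k
  obtain ⟨P, h⟩ := exists_hasChain hp hS
  obtain ⟨c, hc, hP⟩ := exists_coefficients_of_mem hp hS h
  obtain ⟨c', hc', hP'⟩ := exists_coefficients_of_mem hp hF hQ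
  have hw := euler_coefficient hp h hc.base hP hk
  have hw' := euler_coefficient hp hQ hc'.base hP' (euler_lie_fundSym hp k)
  -- Otherwise `fundSym k` would be a combination of `shiftSym` and `expSym` and commute with every
  -- `fundSym n`, against its nonzero bracket for large n ≠ k.
  have hne : ∃ i, c' (i + 3) ≠ 0 := by
    by_contra! h0
    obtain ⟨a, b, e⟩ := eq_combination hp hF hQ hc' hP' h0
    obtain ⟨n, hn, hnk⟩ : ∃ n : ℤ, 2 ≤ n ∧ n ≠ k := ⟨k.natAbs + 2, by omega, by omega⟩
    have h1 := fundSym_lie_fundSym_of_le (ε := ε) hp hn k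
    rw [e, lie_sub, lie_smul, lie_smul, ← lie_skew, shiftSym_lie_fundSym hp, ← lie_skew,
      expSym_lie_fundSym hp] at h1
    simp only [neg_zero, smul_zero, sub_zero] at h1
    exact fundSym_ne_zero hp _ ((smul_eq_zero.1 h1.symm).resolve_left
      (sub_ne_zero.2 (by exact_mod_cast hnk)))
  -- The critical diagonal solves e - 2 + κ = 0 for κ = -k.
  obtain ⟨t, ht⟩ := hc.proportional hc' hp (e := k + 2)
    (by simpa only [Int.cast_add, Int.cast_ofNat, sub_add_cancel_right] using hw)
    (by simpa only [Int.cast_add, Int.cast_ofNat, sub_add_cancel_right] using hw') hne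
  obtain ⟨a, b, e⟩ := eq_combination hp (Submodule.sub_mem _ hS (LieSubalgebra.smul_mem _ t hF))
    (h.sub_smul hQ t) (hc.sub_smul hc' t) (fun i => by rw [hP, hP']; ring)
    (fun i => by rw [ht, sub_self])
  refine ⟨t, a, b, ?_⟩
  rw [add_sub_assoc, ← e]
  abel

/-- For a weight that is not an integer no diagonal can carry constants, so all c_{i+3} vanish. -/
theorem eq_combination_of_weight_ne (hp : p ≠ 1) {κ : ℝ} (hκ : ∀ k : ℤ, κ ≠ -k)
    {S : Derivation ℝ (Fun ε) (Fun ε)} (hS : S ∈ symmetries ε p) (hk : ⁅euler ε, S⁆ = κ • S) :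
    ∃ a b : ℝ, S = a • shiftSym ε p - b • expSym ε p := by
  obtain ⟨P, h⟩ := exists_hasChain hp hS
  obtain ⟨c, hc, hP⟩ := exists_coefficients_of_mem hp hS h
  have hw := euler_coefficient hp h hc.base hP hk
  refine eq_combination hp hS h hc hP (hc.eq_zero_of_weight hp hw fun e he => hκ (e - 2) ?_)
  push_cast
  linear_combination he

/-- The commutation relations of the Witt algebra. -/
theorem fundSym_lie_fundSym (hp : p ≠ 1) (k l : ℤ) :
    ⁅fundSym ε p k, fundSym ε p l⁆ = ((k : ℝ) - l) • fundSym ε p (k + l) := by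
  have hk := fundSym_mem (ε := ε) hp k
  have hl := fundSym_mem (ε := ε) hp l
  -- The defect T is homogeneous, so three coefficients determine it; brackets with `expSym`,
  -- `shiftSym` and a high `fundSym n` show that they vanish.
  obtain ⟨T, hT⟩ : ∃ T, T = ⁅fundSym ε p k, fundSym ε p l⁆ - ((k : ℝ) - l) • fundSym ε p (k + l) :=
    ⟨_, rfl⟩
  have hmem : T ∈ symmetries ε p := hT ▸ Submodule.sub_mem _ (LieSubalgebra.lie_mem _ hk hl)
    (LieSubalgebra.smul_mem _ _ (fundSym_mem hp _))
  have hw : ⁅euler ε, T⁆ = (-((k + l : ℤ) : ℝ)) • T := by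
    rw [hT, lie_sub, lie_smul, leibniz_lie, euler_lie_fundSym hp, euler_lie_fundSym hp,
      euler_lie_fundSym hp, smul_lie, lie_smul]
    push_cast
    module
  obtain ⟨t, a, b, e⟩ := eq_combination_of_weight hp (k + l) hmem hw
  have hX : ⁅shiftSym ε p, T⁆ = 0 := by
    rw [hT, lie_sub, lie_smul, leibniz_lie, shiftSym_lie_fundSym hp, shiftSym_lie_fundSym hp,
      shiftSym_lie_fundSym hp]
    simp
  have hE : ⁅expSym ε p, T⁆ = 0 := by
    rw [hT, lie_sub, lie_smul, leibniz_lie, expSym_lie_fundSym hp, expSym_lie_fundSym hp,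
      expSym_lie_fundSym hp]
    simp
  have hb : b = 0 := by
    rw [e, lie_sub, lie_add, lie_smul, lie_smul, lie_smul, shiftSym_lie_fundSym hp, lie_self,
      shiftSym_lie_expSym hp] at hX
    simpa [expSym_ne_zero hp] using hX
  have ha : a = 0 := by
    rw [e, lie_sub, lie_add, lie_smul, lie_smul, lie_smul, expSym_lie_fundSym hp, lie_self,
      ← lie_skew, shiftSym_lie_expSym hp] at hE
    simpa [expSym_ne_zero hp] using hE
  rw [ha, hb, zero_smul, zero_smul, add_zero, sub_zero] at e
  obtain ⟨n, h2, hnk, hnl, hne⟩ : ∃ n : ℤ, 2 ≤ n ∧ 2 ≤ n + k ∧ 2 ≤ n + l ∧ n ≠ k + l :=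
    ⟨k.natAbs + l.natAbs + 2, by omega, by omega, by omega, by omega⟩
  -- The Jacobi identity; n is so large that every bracket involved has an entry of index at least
  -- 2.
  have h1 : ⁅fundSym ε p n, T⁆ = 0 := by
    rw [hT, lie_sub, lie_smul, leibniz_lie, fundSym_lie_fundSym_of_le hp h2,
      fundSym_lie_fundSym_of_le hp h2, fundSym_lie_fundSym_of_le hp h2, smul_lie, lie_smul,
      fundSym_lie_fundSym_of_le hp hnk, ← lie_skew, fundSym_lie_fundSym_of_le hp hnl,
      show n + l + k = n + (k + l) by ring, show n + k + l = n + (k + l) by ring]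
    push_cast
    module
  rw [e, lie_smul, fundSym_lie_fundSym_of_le hp h2] at h1
  have ht : t = 0 := by
    have := (smul_eq_zero.1 h1)
    refine this.resolve_right fun h => fundSym_ne_zero hp _ ((smul_eq_zero.1 h).resolve_left
      (sub_ne_zero.2 (by exact_mod_cast hne)))
  rw [ht, zero_smul] at e
  exact sub_eq_zero.1 (hT.symm.trans e)

end UHEReduction

namespace UHEReduction

variable {ε : ℤˣ} {p : ℤ}

open Coord (x y u v q)

/-! ### Bases of the model algebras -/

section

open LaurentPolynomial

theorem T_eq_basis (n : ℤ) : (T n : LaurentPolynomial ℝ) = AddMonoidAlgebra.basis ℤ ℝ n := rfl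

theorem mul_T_T_neg (f : LaurentPolynomial ℝ) : f * T 1 * T (-1) = f := by
  rw [mul_T_assoc, add_neg_cancel, T_zero, mul_one]

/-- The Euler field `z ∂/∂z` on Laurent polynomials. -/
def laurentEuler : WittAlgebra := Derivation.mk'
  ((AddMonoidAlgebra.basis ℤ ℝ).constr ℝ fun n : ℤ => (n : ℝ) • (T n : LaurentPolynomial ℝ)) <| by
  have hT : ∀ n : ℤ, (AddMonoidAlgebra.basis ℤ ℝ).constr ℝ
      (fun n : ℤ => (n : ℝ) • (T n : LaurentPolynomial ℝ)) (T n) = (n : ℝ) • T n := fun n => by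
    conv_lhs => rw [T_eq_basis]
    rw [Module.Basis.constr_basis]
  intro f g
  induction f using LaurentPolynomial.induction_on' with
  | add f f' hf hf' => simp only [add_mul, map_add, hf, hf', add_smul, smul_add]; abel
  | C_mul_T m a =>
    induction g using LaurentPolynomial.induction_on' with
    | add g g' hg hg' => simp only [mul_add, map_add, hg, hg', add_smul, smul_add]; abel
    | C_mul_T n b =>
      rw [show C a * T m * (C b * T n) = C (a * b) * T (m + n) by rw [map_mul, T_add]; ring]
      simp only [← smul_eq_C_mul, map_smul, hT, smul_eq_mul]
      simp only [T_add, smul_eq_C_mul, Int.cast_add, map_add, map_mul]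
      ring

theorem laurentEuler_T (n : ℤ) : laurentEuler (T n) = (n : ℝ) • T n := by
  change (AddMonoidAlgebra.basis ℤ ℝ).constr ℝ
      (fun n : ℤ => (n : ℝ) • (T n : LaurentPolynomial ℝ)) (T n) = (n : ℝ) • T n
  conv_lhs => rw [T_eq_basis]
  rw [Module.Basis.constr_basis]

theorem wittAlgebra_ext {D D' : WittAlgebra} (h : D (T 1) = D' (T 1)) : D = D' := by
  have hT : T 1 * T (-1) = (1 : LaurentPolynomial ℝ) := by rw [← T_add]; simp
  have h' : D (T (-1)) = D' (T (-1)) := by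
    rw [D.leibniz_of_mul_eq_one ((mul_comm _ _).trans hT),
      D'.leibniz_of_mul_eq_one ((mul_comm _ _).trans hT), h]
  have hn : ∀ n : ℤ, D (T n) = D' (T n) := fun n => by
    induction n using Int.induction_on with
    | zero => rw [T_zero, D.map_one_eq_zero, D'.map_one_eq_zero]
    | succ n ih => rw [T_add, D.leibniz, D'.leibniz, ih, h]
    | pred n ih => rw [sub_eq_add_neg, T_add, D.leibniz, D'.leibniz, ih, h']
  refine Derivation.ext fun f => ?_
  induction f using LaurentPolynomial.induction_on' with
  | add f f' hf hf' => rw [map_add, map_add, hf, hf']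
  | C_mul_T m a => rw [← smul_eq_C_mul, D.map_smul, D'.map_smul, hn]

/-- A vector field on the punctured line is a multiple of the Euler field. -/
def wittEquiv : LaurentPolynomial ℝ ≃ₗ[ℝ] WittAlgebra where
  -- The sign gives the structure constants k - l, as for `fundSym`.
  toFun f := -(f • laurentEuler)
  map_add' f g := by rw [add_smul, neg_add]
  map_smul' r f := by rw [smul_assoc, RingHom.id_apply, smul_neg]
  invFun D := -(D (T 1) * T (-1))
  left_inv f := by
    change -((-(f • laurentEuler)) (T 1) * T (-1)) = f
    rw [Derivation.neg_apply, Derivation.smul_apply, laurentEuler_T, Int.cast_one, one_smul,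
      smul_eq_mul, neg_mul, neg_neg, mul_T_T_neg]
  right_inv D := wittAlgebra_ext <| by
    change (-(-(D (T 1) * T (-1)) • laurentEuler)) (T 1) = D (T 1)
    rw [Derivation.neg_apply, Derivation.smul_apply, laurentEuler_T, Int.cast_one, one_smul,
      smul_eq_mul, neg_mul, neg_neg, mul_right_comm, mul_T_T_neg]

/-- The basis of the Witt algebra that consists of the fields `-z ^ (k + 1) ∂/∂z`. -/
def wittBasis : Module.Basis ℤ ℝ WittAlgebra := (AddMonoidAlgebra.basis ℤ ℝ).map wittEquiv

theorem wittBasis_apply (k : ℤ) : wittBasis k = -((T k : LaurentPolynomial ℝ) • laurentEuler) := by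
  rw [wittBasis, Module.Basis.map_apply, T_eq_basis]
  rfl

theorem wittBasis_lie (k l : ℤ) :
    ⁅wittBasis k, wittBasis l⁆ = ((k : ℝ) - l) • wittBasis (k + l) := by
  refine wittAlgebra_ext ?_
  simp only [wittBasis_apply, Derivation.commutator_apply, Derivation.neg_apply,
    Derivation.smul_apply, laurentEuler_T, map_neg, smul_eq_mul, Derivation.leibniz, T_add]
  simp only [smul_eq_C_mul, map_sub, map_one, Int.cast_one]
  ring

end

section

attribute [local instance 100] LieRing.ofAssociativeRing

/-- The matrices `!![a, b; 0, 0]` in coordinates. -/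
def s2Equiv : s2 ≃ₗ[ℝ] (Fin 2 → ℝ) where
  toFun A := ![A.1 0 0, A.1 0 1]
  map_add' A B := by simp
  map_smul' r A := by simp
  invFun a := ⟨!![a 0, a 1; 0, 0], rfl, rfl⟩
  left_inv A := by
    obtain ⟨A, h0, h1⟩ := A
    refine Subtype.ext ?_
    ext i j
    fin_cases i <;> fin_cases j <;> simp [h0, h1]
  right_inv a := by
    ext i
    fin_cases i <;> simp

/-- The basis of matrix units. -/
def s2Basis : Module.Basis (Fin 2) ℝ s2 := Module.Basis.ofEquivFun s2Equiv

theorem s2Basis_lie : ⁅s2Basis 0, s2Basis 1⁆ = s2Basis 1 := by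
  have h : ∀ i, s2Basis i = s2Equiv.symm (Pi.single i 1) := fun i => by
    rw [s2Basis, Module.Basis.coe_ofEquivFun]
  rw [h, h]
  refine Subtype.ext ?_
  rw [LieSubalgebra.coe_bracket, Ring.lie_def]
  change !![_, _; 0, 0] * !![_, _; 0, 0] - !![_, _; 0, 0] * !![_, _; 0, 0] = !![_, _; 0, 0]
  ext i j
  fin_cases i <;> fin_cases j <;> simp

end

/-! ### The isomorphism -/

theorem lie_of_basis {ι L L' : Type} [LieRing L] [LieAlgebra ℝ L] [LieRing L'] [LieAlgebra ℝ L']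
    (b : Module.Basis ι ℝ L) (f : L →ₗ[ℝ] L') (h : ∀ i j, f ⁅b i, b j⁆ = ⁅f (b i), f (b j)⁆)
    (a c : L) : f ⁅a, c⁆ = ⁅f a, f c⁆ := by
  have : (LieAlgebra.ad ℝ L : L →ₗ[ℝ] Module.End ℝ L).compr₂ f =
      (LieAlgebra.ad ℝ L' : L' →ₗ[ℝ] Module.End ℝ L').compl₁₂ f f :=
    b.ext fun i => b.ext fun j => h i j
  exact LinearMap.congr_fun (LinearMap.congr_fun this a) c

/-- The basic symmetries. -/
def basicSym (ε : ℤˣ) (p : ℤ) : ℤ ⊕ Fin 2 → Derivation ℝ (Fun ε) (Fun ε) :=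
  Sum.elim (fundSym ε p) ![shiftSym ε p, expSym ε p]

/-- The `fundSym k` have distinct weights. `shiftSym` and `expSym` commute with all of them but not
with each other, so brackets with these two separate the two spans. -/
theorem linearIndependent_basicSym (hp : p ≠ 1) : LinearIndependent ℝ (basicSym ε p) := by
  have hE := expSym_ne_zero (ε := ε) hp
  have hXE := shiftSym_lie_expSym (ε := ε) hp
  have hEX : ⁅expSym ε p, shiftSym ε p⁆ = -expSym ε p := by rw [← lie_skew, hXE]
  refine linearIndependent_sum.2 ⟨?_, ?_, ?_⟩
  · refine Module.End.eigenvectors_linearIndependent'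
      (LieAlgebra.ad ℝ (Derivation ℝ (Fun ε) (Fun ε)) (euler ε)) (fun k : ℤ => -(k : ℝ))
      (fun k l h => by simpa using h) _ fun k => ⟨Module.End.mem_eigenspace_iff.2 ?_, ?_⟩
    · exact euler_lie_fundSym hp k
    · exact fundSym_ne_zero hp k
  · refine LinearIndependent.pair_iff.2 fun a b h => ?_
    change a • shiftSym ε p + b • expSym ε p = 0 at h
    have h1 := congrArg (⁅shiftSym ε p, ·⁆) h
    have h2 := congrArg (⁅expSym ε p, ·⁆) h
    simp only [lie_add, lie_smul, lie_self, hXE, hEX, lie_zero, smul_zero, zero_add, add_zero,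
      smul_neg, neg_eq_zero] at h1 h2
    exact ⟨(smul_eq_zero.1 h2).resolve_right hE, (smul_eq_zero.1 h1).resolve_right hE⟩
  · refine Submodule.disjoint_def.2 fun z hz hz' => ?_
    have hr : Set.range (basicSym ε p ∘ Sum.inr) = {shiftSym ε p, expSym ε p} := by
      change Set.range ![shiftSym ε p, expSym ε p] = _
      rw [Matrix.range_cons_cons_empty]
    rw [hr] at hz'
    obtain ⟨a, b, rfl⟩ := Submodule.mem_span_pair.1 hz'
    have key : ∀ D : Derivation ℝ (Fun ε) (Fun ε), (∀ k, ⁅D, fundSym ε p k⁆ = 0) →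
        ⁅D, a • shiftSym ε p + b • expSym ε p⁆ = 0 := fun D hD => by
      have hle : Submodule.span ℝ (Set.range (basicSym ε p ∘ Sum.inl)) ≤
          LinearMap.ker (LieAlgebra.ad ℝ (Derivation ℝ (Fun ε) (Fun ε)) D) := by
        rw [Submodule.span_le]
        rintro _ ⟨k, rfl⟩
        exact hD k
      exact hle hz
    have h1 := key _ (shiftSym_lie_fundSym hp)
    have h2 := key _ (expSym_lie_fundSym hp)
    simp only [lie_add, lie_smul, lie_self, hXE, hEX, smul_zero, zero_add, add_zero,
      smul_neg, neg_eq_zero] at h1 h2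
    rw [(smul_eq_zero.1 h2).resolve_right hE, (smul_eq_zero.1 h1).resolve_right hE]
    simp

theorem gradedSymmetries_eq_span (hp : p ≠ 1) :
    (gradedSymmetries ε p).toSubmodule = Submodule.span ℝ (Set.range (basicSym ε p)) := by
  have hm : ∀ i, basicSym ε p i ∈ Submodule.span ℝ (Set.range (basicSym ε p)) := fun i =>
    Submodule.subset_span ⟨i, rfl⟩
  refine le_antisymm (Submodule.span_le.2 ?_) (Submodule.span_le.2 ?_)
  · rintro S ⟨hS, κ, hκ⟩
    have hw : ⁅euler ε, S⁆ = κ • S := Derivation.ext hκ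
    by_cases h : ∃ k : ℤ, κ = -k
    · obtain ⟨k, rfl⟩ := h
      obtain ⟨t, a, b, rfl⟩ := eq_combination_of_weight hp k hS hw
      exact Submodule.sub_mem _ (Submodule.add_mem _ (Submodule.smul_mem _ _ (hm (Sum.inl k)))
        (Submodule.smul_mem _ _ (hm (Sum.inr 0)))) (Submodule.smul_mem _ _ (hm (Sum.inr 1)))
    · push Not at h
      obtain ⟨a, b, rfl⟩ := eq_combination_of_weight_ne hp h hS hw
      exact Submodule.sub_mem _ (Submodule.smul_mem _ _ (hm (Sum.inr 0)))
        (Submodule.smul_mem _ _ (hm (Sum.inr 1)))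
  · have key : ∀ {S : Derivation ℝ (Fun ε) (Fun ε)} (κ : ℝ), S ∈ symmetries ε p →
        ⁅euler ε, S⁆ = κ • S → S ∈ (gradedSymmetries ε p).toSubmodule := fun κ hS h =>
      Submodule.subset_span ⟨hS, κ, Derivation.congr_fun h⟩
    rintro _ ⟨k | i, rfl⟩
    · exact key _ (fundSym_mem hp k) (euler_lie_fundSym hp k)
    · fin_cases i
      · exact key 0 shiftSym_mem (by rw [zero_smul]; exact euler_lie_shiftSym)
      · exact key 1 (expSym_mem hp) (by rw [one_smul]; exact euler_lie_expSym hp)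

/-- The basis of the direct sum of the model algebras. -/
def modelBasis : Module.Basis (ℤ ⊕ Fin 2) ℝ (WittAlgebra × s2) := wittBasis.prod s2Basis

/-- The linear map from the model to the vector fields. -/
def modelMap (ε : ℤˣ) (p : ℤ) : WittAlgebra × s2 →ₗ[ℝ] Derivation ℝ (Fun ε) (Fun ε) :=
  modelBasis.constr ℝ (basicSym ε p)

theorem modelMap_basis (i : ℤ ⊕ Fin 2) : modelMap ε p (modelBasis i) = basicSym ε p i :=
  Module.Basis.constr_basis _ _ _ _

theorem modelMap_lie (hp : p ≠ 1) (a c : WittAlgebra × s2) :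
    modelMap ε p ⁅a, c⁆ = ⁅modelMap ε p a, modelMap ε p c⁆ := by
  have hl : ∀ k, modelBasis (Sum.inl k) = (wittBasis k, 0) := fun k =>
    Prod.ext (Module.Basis.prod_apply_inl_fst _ _ _) (Module.Basis.prod_apply_inl_snd _ _ _)
  have hr : ∀ i, modelBasis (Sum.inr i) = (0, s2Basis i) := fun i =>
    Prod.ext (Module.Basis.prod_apply_inr_fst _ _ _) (Module.Basis.prod_apply_inr_snd _ _ _)
  have h01 : ⁅modelBasis (Sum.inr 0), modelBasis (Sum.inr 1)⁆ = modelBasis (Sum.inr 1) := by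
    rw [hr, hr, LieAlgebra.Prod.bracket_apply, s2Basis_lie, lie_self]
  have hc : ∀ i k, ⁅basicSym ε p (Sum.inr i), fundSym ε p k⁆ = 0 := fun i k => by
    fin_cases i
    exacts [shiftSym_lie_fundSym hp k, expSym_lie_fundSym hp k]
  have hlr : ∀ k i, ⁅modelBasis (Sum.inl k), modelBasis (Sum.inr i)⁆ = 0 := fun k i => by
    rw [hr, hl, LieAlgebra.Prod.bracket_apply, lie_zero, zero_lie]
    rfl
  refine lie_of_basis modelBasis _ (fun i j => ?_) a c
  rcases i with k | i <;> rcases j with l | j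
  · have : ⁅modelBasis (Sum.inl k), modelBasis (Sum.inl l)⁆ =
        ((k : ℝ) - l) • modelBasis (Sum.inl (k + l)) := by
      rw [hl, hl, hl, LieAlgebra.Prod.bracket_apply, wittBasis_lie, lie_self, Prod.smul_mk, smul_zero]
    rw [this, map_smul, modelMap_basis, modelMap_basis, modelMap_basis]
    exact (fundSym_lie_fundSym hp k l).symm
  · rw [hlr, map_zero, modelMap_basis, modelMap_basis, ← lie_skew]
    exact (neg_eq_zero.2 (hc j k)).symm
  · rw [← lie_skew, hlr, neg_zero, map_zero, modelMap_basis, modelMap_basis]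
    exact (hc i l).symm
  · have hXE := shiftSym_lie_expSym (ε := ε) hp
    fin_cases i <;> fin_cases j
    · simp
    · change modelMap ε p ⁅modelBasis (Sum.inr 0), modelBasis (Sum.inr 1)⁆ =
        ⁅modelMap ε p (modelBasis (Sum.inr 0)), modelMap ε p (modelBasis (Sum.inr 1))⁆
      rw [h01, modelMap_basis, modelMap_basis]
      exact hXE.symm
    · change modelMap ε p ⁅modelBasis (Sum.inr 1), modelBasis (Sum.inr 0)⁆ =
        ⁅modelMap ε p (modelBasis (Sum.inr 1)), modelMap ε p (modelBasis (Sum.inr 0))⁆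
      rw [← lie_skew, h01, map_neg, ← lie_skew, modelMap_basis, modelMap_basis]
      exact congrArg Neg.neg hXE.symm
    · simp

theorem gradedSymmetries_equiv (ε : ℤˣ) (hp : p ≠ 1) :
    Nonempty (gradedSymmetries ε p ≃ₗ⁅ℝ⁆ WittAlgebra × s2) := by
  let f : WittAlgebra × s2 →ₗ⁅ℝ⁆ Derivation ℝ (Fun ε) (Fun ε) :=
    { modelMap ε p with map_lie' := fun {a c} => modelMap_lie hp a c }
  have hinj : Function.Injective f :=
    modelBasis.injective_constr_of_linearIndependent (linearIndependent_basicSym hp)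
  have hrange : ((f.range : LieSubalgebra ℝ _) : Set (Derivation ℝ (Fun ε) (Fun ε))) =
      gradedSymmetries ε p := by
    have h : LinearMap.range (modelMap ε p) = (gradedSymmetries ε p).toSubmodule := by
      rw [gradedSymmetries_eq_span hp, modelMap, Module.Basis.constr_range]
    exact Set.ext fun S => SetLike.ext_iff.1 h S
  exact ⟨((LieEquiv.ofInjective f hinj).trans (LieEquiv.ofEq _ _ hrange)).symm⟩

end UHEReduction

end

theorem mainTheorem1 (ε : ℤˣ) (p : ℤ) :
    Nonempty (UHEReduction.nonlocalSymmetries ε p ≃ₗ⁅ℝ⁆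
      UHEReduction.WittAlgebra × UHEReduction.s2) := by
  -- The effective parameter of the recursion is 2 for p = 1 and p otherwise, hence never 1.
  refine UHEReduction.gradedSymmetries_equiv ε ?_
  split_ifs with h
  · decide
  · exact h
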